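/- Let $k$ be a (commutative) field and $\mathcal{A}$ an essentially small additive category which is $k$-trivial: for all objects $x,y$, the group $\mathcal{A}(x,y)$ is finite and its order is invertible in $k$. \textbf{Notation.} Let $\mathbf{Rep}(\mathcal{A})$ be the category of additive functors $\mathcal{A}\to\mathbf{Ab}$ and $\mathcal{F}(\mathcal{A};k)$ the category of all functors from $\mathcal{A}$ to $k$-vector spaces. An object of $\mathbf{Rep}(\mathcal{A})$ is \emph{finite} if it is noetherian and artinian; its \emph{length} is then the length of a filtration with simple subquotients. It is \emph{finitely generated} if every (non-empty) upward directed family of subobjects whose supremum is the whole object contains the whole object, and \emph{finitely cogenerated} if every (non-empty) downward directed family of subobjects with intersection $0$ contains $0$. For $n\in\mathbb{N}$, let $\mathcal{L}_n$ be a complete system of representatives of the isomorphism classes of finite objects of length $n$ of $\mathbf{Rep}(\mathcal{A})$. For a ring $R$ (resp. an abelian category $\mathcal{E}$), $\operatorname{Irr}(R)$ (resp. $\operatorname{Irr}(\mathcal{E})$) is the set of isomorphism classes of simple left $R$-modules (resp. of simple objects of $\mathcal{E}$). For $A$ in $\mathbf{Rep}(\mathcal{A})$, let $k[A]$ be the composite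 of $A$ with the $k$-linearization of sets, and put $$Q_A=\operatorname{Coker}\Big(\bigoplus_{B\subsetneq A}k[B]\to k[A]\Big),\qquad Q^A=\operatorname{Ker}\Big(k[A]\to\prod_{0\neq B\subset A}k[A/B]\Big),$$ both with their natural action of $\operatorname{Aut}(A)$. For a $k[\operatorname{Aut}(A)]$-module $M$, let $Q(A,M)$ be the image of the morphism $$M\underset{k[\operatorname{Aut}(A)]}{\otimes}Q^A\to M\underset{k[\operatorname{Aut}(A)]}{\otimes}Q_A$$ induced by $Q^A\hookrightarrow k[A]\twoheadrightarrow Q_A$, where $M\otimes_{k[G]}X$ means the coinvariants $(M\otimes_k X)_G$ for the diagonal action. For an object $x$ of $\mathcal{A}$ and $F$ in $\mathcal{F}(\mathcal{A};k)$, let $\tau_x(F)=F(x\oplus -)$, let $\bar\tau_x(F)(a)=F(x\oplus a)_{\mathcal{A}(x,a)}$ (coinvariants, $u\in\mathcal{A}(x,a)$ acting through the automorphism $\begin{pmatrix}1&0\\u&1\end{pmatrix}$ of $x\oplus a$), and let $\bar\delta_x(F)$ be the cokernel of the morphism $F\to\bar\tau_x(F)$ induced by the inclusions $a\to x\oplus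 a$. For $d\in\mathbb{N}$, $\mathcal{F}_d(\mathcal{A};k)$ is the full subcategory of $\mathcal{F}(\mathcal{A};k)$ of those $F$ with $\bar\delta_{a_0}\cdots\bar\delta_{a_d}\tau_x(F)=0$ for all objects $a_0,\dots,a_d,x$ of $\mathcal{A}$. \textbf{Theorem.} \begin{enumerate} \item If $A$ is a finite object of $\mathbf{Rep}(\mathcal{A})$ and $M$ a simple $k[\operatorname{Aut}(A)]$-module, then $Q(A,M)$ is a simple object of $\mathcal{F}(\mathcal{A};k)$. \item For every $d\in\mathbb{N}$, the assignment $(n,A,[M])\mapsto[Q(A,M)]$ is a well-defined bijection $$\bigsqcup_{n\le d,\ A\in\mathcal{L}_n}\operatorname{Irr}(k[\operatorname{Aut}(A)])\xrightarrow{\ \simeq\ }\operatorname{Irr}(\mathcal{F}_d(\mathcal{A};k)).$$ \item If every object of $\mathbf{Rep}(\mathcal{A})$ which is both finitely generated and finitely cogenerated is finite, then $(n,A,[M])\mapsto[Q(A,M)]$ is a well-defined bijection $$\bigsqcup_{n\in\mathbb{N},\ A\in\mathcal{L}_n}\operatorname{Irr}(k[\operatorname{Aut}(A)])\xrightarrow{\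 \simeq\ }\operatorname{Irr}(\mathcal{F}(\mathcal{A};k)).$$ This hypothesis holds in particular if $\mathbf{Rep}(\mathcal{A})$ is locally finite, i.e. generated by its finite objects. \end{enumerate} -/

import Mathlib

open CategoryTheory CategoryTheory.Limits

universe u v w

namespace AntiPoly

noncomputable section

/-! ### Simple objects -/

/-- Isomorphism of simple objects, as an equivalence relation. -/
def simpleSetoid (E : Type u) [Category.{w} E] [HasZeroMorphisms E] :
    Setoid {X : E // Simple X} where
  r X Y := Nonempty (X.1 ≅ Y.1)
  iseqv :=
    { refl := fun X => ⟨Iso.refl X.1⟩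
      symm := fun ⟨e⟩ => ⟨e.symm⟩
      trans := fun ⟨e⟩ ⟨e'⟩ => ⟨e.trans e'⟩ }

/-- `Irr E`: the isomorphism classes of simple objects of `E`. -/
def Irr (E : Type u) [Category.{w} E] [HasZeroMorphisms E] : Type u :=
  Quotient (simpleSetoid E)

/-- The class `[X]` of a simple object `X`. -/
def Irr.mk {E : Type u} [Category.{w} E] [HasZeroMorphisms E] (X : E) (hX : Simple X) : Irr E :=
  Quotient.mk (simpleSetoid E) ⟨X, hX⟩

/-! ### Additive representations of an additive category -/

/-- `C` is `k`-trivial: every Hom group is finite, of order invertible in `k`. -/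
def IsKTrivial (k : Type v) [Field k] (C : Type u) [Category.{v} C] : Prop :=
  ∀ x y : C, Finite (x ⟶ y) ∧ (Nat.card (x ⟶ y) : k) ≠ 0

/-- The category of additive functors from `C` to abelian groups. -/
abbrev AddRep (C : Type u) [Category.{v} C] [Preadditive C] := C ⥤+ AddCommGrpCat.{v}

section AddRep

variable {C : Type u} [Category.{v} C] [Preadditive C]

/-- A subfunctor of an additive functor. -/
@[ext]
structure SubRep (A : AddRep C) where
  /-- the subgroup at each object -/
  obj : ∀ a : C, AddSubgroup (A.obj.obj a)
  map_mem : ∀ {a b : C} (f : a ⟶ b) (ξ : A.obj.obj a), ξ ∈ obj a → A.obj.map f ξ ∈ obj b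

instance (A : AddRep C) : PartialOrder (SubRep A) :=
  PartialOrder.lift SubRep.obj fun _ _ h => SubRep.ext h

instance (A : AddRep C) : BoundedOrder (SubRep A) where
  top := { obj := fun _ => ⊤, map_mem := fun _ _ _ => AddSubgroup.mem_top _ }
  le_top _ := fun _ => le_top
  bot :=
    { obj := fun _ => ⊥
      map_mem := fun f ξ h => by
        rw [AddSubgroup.mem_bot] at h ⊢
        rw [h, map_zero] }
  bot_le _ := fun _ => bot_le

/-- Finite objects: both noetherian and artinian. -/
def IsFiniteRep : ObjectProperty (AddRep C) :=
  fun A => WellFoundedGT (SubRep A) ∧ WellFoundedLT (SubRep A)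

/-- `A` has a finite filtration `0 = A₀ ⋖ A₁ ⋖ ⋯ ⋖ Aₙ = A`, where each term is maximal among the
proper subfunctors of the next one, i.e. the subquotients are simple. -/
def HasLength (A : AddRep C) (n : ℕ) : Prop :=
  ∃ s : RelSeries {(B, B') : SubRep A × SubRep A | B ⋖ B'},
    s.head = ⊥ ∧ s.last = ⊤ ∧ s.length = n

/-- Finitely generated objects: a directed family of subfunctors with supremum `A` contains `A`. -/
def IsFinGen (A : AddRep C) : Prop :=
  ∀ S : Set (SubRep A), S.Nonempty → DirectedOn (· ≤ ·) S → IsLUB S ⊤ → ⊤ ∈ S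

/-- Finitely cogenerated objects: a codirected family of subfunctors with infimum `0`
contains `0`. -/
def IsFinCogen (A : AddRep C) : Prop :=
  ∀ S : Set (SubRep A), S.Nonempty → DirectedOn (· ≥ ·) S → IsGLB S ⊥ → ⊥ ∈ S

/-- `L n` is a complete system of representatives of the isomorphism classes of finite
objects of length `n`, for every `n`. -/
def IsSystemOfReps (L : ℕ → Set (AddRep C)) : Prop :=
  ∀ n : ℕ, (∀ A ∈ L n, IsFiniteRep A ∧ HasLength A n) ∧
    ∀ A : AddRep C, IsFiniteRep A → HasLength A n → ∃! B, B ∈ L n ∧ Nonempty (A ≅ B)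

end AddRep

/-! ### The functors `Q_A`, `Q^A` and `Q(A, M)` -/

section Q

variable (k : Type v) [Field k] {C : Type u} [Category.{v} C] [Preadditive C]

/-- `k[A(a)]`, with the action of `Aut A`. -/
def linRho (A : AddRep C) (a : C) : Representation k (Aut A) (A.obj.obj a →₀ k) where
  toFun g := Finsupp.lmapDomain k k (g.hom.hom.app a)
  map_one' := by
    ext x : 2
    simp
    rfl
  map_mul' g h := by
    ext x : 2
    simp
    rfl

/-- The linearization `k[A]`, as a functor to `k`-linear representations of `Aut A`. -/
def lin (A : AddRep C) : C ⥤ Rep.{v} k (Aut A) where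
  obj a := Rep.of (linRho k A a)
  map {a b} f := Rep.ofHom
    ⟨Finsupp.lmapDomain k k (A.obj.map f), fun g => by
      ext x : 2
      have := ConcreteCategory.congr_hom (g.hom.hom.naturality f) x
      simp only [ConcreteCategory.comp_apply] at this
      simp [linRho, this]⟩
  map_id a := by
    ext x : 4
    simp
  map_comp f g := by
    ext x : 4
    simp

/-- The value at `a` of the image of `⨁_{B ⊊ A} k[B] ⟶ k[A]`. -/
def lowerKer (A : AddRep C) (a : C) : Submodule k (A.obj.obj a →₀ k) :=
  ⨆ (B : SubRep A) (_ : B ≠ ⊤),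
    LinearMap.range (Finsupp.lmapDomain k k (Subtype.val : B.obj a → A.obj.obj a))

/-- The value at `a` of the kernel of `k[A] ⟶ ∏_{0 ≠ B ⊆ A} k[A/B]`. -/
def upperKer (A : AddRep C) (a : C) : Submodule k (A.obj.obj a →₀ k) :=
  ⨅ (B : SubRep A) (_ : B ≠ ⊥),
    LinearMap.ker (Finsupp.lmapDomain k k
      (QuotientAddGroup.mk : A.obj.obj a → A.obj.obj a ⧸ B.obj a))

/-- Inverse image of a subfunctor. -/
def SubRep.comap {A A' : AddRep C} (φ : A ⟶ A') (B : SubRep A') : SubRep A where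
  obj a := (B.obj a).comap (φ.hom.app a).hom
  map_mem {a b} f ξ h := by
    have := ConcreteCategory.congr_hom (φ.hom.naturality f) ξ
    simp only [ConcreteCategory.comp_apply] at this
    have h2 := B.map_mem f _ h
    rw [AddSubgroup.mem_comap]
    exact this ▸ h2

theorem aut_apply_inv (A : AddRep C) (g : Aut A) (a : C) (x : A.obj.obj a) :
    g.hom.hom.app a (g.inv.hom.app a x) = x := by
  have h : (g.inv ≫ g.hom).hom.app a = 𝟙 _ := by rw [g.inv_hom_id]; rfl
  exact ConcreteCategory.congr_hom h x

theorem aut_inv_apply (A : AddRep C) (g : Aut A) (a : C) (x : A.obj.obj a) :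
    g.inv.hom.app a (g.hom.hom.app a x) = x := by
  have h : (g.hom ≫ g.inv).hom.app a = 𝟙 _ := by rw [g.hom_inv_id]; rfl
  exact ConcreteCategory.congr_hom h x

theorem lowerKer_map (A : AddRep C) {a b : C} (f : a ⟶ b) :
    lowerKer k A a ≤ (lowerKer k A b).comap (Finsupp.lmapDomain k k (A.obj.map f)) := by
  refine iSup₂_le fun B hB => ?_
  rintro _ ⟨y, rfl⟩
  refine Submodule.mem_iSup_of_mem B (Submodule.mem_iSup_of_mem hB ?_)
  refine ⟨Finsupp.lmapDomain k k (fun z : B.obj a => (⟨A.obj.map f z.1,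
    B.map_mem f z.1 z.2⟩ : B.obj b)) y, ?_⟩
  simp only [Finsupp.lmapDomain_apply, ← Finsupp.mapDomain_comp]
  rfl

theorem lowerKer_aut (A : AddRep C) (a : C) (g : Aut A) :
    lowerKer k A a ≤ (lowerKer k A a).comap (linRho k A a g) := by
  refine iSup₂_le fun B hB => ?_
  rintro _ ⟨y, rfl⟩
  have hB' : B.comap g.inv ≠ ⊤ := by
    intro h
    apply hB
    ext c x
    have hx : g.hom.hom.app c x ∈ (B.comap g.inv).obj c := by rw [h]; exact AddSubgroup.mem_top _
    have hx' : g.inv.hom.app c (g.hom.hom.app c x) ∈ B.obj c := hx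
    rw [aut_inv_apply] at hx'
    exact ⟨fun _ => AddSubgroup.mem_top _, fun _ => hx'⟩
  refine Submodule.mem_iSup_of_mem (B.comap g.inv) (Submodule.mem_iSup_of_mem hB' ?_)
  refine ⟨Finsupp.lmapDomain k k (fun z : B.obj a => (⟨g.hom.hom.app a z.1, by
    change g.inv.hom.app a (g.hom.hom.app a z.1) ∈ B.obj a
    rw [aut_inv_apply]
    exact z.2⟩ : (B.comap g.inv).obj a)) y, ?_⟩
  change Finsupp.mapDomain _ (Finsupp.mapDomain _ y) = Finsupp.mapDomain _ (Finsupp.mapDomain _ y)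
  simp only [← Finsupp.mapDomain_comp]
  rfl

theorem upperKer_map (A : AddRep C) {a b : C} (f : a ⟶ b) :
    upperKer k A a ≤ (upperKer k A b).comap (Finsupp.lmapDomain k k (A.obj.map f)) := by
  intro y hy
  simp only [upperKer, Submodule.mem_iInf, Submodule.mem_comap, LinearMap.mem_ker] at hy ⊢
  intro B hB
  have h := congrArg (Finsupp.lmapDomain k k (QuotientAddGroup.map (B.obj a) (B.obj b)
    (A.obj.map f).hom (fun ξ hξ => B.map_mem f ξ hξ))) (hy B hB)
  rw [map_zero] at h
  rw [← h]
  simp only [Finsupp.lmapDomain_apply, ← Finsupp.mapDomain_comp]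
  rfl

theorem upperKer_aut (A : AddRep C) (a : C) (g : Aut A) :
    upperKer k A a ≤ (upperKer k A a).comap (linRho k A a g) := by
  intro y hy
  simp only [upperKer, Submodule.mem_iInf, Submodule.mem_comap, LinearMap.mem_ker] at hy ⊢
  intro B hB
  have hB' : B.comap g.hom ≠ ⊥ := by
    intro h
    apply hB
    ext c x
    refine ⟨fun hx => ?_, fun hx => ?_⟩
    · have hx' : g.inv.hom.app c x ∈ (B.comap g.hom).obj c := by
        change g.hom.hom.app c (g.inv.hom.app c x) ∈ B.obj c
        rw [aut_apply_inv]
        exact hx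
      rw [h] at hx'
      have h0 : g.inv.hom.app c x = 0 := hx'
      have h1 := aut_apply_inv A g c x
      rw [h0, map_zero] at h1
      rw [← h1]
      exact zero_mem _
    · have h0 : x = 0 := hx
      rw [h0]
      exact zero_mem _
  have h := congrArg (Finsupp.lmapDomain k k (QuotientAddGroup.map ((B.comap g.hom).obj a)
    (B.obj a) (g.hom.hom.app a).hom (fun ξ hξ => hξ))) (hy _ hB')
  rw [map_zero] at h
  rw [← h]
  change Finsupp.mapDomain _ (Finsupp.mapDomain _ y) = Finsupp.mapDomain _ (Finsupp.mapDomain _ y)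
  simp only [← Finsupp.mapDomain_comp]
  rfl

/-- The action of `Aut A` on `Q_A(a)`. -/
def lowerRho (A : AddRep C) (a : C) :
    Representation k (Aut A) ((A.obj.obj a →₀ k) ⧸ lowerKer k A a) :=
  Representation.quotient (linRho k A a) (lowerKer k A a) (lowerKer_aut k A a)

/-- `Q_A`, the cokernel of `⨁_{B ⊊ A} k[B] ⟶ k[A]`, with its action of `Aut A`. -/
def qLower (A : AddRep C) : C ⥤ Rep.{v} k (Aut A) where
  obj a := Rep.of (lowerRho k A a)
  map {a b} f := Rep.ofHom
    ⟨Submodule.mapQ _ _ (Finsupp.lmapDomain k k (A.obj.map f)) (lowerKer_map k A f), fun g => by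
      ext x : 3
      exact congrArg (Submodule.Quotient.mk (p := lowerKer k A b))
        (LinearMap.congr_fun (((lin k A).map f).hom.2 g) (Finsupp.single x 1))⟩
  map_id a := by
    ext x : 5
    simp
  map_comp f g := by
    ext x : 5
    simp

/-- The action of `Aut A` on `Q^A(a)`. -/
def upperRho (A : AddRep C) (a : C) : Representation k (Aut A) (upperKer k A a) :=
  Representation.subrepresentation (linRho k A a) (upperKer k A a) (upperKer_aut k A a)

/-- The map `Q^A(a) → Q^A(b)` induced by `f : a ⟶ b`. -/
def upperMap (A : AddRep C) {a b : C} (f : a ⟶ b) :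
    (upperRho k A a).IntertwiningMap (upperRho k A b) where
  toLinearMap := (Finsupp.lmapDomain k k (A.obj.map f)).restrict (upperKer_map k A f)
  isIntertwining' g := by
    refine LinearMap.ext fun x => Subtype.ext ?_
    exact LinearMap.congr_fun (((lin k A).map f).hom.2 g) x.1

/-- `Q^A(a)` as a representation of `Aut A`. -/
def upperObj (A : AddRep C) (a : C) : Rep.{v} k (Aut A) :=
  Rep.of (X := upperKer k A a) (upperRho k A a)

/-- `Q^A`, the kernel of `k[A] ⟶ ∏_{0 ≠ B ⊆ A} k[A/B]`, with its action of `Aut A`. -/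
def qUpper (A : AddRep C) : C ⥤ Rep.{v} k (Aut A) where
  obj a := upperObj k A a
  map {a b} f := Rep.ofHom (upperMap k A f)
  map_id a := by
    refine Rep.hom_ext (Representation.IntertwiningMap.ext
      (LinearMap.ext fun x => Subtype.ext ?_))
    exact congrArg (fun φ => φ.hom x.1) ((lin k A).map_id a)
  map_comp f g := by
    refine Rep.hom_ext (Representation.IntertwiningMap.ext
      (LinearMap.ext fun x => Subtype.ext ?_))
    exact congrArg (fun φ => φ.hom x.1) ((lin k A).map_comp f g)

/-- The composite `Q^A(a) → k[A(a)] → Q_A(a)` of the inclusion and the projection. -/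
def upperToLower (A : AddRep C) (a : C) :
    (upperRho k A a).IntertwiningMap (lowerRho k A a) where
  toLinearMap := (lowerKer k A a).mkQ ∘ₗ (upperKer k A a).subtype
  isIntertwining' _ := rfl

/-- The composite `Q^A ⟶ k[A] ⟶ Q_A` of the inclusion and the projection. -/
def qUpperToLower (A : AddRep C) : qUpper k A ⟶ qLower k A where
  app a := Rep.ofHom (upperToLower k A a)
  naturality _ _ _ := rfl

variable {k}

/-- The functor `M ⊗_{k[G]} -`, i.e. `X ↦ (M ⊗ X)_G` for the diagonal action of `G`. -/
def tensorOver {G : Type w} [Group G] (M : ModuleCat.{v} (MonoidAlgebra k G)) :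
    Rep.{v} k G ⥤ ModuleCat.{v} k :=
  (Rep.coinvariantsTensor k G).obj (Rep.ofModuleMonoidAlgebra.obj M)

/-- `Q(A, M)`: the image of the morphism `M ⊗_{k[Aut A]} Q^A ⟶ M ⊗_{k[Aut A]} Q_A = Q_{A, M}`
obtained by applying `M ⊗_{k[Aut A]} -` to `Q^A ↪ k[A] ↠ Q_A`.
(When `A` is finite and `C` is `k`-trivial, the norm
identifies its source with the invariants `Q^{A, M} = (M ⊗ Q^A)^{Aut A}`; the image is the
same.) -/
def Q (A : AddRep C) (M : ModuleCat.{v} (MonoidAlgebra k (Aut A))) : C ⥤ ModuleCat.{v} k :=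
  image (Functor.whiskerRight (qUpperToLower k A) (tensorOver M))

end Q

/-! ### The subcategories `F_d` -/

section Fd

variable {k : Type v} [Field k] {C : Type u} [Category.{v} C] [Preadditive C]
  [HasBinaryBiproducts C]

/-- The functor `x ⊕ - : C ⥤ C`. -/
def biprodLeft (x : C) : C ⥤ C where
  obj a := x ⊞ a
  map f := biprod.map (𝟙 x) f

/-- The shift `τ_x F = F(x ⊕ -)`. -/
def tau (x : C) (F : C ⥤ ModuleCat.{v} k) : C ⥤ ModuleCat.{v} k :=
  biprodLeft x ⋙ F

/-- The endomorphism of `x ⊕ a` with matrix `(1 0; u 1)`. -/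
def transvection {x a : C} (u : x ⟶ a) : x ⊞ a ⟶ x ⊞ a :=
  biprod.lift biprod.fst (biprod.fst ≫ u + biprod.snd)

/-- The span of the `u • y - y`, for `u` in `C(x, a)` and `y` in `F(x ⊕ a)`. -/
def coinvKer (x : C) (F : C ⥤ ModuleCat.{v} k) (a : C) : Submodule k (F.obj (x ⊞ a)) :=
  Submodule.span k
    (Set.range fun p : (x ⟶ a) × F.obj (x ⊞ a) => F.map (transvection p.1) p.2 - p.2)

theorem coinvKer_map (x : C) (F : C ⥤ ModuleCat.{v} k) {a b : C} (f : a ⟶ b) :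
    coinvKer x F a ≤ (coinvKer x F b).comap (F.map (biprod.map (𝟙 x) f)).hom := by
  refine Submodule.span_le.2 ?_
  rintro _ ⟨⟨u, y⟩, rfl⟩
  refine Submodule.subset_span ⟨(u ≫ f, F.map (biprod.map (𝟙 x) f) y), ?_⟩
  have h : biprod.map (𝟙 x) f ≫ transvection (u ≫ f) =
      transvection u ≫ biprod.map (𝟙 x) f := by
    ext <;> simp [transvection]
  have h' := ConcreteCategory.congr_hom (congrArg F.map h) y
  simp only [Functor.map_comp, ConcreteCategory.comp_apply] at h'
  change F.map (transvection (u ≫ f)) (F.map (biprod.map (𝟙 x) f) y) -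
    F.map (biprod.map (𝟙 x) f) y = F.map (biprod.map (𝟙 x) f) (F.map (transvection u) y - y)
  rw [map_sub, h']

/-- The parabolic shift: `a ↦ F(x ⊕ a)_{C(x, a)}` (coinvariants). -/
def barTau (x : C) (F : C ⥤ ModuleCat.{v} k) : C ⥤ ModuleCat.{v} k where
  obj a := ModuleCat.of k (F.obj (x ⊞ a) ⧸ coinvKer x F a)
  map {a b} f := ModuleCat.ofHom
    (Submodule.mapQ _ _ (F.map (biprod.map (𝟙 x) f)).hom (coinvKer_map x F f))
  map_id a := by
    have h : biprod.map (𝟙 x) (𝟙 a) = 𝟙 (x ⊞ a) := by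
      ext <;> simp
    ext y
    simp [h]
  map_comp f g := by
    ext y
    have h : biprod.map (𝟙 x) (f ≫ g) = biprod.map (𝟙 x) f ≫ biprod.map (𝟙 x) g := by
      ext <;> simp
    simp [h]

/-- The canonical map `F ⟶ τ̄_x F`, given by `F(a) → F(x ⊕ a) ↠ F(x ⊕ a)_{C(x, a)}`. -/
def toBarTau (x : C) (F : C ⥤ ModuleCat.{v} k) : F ⟶ barTau x F where
  app a := ModuleCat.ofHom ((coinvKer x F a).mkQ ∘ₗ (F.map (biprod.inr : a ⟶ x ⊞ a)).hom)
  naturality a b f := by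
    have h : f ≫ (biprod.inr : b ⟶ x ⊞ b) = biprod.inr ≫ biprod.map (𝟙 x) f := by simp
    have h' := congrArg F.map h
    rw [F.map_comp, F.map_comp] at h'
    ext y
    exact congrArg (coinvKer x F b).mkQ (ConcreteCategory.congr_hom h' y)

/-- The parabolic difference functor: `δ̄_x F` is the cokernel of `F ⟶ τ̄_x F`. -/
def barDelta (x : C) (F : C ⥤ ModuleCat.{v} k) : C ⥤ ModuleCat.{v} k :=
  cokernel (toBarTau x F)

/-- `F_d(C; k)`: the functors `F` with `δ̄_{a_0} ⋯ δ̄_{a_d} τ_x F = 0` for all objects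
`a_0, …, a_d, x`. -/
def Fd (k : Type v) [Field k] (C : Type u) [Category.{v} C] [Preadditive C]
    [HasBinaryBiproducts C] (d : ℕ) : ObjectProperty (C ⥤ ModuleCat.{v} k) :=
  fun F => ∀ (l : List C) (x : C), l.length = d + 1 → IsZero (l.foldr barDelta (tau x F))

end Fd

end

end AntiPoly

namespace AntiPoly

noncomputable section

/-! ### Sums over finite abelian groups -/

/-! Everything is averaging over finite groups whose orders are invertible in `k`. The whole
argument runs for objects `A` having a generator `v ∈ A(a)` and a cogenerating object
(`IsGenCogen`); a noetherian `A` has the former, an artinian `A` the latter.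

Simplicity. For `η ∈ Q^A(b)`, the element `∑ η(A(f)(v)) f` of `k[C(a, b)]` sends `[w]` to a multiple
of `σ_* η` if `w = σ v` for an automorphism `σ`, and to `0` otherwise, because then `η` is summed
over cosets of a nonzero subfunctor. Applied to `t ∈ M ⊗ Q^A`, it therefore extracts `m ⊗ η`, up to
an invertible factor, where `m` is the coefficient at `v` of the image of `t` in `M ⊗ Q_A`
(`sum_map_upperTensor`). If `M` is simple, a subfunctor of `M ⊗ Q^A` with nonzero image in `M ⊗ Q_A`
is thus everything, so `Q(A, M)` is simple and is the only simple quotient of `M ⊗ Q^A`.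

Injectivity. Applying such an element to both descriptions of `Q(A, M) ≅ Q(A', M')` shows that `A`
is a quotient of a subfunctor of `A'`. By symmetry and a count of elements `A ≅ A'`, and the same
identity then compares `M` with `M'`.

Surjectivity. A nonzero `ξ ∈ S(x)` of a simple `S` gives a nonzero map `k[C(x, -)] ⟶ S`. Choosing a
subfunctor `B` of `C(x, -)` as large as possible at `x`, and then as many vanishing conditions as
possible, turns it into a nonzero map `Q^A ⟶ S` with `A = C(x, -)/B` (`exists_supports`,
`exists_upperFam`). The maps `Q^A ⟶ S` generated by it under `k[Aut A]` contain a simple module `M`,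
and `S ≅ Q(A, M)`.

Degree. `δ̄_x k[A]` is the sum of the `k[A/⟨v⟩]` over the nonzero `v ∈ A(x)`, so each difference
consumes at least one unit of length; hence `Q(A, M)`, a subfunctor of a quotient of copies of
`k[A]`, lies in `F_d` when `A` has length at most `d`. Conversely `k[A]` embeds into a shift of
`Q(A, M)`, and `δ̄` preserves monomorphisms, so `Q(A, M) ∈ F_d` bounds the length of `A` by `d`. -/

theorem sum_comp_surjective {H K N : Type*} [AddCommGroup H] [AddCommGroup K] [Fintype H]
    [Fintype K] [AddCommMonoid N] (p : H →+ K) (hp : Function.Surjective p) (g : K → N) :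
    ∑ h, g (p h) = Nat.card p.ker • ∑ n, g n := by
  classical
  rw [← Finset.sum_fiberwise (s := Finset.univ) (g := p), Finset.smul_sum]
  refine Finset.sum_congr rfl fun n _ => ?_
  obtain ⟨h₀, rfl⟩ := hp n
  rw [Finset.sum_congr rfl (g := fun _ => g (p h₀))
    (fun h hh => by rw [(Finset.mem_filter.1 hh).2]), Finset.sum_const]
  congr 1
  rw [Nat.card_eq_fintype_card, ← Fintype.card_coe]
  refine Fintype.card_congr
    { toFun := fun h => ⟨h.1 - h₀, by
        have := (Finset.mem_filter.1 h.2).2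
        rw [AddMonoidHom.mem_ker, map_sub, this, sub_self]⟩
      invFun := fun z => ⟨z.1 + h₀, by
        have := z.2
        rw [AddMonoidHom.mem_ker] at this
        simp [this]⟩
      left_inv := fun h => by simp
      right_inv := fun z => by simp }

section Translation

variable (k : Type*) [Field k] {V : Type*} [AddCommGroup V]

/-- The kernel of `k[V] → k[V/N]`. -/
def cosetKer (N : AddSubgroup V) : Submodule k (V →₀ k) :=
  LinearMap.ker (Finsupp.lmapDomain k k (QuotientAddGroup.mk : V → V ⧸ N))

variable {k}

theorem mem_cosetKer {N : AddSubgroup V} {ξ : V →₀ k} :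
    ξ ∈ cosetKer k N ↔ ξ.mapDomain (QuotientAddGroup.mk : V → V ⧸ N) = 0 := Iff.rfl

/-- The map `g` need not be additive: preserving congruence is enough for it to descend to cosets.
This covers translations and set-theoretic sections. -/
theorem cosetKer_map {W : Type*} [AddCommGroup W] {N : AddSubgroup V} {N' : AddSubgroup W}
    (g : V → W) (hg : ∀ x y, -x + y ∈ N → -g x + g y ∈ N') {ξ : V →₀ k}
    (hξ : ξ ∈ cosetKer k N) : ξ.mapDomain g ∈ cosetKer k N' := by
  rw [mem_cosetKer] at hξ ⊢
  have h := congrArg (Finsupp.mapDomain (Quotient.map' (s₁ := QuotientAddGroup.leftRel N)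
    (s₂ := QuotientAddGroup.leftRel N') g
    (fun x y h => QuotientAddGroup.leftRel_apply.2 (hg x y (QuotientAddGroup.leftRel_apply.1 h)))))
    hξ
  rw [Finsupp.mapDomain_zero, ← Finsupp.mapDomain_comp] at h
  rw [← Finsupp.mapDomain_comp, ← h]
  rfl

theorem cosetKer_mono {N N' : AddSubgroup V} (h : N ≤ N') : cosetKer k N ≤ cosetKer k N' := by
  intro ξ hξ
  have := cosetKer_map (N' := N') (id : V → V) (fun x y hxy => h hxy) hξ
  rwa [Finsupp.mapDomain_id] at this

theorem cosetKer_bot : cosetKer k (⊥ : AddSubgroup V) = ⊥ := by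
  rw [eq_bot_iff]
  intro ξ hξ
  rw [mem_cosetKer] at hξ
  have hinj : Function.Injective (QuotientAddGroup.mk : V → V ⧸ (⊥ : AddSubgroup V)) := by
    intro x y hxy
    have := QuotientAddGroup.eq.1 hxy
    rw [AddSubgroup.mem_bot] at this
    exact (neg_add_eq_zero.1 this)
  exact Finsupp.mapDomain_injective hinj (by rw [hξ, Finsupp.mapDomain_zero])

/-- The sum over `x + N` is the coefficient of that coset in the image of `ξ` in `k[V/N]`. -/
theorem cosetSum_eq_zero {N : AddSubgroup V} [Fintype N] {ξ : V →₀ k}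
    (hξ : ξ ∈ cosetKer k N) (x : V) : ∑ n : N, ξ (x + n) = 0 := by
  classical
  rw [mem_cosetKer] at hξ
  have h := DFunLike.congr_fun hξ (QuotientAddGroup.mk x)
  rw [Finsupp.mapDomain, Finsupp.sum_apply, Finsupp.zero_apply] at h
  rw [← h, Finsupp.sum]
  simp only [Finsupp.single_apply]
  rw [← Finset.sum_filter]
  refine Finset.sum_bij_ne_zero (fun n _ _ => x + n) ?_ ?_ ?_ ?_
  · intro n _ hn
    rw [Finset.mem_filter, Finsupp.mem_support_iff]
    refine ⟨hn, ?_⟩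
    rw [QuotientAddGroup.eq]
    simp
  · intro a _ _ b _ _ hab
    exact Subtype.ext (add_left_cancel hab)
  · intro b hb hb'
    rw [Finset.mem_filter] at hb
    have := QuotientAddGroup.eq.1 hb.2.symm
    exact ⟨⟨-x + b, this⟩, Finset.mem_univ _, by simpa using hb', by simp⟩
  · intros; rfl

/-- Translation by `n` on `k[V]`. -/
def shift (n : V) : (V →₀ k) →ₗ[k] (V →₀ k) := Finsupp.lmapDomain k k (fun x => x + n)

theorem shift_shift (m n : V) (ξ : V →₀ k) : shift m (shift n ξ) = shift (n + m) ξ := by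
  simp only [shift, Finsupp.lmapDomain_apply, ← Finsupp.mapDomain_comp]
  congr 1
  funext x
  simp [add_assoc]

theorem shift_sub_mem {N : AddSubgroup V} {n : V} (hn : n ∈ N) (ξ : V →₀ k) :
    shift n ξ - ξ ∈ cosetKer k N := by
  rw [cosetKer, LinearMap.mem_ker, map_sub, sub_eq_zero, shift, Finsupp.lmapDomain_apply,
    Finsupp.lmapDomain_apply, Finsupp.lmapDomain_apply, ← Finsupp.mapDomain_comp]
  congr 1
  funext x
  exact (QuotientAddGroup.eq.2 (by simpa using hn)).symm

variable (k) in
/-- The average of the translations by the elements of `N`. -/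
def avg (N : AddSubgroup V) [Fintype N] : (V →₀ k) →ₗ[k] (V →₀ k) :=
  (Fintype.card N : k)⁻¹ • ∑ n : N, shift n.1

theorem avg_apply (N : AddSubgroup V) [Fintype N] (ξ : V →₀ k) :
    avg k N ξ = (Fintype.card N : k)⁻¹ • ∑ n : N, shift n.1 ξ := by
  simp [avg]

variable {N N' : AddSubgroup V} [Fintype N] [Fintype N']

theorem avg_sub_mem (hN : (Fintype.card N : k) ≠ 0) (ξ : V →₀ k) :
    avg k N ξ - ξ ∈ cosetKer k N := by
  have : avg k N ξ - ξ = (Fintype.card N : k)⁻¹ • ∑ n : N, (shift n.1 ξ - ξ) := by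
    rw [avg_apply, Finset.sum_sub_distrib, smul_sub, Finset.sum_const, Finset.card_univ,
      ← Nat.cast_smul_eq_nsmul k, smul_smul, inv_mul_cancel₀ hN, one_smul]
  rw [this]
  exact Submodule.smul_mem _ _ (Submodule.sum_mem _ fun n _ => shift_sub_mem n.2 ξ)

theorem avg_eq_zero {ξ : V →₀ k} (hξ : ξ ∈ cosetKer k N) : avg k N ξ = 0 := by
  rw [avg_apply]
  convert smul_zero _
  ext x
  rw [Finsupp.finsetSum_apply, Finsupp.zero_apply, ← cosetSum_eq_zero hξ x]
  -- The coefficient at `x` of the translate by `n` is `ξ (x - n)`, whence the change of sign.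
  refine Fintype.sum_equiv (Equiv.neg N) _ _ fun n => ?_
  have : x = (x + (-n.1)) + n.1 := by abel
  conv_lhs => rw [this]
  rw [shift, Finsupp.lmapDomain_apply,
    Finsupp.mapDomain_apply (f := fun x => x + n.1) (add_left_injective n.1)]
  rfl

theorem mem_cosetKer_of_avg (hN : (Fintype.card N : k) ≠ 0) {ξ : V →₀ k} (h : avg k N ξ = 0) :
    ξ ∈ cosetKer k N := by
  have := avg_sub_mem hN ξ
  rw [h, zero_sub] at this
  simpa using this

theorem avg_shift (ξ : V →₀ k) {n : V} (hn : n ∈ N) : avg k N (shift n ξ) = avg k N ξ := by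
  have := avg_eq_zero (shift_sub_mem hn ξ)
  rwa [map_sub, sub_eq_zero] at this

theorem avg_shift_comm (ξ : V →₀ k) (n : V) : avg k N (shift n ξ) = shift n (avg k N ξ) := by
  simp only [avg_apply, map_smul, map_sum, shift_shift, add_comm]

/-- Averages absorb translations by their own group and commute with all others, so `avg N ∘ avg N'`
is invariant under translation by `N ⊔ N'` and kills `ξ`; the kernel of `avg N` is `cosetKer k N`.
-/
theorem avg_mem_cosetKer (hN : (Fintype.card N : k) ≠ 0)
    {ξ : V →₀ k} (hξ : ξ ∈ cosetKer k (N ⊔ N')) : avg k N' ξ ∈ cosetKer k N := by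
  refine mem_cosetKer_of_avg hN ?_
  have key : ∀ m ∈ N ⊔ N', ∀ ζ : V →₀ k, avg k N (avg k N' (shift m ζ)) = avg k N (avg k N' ζ) := by
    intro m hm ζ
    obtain ⟨n, hn, n', hn', rfl⟩ := AddSubgroup.mem_sup.1 hm
    rw [← shift_shift, avg_shift _ hn', avg_shift_comm, avg_shift _ hn]
  -- `avg N ∘ avg N'` factors through the coinvariants of `N ⊔ N'`
  have hdesc : ∀ ζ : V →₀ k, ∀ s : V ⧸ (N ⊔ N') → V, (∀ q, QuotientAddGroup.mk (s q) = q) →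
      avg k N (avg k N' ((ζ.mapDomain (QuotientAddGroup.mk : V → V ⧸ (N ⊔ N'))).mapDomain s)) =
        avg k N (avg k N' ζ) := by
    intro ζ s hs
    induction ζ using Finsupp.induction_linear with
    | zero => simp
    | add f g hf hg => rw [Finsupp.mapDomain_add, Finsupp.mapDomain_add, map_add, map_add, hf, hg,
        map_add, map_add]
    | single x r =>
      rw [Finsupp.mapDomain_single, Finsupp.mapDomain_single,
        ← key (-s (QuotientAddGroup.mk x) + x) (QuotientAddGroup.eq.1 (hs _)), shift,
        Finsupp.lmapDomain_apply, Finsupp.mapDomain_single]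
      simp
  rw [← hdesc ξ Quotient.out fun q => Quotient.out_eq' q, mem_cosetKer.1 hξ]
  simp

end Translation

/-! ### Subfunctors, generators and quotients of additive functors -/

section AddRep

variable {C : Type u} [Category.{v} C] [Preadditive C]

instance (A : AddRep C) : A.obj.Additive := A.property

theorem rep_map_comp (A : AddRep C) {a b c : C} (f : a ⟶ b) (g : b ⟶ c) (x : A.obj.obj a) :
    A.obj.map (f ≫ g) x = A.obj.map g (A.obj.map f x) := by
  simp

theorem rep_map_id (A : AddRep C) {a : C} (x : A.obj.obj a) : A.obj.map (𝟙 a) x = x := by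
  simp

theorem rep_map_add (A : AddRep C) {a b : C} (f g : a ⟶ b) (x : A.obj.obj a) :
    A.obj.map (f + g) x = A.obj.map f x + A.obj.map g x := by
  rw [Functor.map_add]
  rfl

theorem rep_map_zero (A : AddRep C) {a b : C} (x : A.obj.obj a) :
    A.obj.map (0 : a ⟶ b) x = 0 := by
  rw [Functor.map_zero]
  rfl

theorem rep_naturality {A A' : AddRep C} (φ : A ⟶ A') {a b : C} (f : a ⟶ b) (x : A.obj.obj a) :
    φ.hom.app b (A.obj.map f x) = A'.obj.map f (φ.hom.app a x) := by
  have := ConcreteCategory.congr_hom (φ.hom.naturality f) x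
  simpa only [ConcreteCategory.comp_apply] using this

/-- The map `f ↦ A(f)(v)` given by an element `v` of `A(a)`. -/
def orbit (A : AddRep C) {a : C} (v : A.obj.obj a) (c : C) : (a ⟶ c) →+ A.obj.obj c where
  toFun f := A.obj.map f v
  map_zero' := rep_map_zero A v
  map_add' f g := rep_map_add A f g v

@[simp]
theorem orbit_apply (A : AddRep C) {a : C} (v : A.obj.obj a) {c : C} (f : a ⟶ c) :
    orbit A v c f = A.obj.map f v := rfl

/-- `v` generates `A`. -/
def IsGen (A : AddRep C) {a : C} (v : A.obj.obj a) : Prop :=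
  ∀ c : C, Function.Surjective (orbit A v c)

/-- `b` cogenerates `A`: every nonzero element is detected by a morphism to `b`. -/
def IsCogen (A : AddRep C) (b : C) : Prop :=
  ∀ (c : C) (u : A.obj.obj c), (∀ f : c ⟶ b, A.obj.map f u = 0) → u = 0

namespace SubRep

variable {A A' : AddRep C}

theorem mem_top {a : C} (x : A.obj.obj a) : x ∈ (⊤ : SubRep A).obj a := AddSubgroup.mem_top _

theorem mem_bot {a : C} {x : A.obj.obj a} : x ∈ (⊥ : SubRep A).obj a ↔ x = 0 :=
  AddSubgroup.mem_bot

theorem eq_top_iff_forall {B : SubRep A} : B = ⊤ ↔ ∀ a x, x ∈ B.obj a :=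
  ⟨fun h _ x => h ▸ mem_top x, fun h => top_unique fun a x _ => h a x⟩

theorem eq_bot_iff_forall {B : SubRep A} : B = ⊥ ↔ ∀ a, ∀ x ∈ B.obj a, x = 0 :=
  ⟨fun h _ _ hx => mem_bot.1 (h ▸ hx), fun h => bot_unique fun a x hx => mem_bot.2 (h a x hx)⟩

instance : Lattice (SubRep A) where
  sup B B' :=
    { obj := fun a => B.obj a ⊔ B'.obj a
      map_mem := fun f ξ h => by
        obtain ⟨y, hy, z, hz, rfl⟩ := AddSubgroup.mem_sup.1 h
        rw [map_add]
        exact AddSubgroup.add_mem_sup (B.map_mem f y hy) (B'.map_mem f z hz) }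
  inf B B' :=
    { obj := fun a => B.obj a ⊓ B'.obj a
      map_mem := fun f ξ h => ⟨B.map_mem f ξ h.1, B'.map_mem f ξ h.2⟩ }
  le_sup_left _ _ := fun _ => le_sup_left
  le_sup_right _ _ := fun _ => le_sup_right
  sup_le _ _ _ h h' := fun a => sup_le (h a) (h' a)
  inf_le_left _ _ := fun _ => inf_le_left
  inf_le_right _ _ := fun _ => inf_le_right
  le_inf _ _ _ h h' := fun a => le_inf (h a) (h' a)

theorem sup_obj (B B' : SubRep A) (a : C) : (B ⊔ B').obj a = B.obj a ⊔ B'.obj a := rfl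

/-- Modularity gives Jordan–Hölder for lengths, and lets chain conditions pass to joins. -/
instance : IsModularLattice (SubRep A) where
  sup_inf_le_assoc_of_le {x} y {z} h := by
    intro a
    exact IsModularLattice.sup_inf_le_assoc_of_le (y.obj a) (h a)

/-- The subfunctor generated by `v`. -/
def span {a : C} (v : A.obj.obj a) : SubRep A where
  obj c := (orbit A v c).range
  map_mem := by
    rintro b c f _ ⟨g, rfl⟩
    exact ⟨g ≫ f, rep_map_comp A g f v⟩

theorem mem_span {a c : C} {v : A.obj.obj a} {x : A.obj.obj c} :
    x ∈ (span v).obj c ↔ ∃ f : a ⟶ c, A.obj.map f v = x := Iff.rfl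

theorem self_mem_span {a : C} (v : A.obj.obj a) : v ∈ (span v).obj a := ⟨𝟙 a, rep_map_id A v⟩

theorem span_le {a : C} {v : A.obj.obj a} {B : SubRep A} : span v ≤ B ↔ v ∈ B.obj a := by
  refine ⟨fun h => h a (self_mem_span v), fun h c => ?_⟩
  rintro _ ⟨f, rfl⟩
  exact B.map_mem f v h

theorem span_eq_top {a : C} {v : A.obj.obj a} : span v = ⊤ ↔ IsGen A v :=
  eq_top_iff_forall

theorem comap_mono (φ : A ⟶ A') : Monotone (comap φ) :=
  fun _ _ h a _ hx => h a hx

/-- The quotient `A/B`. -/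
def quot (B : SubRep A) : AddRep C where
  obj :=
    { obj := fun a => AddCommGrpCat.of (A.obj.obj a ⧸ B.obj a)
      map := fun {a b} f => AddCommGrpCat.ofHom (QuotientAddGroup.map (B.obj a) (B.obj b)
        (A.obj.map f).hom (fun ξ hξ => B.map_mem f ξ hξ))
      map_id := fun a => by
        ext x
        simp
      map_comp := fun {a b c} f g => by
        ext x
        exact congrArg (QuotientAddGroup.mk : _ → A.obj.obj c ⧸ B.obj c) (rep_map_comp A f g x) }
  property :=
    { map_add := fun {a b f g} => by
        ext x
        exact congrArg (QuotientAddGroup.mk : _ → A.obj.obj b ⧸ B.obj b) (rep_map_add A f g x) }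

/-- The projection `A(a) → (A/B)(a)`. -/
def cls (B : SubRep A) (a : C) : A.obj.obj a →+ B.quot.obj.obj a :=
  QuotientAddGroup.mk' (B.obj a)

theorem cls_surjective (B : SubRep A) (a : C) : Function.Surjective (B.cls a) :=
  QuotientAddGroup.mk'_surjective _

theorem cls_eq_zero {B : SubRep A} {a : C} {x : A.obj.obj a} : B.cls a x = 0 ↔ x ∈ B.obj a :=
  QuotientAddGroup.eq_zero_iff x

theorem cls_eq_cls {B : SubRep A} {a : C} {x y : A.obj.obj a} :
    B.cls a x = B.cls a y ↔ x - y ∈ B.obj a := by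
  rw [← sub_eq_zero, ← map_sub, cls_eq_zero]

theorem quot_map (B : SubRep A) {a b : C} (f : a ⟶ b) (x : A.obj.obj a) :
    B.quot.obj.map f (B.cls a x) = B.cls b (A.obj.map f x) := rfl

/-- The projection `A ⟶ A/B`. -/
def proj (B : SubRep A) : A ⟶ B.quot where
  hom :=
    { app := fun a => AddCommGrpCat.ofHom (B.cls a)
      naturality := fun _ _ _ => rfl }

theorem proj_app (B : SubRep A) (a : C) (x : A.obj.obj a) : B.proj.hom.app a x = B.cls a x := rfl

theorem mem_comap {φ : A ⟶ A'} {B : SubRep A'} {a : C} {x : A.obj.obj a} :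
    x ∈ (comap φ B).obj a ↔ φ.hom.app a x ∈ B.obj a := Iff.rfl

theorem comap_strictMono {φ : A ⟶ A'} (hφ : ∀ a, Function.Surjective (φ.hom.app a)) :
    StrictMono (comap φ) := by
  refine (comap_mono φ).strictMono_of_injective fun B B' h => ?_
  ext a x
  obtain ⟨x, rfl⟩ := hφ a x
  exact SetLike.ext_iff.1 (congrFun (congrArg SubRep.obj h) a) x

theorem proj_surjective (B : SubRep A) (a : C) : Function.Surjective (B.proj.hom.app a) :=
  B.cls_surjective a

theorem le_comap_proj (B : SubRep A) (B' : SubRep B.quot) : B ≤ comap B.proj B' := by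
  intro a x hx
  rw [mem_comap, proj_app, cls_eq_zero.2 hx]
  exact zero_mem _

/-- The image of a subfunctor. -/
def map (φ : A ⟶ A') (B : SubRep A) : SubRep A' where
  obj a := (B.obj a).map (φ.hom.app a).hom
  map_mem := by
    rintro a b f _ ⟨x, hx, rfl⟩
    exact ⟨A.obj.map f x, B.map_mem f x hx, rep_naturality φ f x⟩

theorem map_le_iff {φ : A ⟶ A'} {B : SubRep A} {B' : SubRep A'} :
    map φ B ≤ B' ↔ B ≤ comap φ B' := by
  refine ⟨fun h a x hx => h a ⟨x, hx, rfl⟩, ?_⟩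
  rintro h a _ ⟨x, hx, rfl⟩
  exact h a hx

end SubRep

/-- Isomorphic objects have isomorphic lattices of subfunctors. -/
def subRepOrderIso {A A' : AddRep C} (e : A ≅ A') : SubRep A ≃o SubRep A' where
  toFun := SubRep.comap e.inv
  invFun := SubRep.comap e.hom
  left_inv B := by
    ext a x
    have h : (e.hom ≫ e.inv).hom.app a x = x := by rw [e.hom_inv_id]; rfl
    change (e.hom ≫ e.inv).hom.app a x ∈ B.obj a ↔ _
    rw [h]
  right_inv B := by
    ext a x
    have h : (e.inv ≫ e.hom).hom.app a x = x := by rw [e.inv_hom_id]; rfl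
    change (e.inv ≫ e.hom).hom.app a x ∈ B.obj a ↔ _
    rw [h]
  map_rel_iff' {B B'} := by
    refine ⟨fun h a x hx => ?_, fun h => SubRep.comap_mono _ h⟩
    have h' : (e.hom ≫ e.inv).hom.app a x = x := by rw [e.hom_inv_id]; rfl
    have := @h a (e.hom.hom.app a x) (by
      change (e.hom ≫ e.inv).hom.app a x ∈ B.obj a
      rwa [h'])
    change (e.hom ≫ e.inv).hom.app a x ∈ B'.obj a at this
    rwa [h'] at this

theorem HasLength.of_iso {A A' : AddRep C} (e : A ≅ A') {n : ℕ} (h : HasLength A n) :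
    HasLength A' n := by
  obtain ⟨s, h0, h1, hn⟩ := h
  refine ⟨s.map ⟨subRepOrderIso e, fun {a b} hab => ?_⟩, ?_, ?_, hn⟩
  · exact (apply_covBy_apply_iff (subRepOrderIso e)).2 hab
  · exact (congrArg (subRepOrderIso e) h0).trans (map_bot _)
  · exact (congrArg (subRepOrderIso e) h1).trans (map_top _)

theorem IsGen.cls {A : AddRep C} {a : C} {v : A.obj.obj a} (hv : IsGen A v) (B : SubRep A) :
    IsGen B.quot (B.cls a v) := by
  intro c x
  obtain ⟨x, rfl⟩ := B.cls_surjective c x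
  obtain ⟨f, rfl⟩ := hv c x
  exact ⟨f, rfl⟩

theorem isGen_of_map {A : AddRep C} {a b : C} {v : A.obj.obj a} (f : a ⟶ b)
    (h : IsGen A (A.obj.map f v)) : IsGen A v := by
  intro c x
  obtain ⟨g, rfl⟩ := h c x
  exact ⟨f ≫ g, rep_map_comp A f g v⟩

theorem isGen_aut {A : AddRep C} (g : Aut A) {a : C} {v : A.obj.obj a} (hv : IsGen A v) :
    IsGen A (g.hom.hom.app a v) := by
  intro c x
  obtain ⟨f, hf⟩ := hv c (g.inv.hom.app c x)
  refine ⟨f, ?_⟩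
  rw [orbit_apply] at hf ⊢
  rw [← rep_naturality g.hom, hf, aut_apply_inv]

theorem aut_eq_of_gen {A : AddRep C} {g h : Aut A} {a : C} {v : A.obj.obj a} (hv : IsGen A v)
    (heq : g.hom.hom.app a v = h.hom.hom.app a v) : g = h := by
  refine Iso.ext (ObjectProperty.hom_ext _ ?_)
  ext c x
  obtain ⟨f, rfl⟩ := hv c x
  rw [orbit_apply, rep_naturality, rep_naturality, heq]

/-! ### Finite objects have a generator and a cogenerator -/

section Biprod

variable [HasBinaryBiproducts C]

/-- Take `v` with `⟨v⟩` maximal among cyclic subfunctors. For `x ∈ A(c)`, the element `(v, x)` of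
`A(a ⊕ c)` generates a cyclic subfunctor containing both `v` and `x`, so `x ∈ ⟨v⟩`. -/
theorem IsFiniteRep.exists_isGen [HasZeroObject C] {A : AddRep C} (hA : IsFiniteRep A) :
    ∃ (a : C) (v : A.obj.obj a), IsGen A v := by
  have := hA.1
  obtain ⟨_, ⟨⟨a, v⟩, rfl⟩, hmax⟩ := (wellFounded_gt (α := SubRep A)).has_min
    (Set.range fun p : (Σ a : C, A.obj.obj a) => SubRep.span p.2)
    ⟨_, ⟨⟨HasZeroObject.zero' C |>.zero, 0⟩, rfl⟩⟩
  refine ⟨a, v, SubRep.span_eq_top.1 (SubRep.eq_top_iff_forall.2 fun c x => ?_)⟩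
  set w : A.obj.obj (a ⊞ c) := A.obj.map biprod.inl v + A.obj.map biprod.inr x with hw
  have h1 : A.obj.map biprod.fst w = v := by
    rw [hw, map_add, ← rep_map_comp, ← rep_map_comp, biprod.inl_fst, biprod.inr_fst, rep_map_id,
      rep_map_zero, add_zero]
  have h2 : A.obj.map biprod.snd w = x := by
    rw [hw, map_add, ← rep_map_comp, ← rep_map_comp, biprod.inl_snd, biprod.inr_snd, rep_map_id,
      rep_map_zero, zero_add]
  have hle : SubRep.span v ≤ SubRep.span w := SubRep.span_le.2 ⟨_, h1⟩
  have hnlt := hmax _ ⟨⟨a ⊞ c, w⟩, rfl⟩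
  have heq : SubRep.span v = SubRep.span w := hle.eq_or_lt.resolve_right hnlt
  change x ∈ (SubRep.span v).obj c
  rw [heq]
  exact ⟨_, h2⟩

/-- The largest subfunctor which vanishes at `b`. -/
def annih (A : AddRep C) (b : C) : SubRep A where
  obj c :=
    { carrier := {u | ∀ f : c ⟶ b, A.obj.map f u = 0}
      zero_mem' := fun f => map_zero _
      add_mem' := fun {x y} hx hy f => by rw [map_add, hx f, hy f, add_zero]
      neg_mem' := fun {x} hx f => by rw [map_neg, hx f, neg_zero] }
  map_mem g ξ h f := by
    rw [← rep_map_comp]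
    exact h _

/-- Dual to the existence of a generator: minimize `annih A b`, and enlarge `b` to `b ⊕ c`. -/
theorem IsFiniteRep.exists_isCogen [HasZeroObject C] {A : AddRep C} (hA : IsFiniteRep A) :
    ∃ b : C, IsCogen A b := by
  have := hA.2
  obtain ⟨_, ⟨b, rfl⟩, hmin⟩ := (wellFounded_lt (α := SubRep A)).has_min
    (Set.range fun b : C => annih A b) ⟨_, ⟨HasZeroObject.zero' C |>.zero, rfl⟩⟩
  refine ⟨b, fun c u hu => ?_⟩
  have hle : annih A (b ⊞ c) ≤ annih A b := by
    intro d x hx f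
    have h := congrArg (A.obj.map biprod.fst) (hx (f ≫ biprod.inl))
    rwa [← rep_map_comp, Category.assoc, biprod.inl_fst, Category.comp_id, map_zero] at h
  have heq : annih A (b ⊞ c) = annih A b := hle.eq_or_lt.resolve_right (hmin _ ⟨_, rfl⟩)
  have hu' : u ∈ (annih A (b ⊞ c)).obj c := by rw [heq]; exact hu
  have h := congrArg (A.obj.map biprod.snd) (hu' biprod.inr)
  rwa [← rep_map_comp, biprod.inr_snd, rep_map_id, map_zero] at h

end Biprod

/-- A directed supremum is an objectwise union, so the generator already lies in one member. -/
theorem IsGen.isFinGen {A : AddRep C} {a : C} {v : A.obj.obj a} (hv : IsGen A v) :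
    IsFinGen A := by
  intro S hS hdir hlub
  let U : SubRep A :=
    { obj := fun c =>
        { carrier := {x | ∃ B ∈ S, x ∈ B.obj c}
          zero_mem' := let ⟨B, hB⟩ := hS; ⟨B, hB, zero_mem _⟩
          add_mem' := by
            rintro x y ⟨B, hB, hx⟩ ⟨B', hB', hy⟩
            obtain ⟨D, hD, h, h'⟩ := hdir B hB B' hB'
            exact ⟨D, hD, add_mem (h c hx) (h' c hy)⟩
          neg_mem' := by
            rintro x ⟨B, hB, hx⟩
            exact ⟨B, hB, neg_mem hx⟩ }
      map_mem := by
        rintro b c f x ⟨B, hB, hx⟩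
        exact ⟨B, hB, B.map_mem f x hx⟩ }
  have hU : ⊤ ≤ U := hlub.2 fun B hB c x hx => ⟨B, hB, hx⟩
  obtain ⟨B, hB, hvB⟩ := @hU a v (SubRep.mem_top v)
  have : B = ⊤ := top_unique (by
    rw [← SubRep.span_eq_top.2 hv]
    exact SubRep.span_le.2 hvB)
  exact this ▸ hB

/-- Each nonzero `u` of the finite group `A(b)` is missed by some member of the family. A common
lower bound of these members vanishes at `b`, hence everywhere. -/
theorem IsCogen.isFinCogen {A : AddRep C} {b : C} (hb : IsCogen A b) [Finite (A.obj.obj b)] :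
    IsFinCogen A := by
  intro S hS hdir hglb
  have h1 : ∀ u : A.obj.obj b, ∃ B ∈ S, u ∈ B.obj b → u = 0 := by
    intro u
    by_contra! h
    have hle : SubRep.span u ≤ ⊥ := hglb.2 fun B hB => SubRep.span_le.2 (h B hB).1
    obtain ⟨B, hB⟩ := hS
    exact (h B hB).2 (SubRep.mem_bot.1 (hle b (SubRep.self_mem_span u)))
  choose f hfS hf using h1
  have : Fintype (A.obj.obj b) := Fintype.ofFinite _
  have h2 : ∀ s : Finset (A.obj.obj b), ∃ B ∈ S, ∀ u ∈ s, B ≤ f u := by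
    classical
    intro s
    induction s using Finset.induction_on with
    | empty => obtain ⟨B, hB⟩ := hS; exact ⟨B, hB, by simp⟩
    | insert u s _ ih =>
      obtain ⟨B, hB, h⟩ := ih
      obtain ⟨D, hD, h', h''⟩ := hdir B hB (f u) (hfS u)
      refine ⟨D, hD, fun w hw => ?_⟩
      rcases Finset.mem_insert.1 hw with rfl | hw
      · exact h''
      · exact le_trans h' (h w hw)
  obtain ⟨B, hB, h⟩ := h2 Finset.univ
  have : B = ⊥ := SubRep.eq_bot_iff_forall.2 fun c x hx => hb c x fun g =>
    hf _ (h _ (Finset.mem_univ _) b (B.map_mem g x hx))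
  exact this ▸ hB

/-! ### Length -/

/-- All chains of subfunctors of `A` have length at most `n`. -/
def LenLE (A : AddRep C) (n : ℕ) : Prop :=
  ∀ s : LTSeries (SubRep A), s.length ≤ n

/-- Any chain refines to a composition series, and Jordan–Hölder fixes the length of the latter. -/
theorem HasLength.lenLE {A : AddRep C} (hA : IsFiniteRep A) {n : ℕ} (h : HasLength A n) :
    LenLE A n := by
  have := hA.1
  have := hA.2
  obtain ⟨s, h0, h1, rfl⟩ := h
  intro t
  obtain ⟨t', i, -, ht₁, ht₂⟩ := t.exists_relSeries_covBy_and_head_eq_bot_and_last_eq_bot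
  have := (CompositionSeries.jordan_holder s t' (h0.trans ht₁.symm) (h1.trans ht₂.symm)).choose
  have h : t.length ≤ t'.length := by simpa using Fintype.card_le_of_embedding i
  have h' : t'.length = s.length := by simpa using Fintype.card_congr this.symm
  exact h.trans h'.le

theorem HasLength.le {A : AddRep C} {n m : ℕ} (h : HasLength A n) (h' : LenLE A m) : n ≤ m := by
  obtain ⟨s, -, -, rfl⟩ := h
  exact h' (s.map ⟨id, fun h => h.1⟩)

theorem IsFiniteRep.exists_hasLength {A : AddRep C} (hA : IsFiniteRep A) :
    ∃ n, HasLength A n := by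
  have := hA.1
  have := hA.2
  obtain ⟨f, f0, n, hn⟩ := exists_covBy_seq_of_wellFoundedLT_wellFoundedGT (SubRep A)
  exact ⟨n, ⟨n, fun i ↦ f i, fun i ↦ hn.2 i i.2⟩, f0.eq_bot, hn.1.eq_top, rfl⟩

theorem LenLE.isFiniteRep {A : AddRep C} {n : ℕ} (h : LenLE A n) : IsFiniteRep A := by
  have : FiniteDimensionalOrder (SubRep A) := by
    by_contra hf
    have : InfiniteDimensionalOrder (SubRep A) := by
      rwa [not_finiteDimensionalOrder_iff] at hf
    have := h (LTSeries.withLength (SubRep A) (n + 1))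
    simp at this
  exact ⟨⟨SetRel.IsWellFounded.inv_of_finiteDimensional {(a, b) : SubRep A × SubRep A | a < b}⟩,
    ⟨SetRel.IsWellFounded.of_finiteDimensional {(a, b) : SubRep A × SubRep A | a < b}⟩⟩

theorem LenLE.mono {A : AddRep C} {n m : ℕ} (h : LenLE A n) (hnm : n ≤ m) : LenLE A m :=
  fun s => (h s).trans hnm

theorem LenLE.eq_zero {A : AddRep C} (h : LenLE A 0) {a : C} (v : A.obj.obj a) : v = 0 := by
  by_contra hv
  have hlt : (⊥ : SubRep A) < SubRep.span v := bot_lt_iff_ne_bot.2 fun he =>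
    hv (SubRep.eq_bot_iff_forall.1 he a v (SubRep.self_mem_span v))
  have := h ((RelSeries.singleton _ ⊥).snoc (SubRep.span v) hlt)
  exact Nat.not_succ_le_zero _ this

/-- A chain in the quotient pulls back to a chain whose terms contain `⟨v⟩ ≠ 0`, so `⊥` can be put
below it. -/
theorem LenLE.quot_span {A : AddRep C} {n : ℕ} (h : LenLE A (n + 1)) {a : C} {v : A.obj.obj a}
    (hv : v ≠ 0) : LenLE (SubRep.span v).quot n := by
  intro s
  have hlt : (⊥ : SubRep A) <
      (s.map (SubRep.comap (SubRep.span v).proj)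
        (SubRep.comap_strictMono (SubRep.proj_surjective _))).head := by
    refine bot_lt_iff_ne_bot.2 fun he => hv ?_
    have hle := SubRep.le_comap_proj (SubRep.span v) s.head
    exact SubRep.eq_bot_iff_forall.1 he a v (hle a (SubRep.self_mem_span v))
  have := h ((s.map _ (SubRep.comap_strictMono (SubRep.proj_surjective _))).cons ⊥ hlt)
  simpa using this

/-- A chain in `A` whose second term contains `v` gives a chain in `A/⟨v⟩`. -/
theorem exists_quot_series {A : AddRep C} {n : ℕ} (s : LTSeries (SubRep A))
    (hs : s.length = n + 1) : ∃ (a : C) (v : A.obj.obj a), v ≠ 0 ∧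
      ∃ t : LTSeries (SubRep (SubRep.span v).quot), t.length = n := by
  obtain ⟨m, s, hstep⟩ := s
  obtain rfl : m = n + 1 := hs
  have h01 : s 0 < s 1 := hstep 0
  have : ∃ a, ∃ v ∈ (s 1).obj a, v ∉ (s 0).obj a := by
    by_contra! h
    exact h01.not_ge h
  obtain ⟨a, v, hv1, hv0⟩ := this
  have hmono : StrictMono (s : Fin (n + 2) → SubRep A) := Fin.strictMono_iff_lt_succ.2 hstep
  refine ⟨a, v, fun h => hv0 (h ▸ zero_mem _), ?_⟩
  -- The terms of index at least `1` all contain `v`, so their images in the quotient stay strictly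
  -- increasing; only the initial step of the chain is lost.
  refine ⟨⟨n, fun i => SubRep.map (SubRep.span v).proj (s i.succ), fun i => ?_⟩, rfl⟩
  have hlt : s i.castSucc.succ < s i.succ.succ := hmono (by simp [Fin.lt_def])
  suffices SubRep.map (SubRep.span v).proj (s i.castSucc.succ) <
      SubRep.map (SubRep.span v).proj (s i.succ.succ) from this
  refine lt_of_le_not_ge ?_ fun h => hlt.not_ge fun c x hx => ?_
  · exact SubRep.map_le_iff.2 fun c x hx => ⟨x, hlt.le c hx, rfl⟩
  · obtain ⟨y, hy, hyx⟩ := h c ⟨x, hx, rfl⟩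
    have h1 : (SubRep.span v).cls c y = (SubRep.span v).cls c x := hyx
    have h2 := SubRep.cls_eq_cls.1 h1
    have h3 : SubRep.span v ≤ s i.castSucc.succ := by
      refine SubRep.span_le.2 ?_
      have : s 1 ≤ s i.castSucc.succ := hmono.monotone (by simp [Fin.le_def])
      exact this a hv1
    have := sub_mem hy (h3 c h2)
    simpa using this

end AddRep

/-! ### Morphisms defined on a generator, and twisted sums -/

section Twist

variable {C : Type u} [Category.{v} C] [Preadditive C]

/-- The morphism sending a generator `v` to `w`. -/
def descGen {A A' : AddRep C} {a : C} {v : A.obj.obj a} (hv : IsGen A v) {w : A'.obj.obj a}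
    (h : ∀ (c : C) (f : a ⟶ c), A.obj.map f v = 0 → A'.obj.map f w = 0) : A ⟶ A' where
  hom :=
    { app := fun c => AddCommGrpCat.ofHom ((orbit A v c).liftOfSurjective (hv c)
        ⟨orbit A' w c, fun f hf => h c f hf⟩)
      naturality := fun b c f => by
        ext x
        obtain ⟨g, rfl⟩ := hv b x
        have h1 : ∀ (c : C) (g : a ⟶ c), (orbit A v c).liftOfSurjective (hv c)
            ⟨orbit A' w c, fun f hf => h c f hf⟩ (A.obj.map g v) = A'.obj.map g w :=
          fun c g => (orbit A v c).liftOfRightInverse_comp_apply _ _ _ g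
        simp only [AddCommGrpCat.hom_comp, AddCommGrpCat.hom_ofHom, AddMonoidHom.comp_apply]
        have h2 := h1 c (g ≫ f)
        rw [rep_map_comp, rep_map_comp] at h2
        refine h2.trans (congrArg (A'.obj.map f) (h1 b g).symm) }

theorem descGen_apply {A A' : AddRep C} {a : C} {v : A.obj.obj a} (hv : IsGen A v)
    {w : A'.obj.obj a} (h : ∀ (c : C) (f : a ⟶ c), A.obj.map f v = 0 → A'.obj.map f w = 0) :
    (descGen hv h).hom.app a v = w := by
  have h1 : (orbit A v a).liftOfSurjective (hv a)
      ⟨orbit A' w a, fun f hf => h a f hf⟩ (A.obj.map (𝟙 a) v) = A'.obj.map (𝟙 a) w :=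
    (orbit A v a).liftOfRightInverse_comp_apply _ _ _ (𝟙 a)
  rw [rep_map_id, rep_map_id] at h1
  exact h1

theorem hom_ext_gen {A A' : AddRep C} {φ ψ : A ⟶ A'} {a : C} {v : A.obj.obj a} (hv : IsGen A v)
    (h : φ.hom.app a v = ψ.hom.app a v) : φ = ψ := by
  refine ObjectProperty.hom_ext _ ?_
  ext c x
  obtain ⟨f, rfl⟩ := hv c x
  rw [orbit_apply, rep_naturality, rep_naturality, h]

/-- By hypothesis `w ↦ v` defines a surjection from `⟨w⟩ ⊆ A'` onto `A`. Since `A'(c)` has at most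
as many elements as `A(c)`, this forces `⟨w⟩ = A'` and makes the surjection bijective. For `A' = A`
it produces automorphisms. -/
theorem exists_iso_of_card_le {A A' : AddRep C} [∀ c, Finite (A.obj.obj c)]
    [∀ c, Finite (A'.obj.obj c)] (hcard : ∀ c, Nat.card (A'.obj.obj c) ≤ Nat.card (A.obj.obj c))
    {a : C} {v : A.obj.obj a} (hv : IsGen A v) {w : A'.obj.obj a}
    (h : ∀ (c : C) (f : a ⟶ c), A'.obj.map f w = 0 → A.obj.map f v = 0) :
    ∃ e : A ≅ A', e.hom.hom.app a v = w := by
  have hwd : ∀ (c : C) (f f' : a ⟶ c), A'.obj.map f w = A'.obj.map f' w →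
      A.obj.map f v = A.obj.map f' v := by
    intro c f f' hff
    have h1 : orbit A' w c (f - f') = 0 := by rw [map_sub, sub_eq_zero]; exact hff
    have h2 : orbit A v c (f - f') = 0 := h c _ h1
    rwa [map_sub, sub_eq_zero] at h2
  have hw : IsGen A' w := by
    intro c
    have hinj : Function.Injective (fun u => orbit A' w c (Function.surjInv (hv c) u)) := by
      intro u u' huu
      have := hwd c _ _ huu
      exact ((Function.surjInv_eq (hv c) u).symm.trans this).trans (Function.surjInv_eq (hv c) u')
    have hbij := hinj.bijective_of_nat_card_le (hcard c)
    intro y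
    obtain ⟨u, hu⟩ := hbij.2 y
    exact ⟨_, hu⟩
  have h' : ∀ (c : C) (f : a ⟶ c), A.obj.map f v = 0 → A'.obj.map f w = 0 := by
    intro c f hf
    have hsurj : Function.Surjective (fun y => orbit A v c (Function.surjInv (hw c) y)) := by
      intro u
      obtain ⟨g, rfl⟩ := hv c u
      exact ⟨orbit A' w c g, hwd c _ _ (Function.surjInv_eq (hw c) _)⟩
    have hbij := hsurj.bijective_of_nat_card_le (hcard c)
    apply hbij.1
    have h1 : ∀ g : a ⟶ c, orbit A v c (Function.surjInv (hw c) (A'.obj.map g w)) =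
      A.obj.map g v := fun g => hwd c _ _ (Function.surjInv_eq (hw c) _)
    have h2 := h1 0
    rw [rep_map_zero, rep_map_zero] at h2
    change orbit A v c (Function.surjInv (hw c) (A'.obj.map f w)) =
      orbit A v c (Function.surjInv (hw c) 0)
    rw [h1 f, h2, hf]
  refine ⟨⟨descGen hv h', descGen hw h, hom_ext_gen hv ?_, hom_ext_gen hw ?_⟩,
    descGen_apply hv h'⟩
  · change (descGen hw h).hom.app a ((descGen hv h').hom.app a v) = v
    rw [descGen_apply, descGen_apply]
  · change (descGen hv h').hom.app a ((descGen hw h).hom.app a w) = w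
    rw [descGen_apply, descGen_apply]

section Finite

variable (k : Type v) [Field k]

theorem card_ne_zero_of_subgroup {H : Type*} [AddGroup H] (N : AddSubgroup H)
    (h : (Nat.card H : k) ≠ 0) : (Nat.card N : k) ≠ 0 := by
  obtain ⟨m, hm⟩ := AddSubgroup.card_addSubgroup_dvd_card N
  intro h0
  rw [hm, Nat.cast_mul, h0, zero_mul] at h
  exact h rfl

variable {k}

theorem IsGen.finite (hC : IsKTrivial k C) {A : AddRep C} {a : C} {v : A.obj.obj a}
    (hv : IsGen A v) (c : C) : Finite (A.obj.obj c) :=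
  have := (hC a c).1
  Finite.of_surjective _ (hv c)

theorem mem_upperKer {A : AddRep C} {a : C} {ξ : A.obj.obj a →₀ k} :
    ξ ∈ upperKer k A a ↔ ∀ B : SubRep A, B ≠ ⊥ → ξ ∈ cosetKer k (B.obj a) := by
  simp only [upperKer, Submodule.mem_iInf]
  rfl

variable [∀ a b : C, Fintype (a ⟶ b)]

/-- The element `∑ η(A(f)(v)) [A'(f)(w)]` of `k[A'(b)]`, where `f` runs over `C(a, b)`. -/
def twist {A A' : AddRep C} {a b : C} (v : A.obj.obj a) (η : A.obj.obj b →₀ k)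
    (w : A'.obj.obj a) : A'.obj.obj b →₀ k :=
  ∑ f : a ⟶ b, η (A.obj.map f v) • Finsupp.single (A'.obj.map f w) 1

/-- The coefficient at `u` is a sum over the `f` with `A'(f)(w) = u`. As `f` varies, `A(f)(v)`
covers a coset of `B = {A(f)(v) : A'(f)(w) = 0}` with constant multiplicity. The subfunctor `B` is
nonzero, so the coset sums of `η` vanish. -/
theorem twist_eq_zero {A A' : AddRep C} {a b : C} {v : A.obj.obj a} {η : A.obj.obj b →₀ k}
    (hη : η ∈ upperKer k A b) {w : A'.obj.obj a}
    (h : ∃ (c : C) (f : a ⟶ c), A'.obj.map f w = 0 ∧ A.obj.map f v ≠ 0) : twist v η w = 0 := by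
  classical
  let B : SubRep A :=
    { obj := fun c => (orbit A' w c).ker.map (orbit A v c)
      map_mem := by
        rintro c d g _ ⟨f, hf, rfl⟩
        refine ⟨f ≫ g, ?_, rep_map_comp A f g v⟩
        rw [SetLike.mem_coe, AddMonoidHom.mem_ker, orbit_apply] at hf ⊢
        rw [rep_map_comp, hf, map_zero] }
  have hB : B ≠ ⊥ := by
    obtain ⟨c, f, hf, hf'⟩ := h
    intro he
    exact hf' (SubRep.eq_bot_iff_forall.1 he c _ ⟨f, hf, rfl⟩)
  have hηB := mem_upperKer.1 hη B hB
  ext u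
  rw [twist, Finsupp.finsetSum_apply, Finsupp.zero_apply]
  simp only [Finsupp.smul_apply, Finsupp.single_apply, smul_eq_mul, mul_ite, mul_one, mul_zero]
  by_cases hu : ∃ f₀ : a ⟶ b, A'.obj.map f₀ w = u
  swap
  · exact Finset.sum_eq_zero fun f _ => if_neg fun hf => hu ⟨f, hf⟩
  obtain ⟨f₀, rfl⟩ := hu
  let p : (orbit A' w b).ker →+ B.obj b :=
    ((orbit A v b).comp (orbit A' w b).ker.subtype).codRestrict _ fun h => ⟨h.1, h.2, rfl⟩
  have hp : Function.Surjective p := by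
    rintro ⟨_, f, hf, rfl⟩
    exact ⟨⟨f, hf⟩, rfl⟩
  have : Fintype (B.obj b) := by
    have := Finite.of_surjective _ hp
    exact Fintype.ofFinite _
  rw [← Finset.sum_filter]
  have h1 : ∑ f ∈ Finset.univ.filter (fun f : a ⟶ b => A'.obj.map f w = A'.obj.map f₀ w),
      η (A.obj.map f v) = ∑ h : (orbit A' w b).ker, η (A.obj.map f₀ v + (p h : A.obj.obj b)) := by
    refine Finset.sum_bij' (fun f hf => ⟨f - f₀, ?_⟩) (fun h _ => f₀ + h.1) ?_ ?_ ?_ ?_ ?_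
    · rw [AddMonoidHom.mem_ker, map_sub, sub_eq_zero]
      exact (Finset.mem_filter.1 hf).2
    · intros; exact Finset.mem_univ _
    · intro h _
      have := h.2
      rw [AddMonoidHom.mem_ker, orbit_apply] at this
      rw [Finset.mem_filter, rep_map_add, this, add_zero]
      exact ⟨Finset.mem_univ _, rfl⟩
    · intros; simp
    · intros; simp
    · intro f hf
      congr 1
      change orbit A v b f = orbit A v b f₀ + orbit A v b (f - f₀)
      rw [map_sub, add_sub_cancel]
  rw [h1, sum_comp_surjective p hp (fun n => η (A.obj.map f₀ v + (n : A.obj.obj b))),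
    cosetSum_eq_zero hηB, smul_zero]

/-- Every element of `A(b)` has the form `A(f)(v)` for equally many `f`, namely the order of the
kernel. -/
theorem twist_app {A A' : AddRep C} {a b : C} {v : A.obj.obj a} (hv : IsGen A v)
    (η : A.obj.obj b →₀ k) (σ : A ⟶ A') :
    twist v η (σ.hom.app a v) =
      (Nat.card (orbit A v b).ker : k) • η.mapDomain (σ.hom.app b) := by
  have : Fintype (A.obj.obj b) := by
    have := Finite.of_surjective _ (hv b)
    exact Fintype.ofFinite _
  have h1 : twist v η (σ.hom.app a v) =
      ∑ f : a ⟶ b, (fun u => η u • Finsupp.single (σ.hom.app b u) (1 : k)) (orbit A v b f) := by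
    refine Finset.sum_congr rfl fun f _ => ?_
    change _ = η (A.obj.map f v) • Finsupp.single (σ.hom.app b (A.obj.map f v)) (1 : k)
    rw [rep_naturality]
  rw [h1, sum_comp_surjective _ (hv b)
    (fun u => η u • Finsupp.single (σ.hom.app b u) (1 : k)), Nat.cast_smul_eq_nsmul,
    Finsupp.mapDomain, Finsupp.sum_fintype _ _ (by simp)]
  simp

end Finite

end Twist

/-! ### The tensor product over a group algebra -/

section Tensor

variable {k : Type v} [Field k] {G : Type w} [Group G] (M : ModuleCat.{v} (MonoidAlgebra k G))
  (X : Rep.{v} k G)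

/-- The module `M`, as a representation. -/
abbrev repOf : Rep.{v} k G := Rep.ofModuleMonoidAlgebra.obj M

/-- The class of `m ⊗ x` in the coinvariants. -/
def tmk : repOf M →ₗ[k] X →ₗ[k] (tensorOver M).obj X :=
  (TensorProduct.mk k (repOf M) X).compr₂
    (Representation.Coinvariants.mk ((repOf M).ρ.tprod X.ρ))

theorem tmk_rho (g : G) (m : repOf M) (x : X) :
    tmk M X ((repOf M).ρ g m) (X.ρ g x) = tmk M X m x :=
  Representation.Coinvariants.mk_self_apply ((repOf M).ρ.tprod X.ρ) g (m ⊗ₜ[k] x)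

theorem tmk_induction {p : (tensorOver M).obj X → Prop} (h0 : p 0)
    (hadd : ∀ s t, p s → p t → p (s + t)) (h : ∀ m x, p (tmk M X m x))
    (t : (tensorOver M).obj X) : p t := by
  obtain ⟨t, rfl⟩ := Representation.Coinvariants.mk_surjective ((repOf M).ρ.tprod X.ρ) t
  induction t using TensorProduct.induction_on with
  | zero => rw [map_zero]; exact h0
  | tmul m x => exact h m x
  | add s t hs ht => rw [map_add]; exact hadd _ _ hs ht

/-- The linear map out of the coinvariants induced by an invariant bilinear map. -/
def tlift {N : Type*} [AddCommGroup N] [Module k N] (φ : repOf M →ₗ[k] X →ₗ[k] N)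
    (h : ∀ g m x, φ ((repOf M).ρ g m) (X.ρ g x) = φ m x) : (tensorOver M).obj X →ₗ[k] N :=
  Representation.Coinvariants.lift ((repOf M).ρ.tprod X.ρ) (TensorProduct.lift φ)
    (fun g => TensorProduct.ext' fun m x => h g m x)

end Tensor

/-! ### The functors `M ⊗ Q^A` and `M ⊗ Q_A`, and their coefficients -/

section QTensor

variable {k : Type v} [Field k] {C : Type u} [Category.{v} C] [Preadditive C]
  (A : AddRep C) (M : ModuleCat.{v} (MonoidAlgebra k (Aut A)))

/-- The functor `M ⊗ Q^A`. -/
abbrev upperTensor : C ⥤ ModuleCat.{v} k := qUpper k A ⋙ tensorOver M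

/-- The functor `M ⊗ Q_A`. -/
abbrev lowerTensor : C ⥤ ModuleCat.{v} k := qLower k A ⋙ tensorOver M

/-- The morphism `M ⊗ Q^A ⟶ M ⊗ Q_A`. -/
abbrev tensorMap : upperTensor A M ⟶ lowerTensor A M :=
  Functor.whiskerRight (qUpperToLower k A) (tensorOver M)

/-- The class of `m ⊗ ξ` in `M ⊗ Q^A`. -/
def umk (a : C) : repOf M →ₗ[k] upperKer k A a →ₗ[k] (upperTensor A M).obj a :=
  tmk M (upperObj k A a)

/-- The class of `m ⊗ ξ` in `M ⊗ Q_A`. -/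
def lmk (a : C) : repOf M →ₗ[k] (A.obj.obj a →₀ k) →ₗ[k] (lowerTensor A M).obj a :=
  (tmk M (Rep.of (lowerRho k A a))).compl₂ (lowerKer k A a).mkQ

variable {A M}

theorem umk_map {a b : C} (f : a ⟶ b) (m : repOf M) (ξ : upperKer k A a) :
    (upperTensor A M).map f (umk A M a m ξ) =
      umk A M b m ((Finsupp.lmapDomain k k (A.obj.map f)).restrict (upperKer_map k A f) ξ) := rfl

theorem lmk_map {a b : C} (f : a ⟶ b) (m : repOf M) (ξ : A.obj.obj a →₀ k) :
    (lowerTensor A M).map f (lmk A M a m ξ) = lmk A M b m (ξ.mapDomain (A.obj.map f)) := rfl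

theorem tensorMap_umk {a : C} (m : repOf M) (ξ : upperKer k A a) :
    (tensorMap A M).app a (umk A M a m ξ) = lmk A M a m ξ.1 := rfl

theorem umk_rho {a : C} (g : Aut A) (m : repOf M) (ξ : upperKer k A a) :
    umk A M a ((repOf M).ρ g m) (upperRho k A a g ξ) = umk A M a m ξ :=
  tmk_rho M (upperObj k A a) g m ξ

theorem lmk_rho {a : C} (g : Aut A) (m : repOf M) (ξ : A.obj.obj a →₀ k) :
    lmk A M a ((repOf M).ρ g m) (ξ.mapDomain (g.hom.hom.app a)) = lmk A M a m ξ :=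
  tmk_rho M (Rep.of (lowerRho k A a)) g m ((lowerKer k A a).mkQ ξ)

theorem lmk_eq_zero {a : C} (m : repOf M) {ξ : A.obj.obj a →₀ k} (hξ : ξ ∈ lowerKer k A a) :
    lmk A M a m ξ = 0 := by
  change tmk M (Rep.of (lowerRho k A a)) m ((lowerKer k A a).mkQ ξ) = 0
  have h : (lowerKer k A a).mkQ ξ = 0 := (Submodule.Quotient.mk_eq_zero _).2 hξ
  rw [h]
  exact map_zero _

theorem umk_induction {a : C} {p : (upperTensor A M).obj a → Prop} (h0 : p 0)
    (hadd : ∀ s t, p s → p t → p (s + t)) (h : ∀ m x, p (umk A M a m x))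
    (t : (upperTensor A M).obj a) : p t :=
  tmk_induction M (upperObj k A a) h0 hadd h t

theorem lmk_induction {a : C} {p : (lowerTensor A M).obj a → Prop} (h0 : p 0)
    (hadd : ∀ s t, p s → p t → p (s + t)) (h : ∀ m x r, p (lmk A M a m (Finsupp.single x r)))
    (t : (lowerTensor A M).obj a) : p t := by
  refine tmk_induction M (Rep.of (lowerRho k A a)) h0 hadd (fun m x => ?_) t
  obtain ⟨ξ, rfl⟩ := (lowerKer k A a).mkQ_surjective x
  change p (lmk A M a m ξ)
  induction ξ using Finsupp.induction_linear with
  | zero => rw [map_zero]; exact h0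
  | add f g hf hg => rw [map_add]; exact hadd _ _ hf hg
  | single x r => exact h m x r

theorem single_mem_lowerKer {a : C} {x : A.obj.obj a} (hx : ¬ IsGen A x) (r : k) :
    Finsupp.single x r ∈ lowerKer k A a := by
  refine Submodule.mem_iSup_of_mem (SubRep.span x) (Submodule.mem_iSup_of_mem
    (fun h => hx (SubRep.span_eq_top.1 h)) ?_)
  exact ⟨Finsupp.single ⟨x, SubRep.self_mem_span x⟩ r, by simp⟩

open Classical in
variable (M) in
/-- The endomorphism of `M` given by `σ⁻¹` if `w = σ v`, where `v` is a generator. -/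
def transporter {a : C} (v w : A.obj.obj a) : repOf M →ₗ[k] repOf M :=
  if h : IsGen A v ∧ ∃ σ : Aut A, σ.hom.hom.app a v = w then (repOf M).ρ (h.2.choose)⁻¹ else 0

theorem transporter_app {a : C} {v : A.obj.obj a} (hv : IsGen A v) (σ : Aut A) :
    transporter M v (σ.hom.hom.app a v) = (repOf M).ρ σ⁻¹ := by
  have h : IsGen A v ∧ ∃ τ : Aut A, τ.hom.hom.app a v = σ.hom.hom.app a v := ⟨hv, σ, rfl⟩
  rw [transporter, dif_pos h, aut_eq_of_gen hv h.2.choose_spec]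

theorem transporter_eq_zero {a : C} {v w : A.obj.obj a}
    (h : ¬ (IsGen A v ∧ ∃ σ : Aut A, σ.hom.hom.app a v = w)) : transporter M v w = 0 :=
  dif_neg h

theorem transporter_aut {a : C} (v w : A.obj.obj a) (g : Aut A) (m : repOf M) :
    transporter M v (g.hom.hom.app a w) ((repOf M).ρ g m) = transporter M v w m := by
  by_cases h : IsGen A v ∧ ∃ σ : Aut A, σ.hom.hom.app a v = w
  · obtain ⟨hv, σ, rfl⟩ := h
    have h1 : g.hom.hom.app a (σ.hom.hom.app a v) = (g * σ).hom.hom.app a v := rfl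
    rw [h1, transporter_app hv, transporter_app hv, mul_inv_rev, map_mul, Module.End.mul_apply,
      Representation.inv_self_apply]
  · rw [transporter_eq_zero h, transporter_eq_zero]
    · rfl
    · rintro ⟨hv, σ, hσ⟩
      refine h ⟨hv, g⁻¹ * σ, ?_⟩
      change g.inv.hom.app a (σ.hom.hom.app a v) = w
      rw [hσ, aut_inv_apply]

variable (M) in
/-- The coefficient at the generator `v` of an element of `M ⊗ Q_A`. -/
def coeff {a : C} (v : A.obj.obj a) : (lowerTensor A M).obj a →ₗ[k] repOf M :=
  tlift M (Rep.of (lowerRho k A a))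
    ((lowerKer k A a).liftQ (Finsupp.linearCombination k (transporter M v)) (by
      refine iSup₂_le fun B hB => ?_
      rintro _ ⟨y, rfl⟩
      rw [LinearMap.mem_ker, Finsupp.lmapDomain_apply, Finsupp.linearCombination_mapDomain]
      refine Finset.sum_eq_zero fun x _ => ?_
      -- An element of a proper subfunctor is not of the form `σ v` with `v` a generator.
      have : transporter M v x.1 = 0 := by
        refine transporter_eq_zero ?_
        rintro ⟨hv, σ, hσ⟩
        refine hB (top_unique ?_)
        rw [← SubRep.span_eq_top.2 (isGen_aut σ hv), SubRep.span_le, hσ]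
        exact x.2
      simp [this])).flip
    (by
      intro g m x
      obtain ⟨ξ, rfl⟩ := (lowerKer k A a).mkQ_surjective x
      change (Finsupp.linearCombination k (transporter M v) (ξ.mapDomain (g.hom.hom.app a)))
        ((repOf M).ρ g m) = Finsupp.linearCombination k (transporter M v) ξ m
      induction ξ using Finsupp.induction_linear with
      | zero => simp
      | add f g hf hg =>
        rw [Finsupp.mapDomain_add, map_add, map_add, LinearMap.add_apply, hf, hg]
        rfl
      | single x r =>
        rw [Finsupp.mapDomain_single, Finsupp.linearCombination_single,
          Finsupp.linearCombination_single, LinearMap.smul_apply, LinearMap.smul_apply,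
          transporter_aut])

theorem coeff_lmk {a : C} (v : A.obj.obj a) (m : repOf M) (ξ : A.obj.obj a →₀ k) :
    coeff M v (lmk A M a m ξ) = Finsupp.linearCombination k (transporter M v) ξ m := rfl

theorem coeff_lmk_single {a : C} (v w : A.obj.obj a) (m : repOf M) (r : k) :
    coeff M v (lmk A M a m (Finsupp.single w r)) = r • transporter M v w m := by
  rw [coeff_lmk, Finsupp.linearCombination_single]
  rfl

/-- An element of `M ⊗ Q_A` all of whose coefficients vanish is zero. -/
theorem exists_coeff_ne_zero {a : C} [Finite (A.obj.obj a)] {t : (lowerTensor A M).obj a}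
    (ht : t ≠ 0) : ∃ v : A.obj.obj a, IsGen A v ∧ coeff M v t ≠ 0 := by
  classical
  have : Fintype (A.obj.obj a) := Fintype.ofFinite _
  let s : Setoid (A.obj.obj a) :=
    { r := fun x y => ∃ σ : Aut A, σ.hom.hom.app a x = y
      iseqv :=
        { refl := fun x => ⟨1, rfl⟩
          symm := by
            rintro x _ ⟨σ, rfl⟩
            exact ⟨σ⁻¹, aut_inv_apply A σ a x⟩
          trans := by
            rintro x _ _ ⟨σ, rfl⟩ ⟨τ, rfl⟩
            exact ⟨τ * σ, rfl⟩ } }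
  -- An element is recovered from its coefficients at one representative of each orbit of `Aut A`;
  -- orbits of elements that do not generate contribute nothing.
  have key : ∀ t : (lowerTensor A M).obj a,
      t = ∑ q : Quotient s, lmk A M a (coeff M q.out t) (Finsupp.single q.out 1) := by
    intro t
    induction t using lmk_induction with
    | h0 => simp
    | hadd x y hx hy =>
      simp only [map_add, LinearMap.add_apply, Finset.sum_add_distrib]
      rw [← hx, ← hy]
    | h m x r =>
      rw [Finset.sum_eq_single (Quotient.mk s x)]
      · obtain ⟨σ, hσ⟩ : ∃ σ : Aut A, σ.hom.hom.app a (Quotient.mk s x).out = x :=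
          Quotient.mk_out (s := s) x
        by_cases hx : IsGen A x
        · have hx' : IsGen A (Quotient.mk s x).out := by
            rw [← aut_inv_apply A σ a (Quotient.mk s x).out, hσ]
            exact isGen_aut σ⁻¹ hx
          generalize (Quotient.mk s x).out = v at hσ hx'
          have h1 := lmk_rho σ ((repOf M).ρ σ⁻¹ m) (Finsupp.single v (1 : k))
          rw [Finsupp.mapDomain_single, Representation.self_inv_apply, hσ] at h1
          have h2 := transporter_app (M := M) hx' σ
          rw [hσ] at h2
          rw [coeff_lmk_single, h2, map_smul, LinearMap.smul_apply, ← h1, ← map_smul,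
            Finsupp.smul_single, smul_eq_mul, mul_one]
        · rw [lmk_eq_zero m (single_mem_lowerKer hx r), map_zero, map_zero, LinearMap.zero_apply]
      · intro q _ hq
        rw [coeff_lmk_single, transporter_eq_zero, LinearMap.zero_apply, smul_zero, map_zero,
          LinearMap.zero_apply]
        rintro ⟨-, h⟩
        apply hq
        rw [← Quotient.out_eq q]
        exact Quotient.sound h
      · intro h
        exact absurd (Finset.mem_univ _) h
  by_contra! h
  apply ht
  rw [key t]
  refine Finset.sum_eq_zero fun q _ => ?_
  by_cases hq : IsGen A q.out
  · rw [h _ hq, map_zero, LinearMap.zero_apply]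
  · rw [lmk_eq_zero _ (single_mem_lowerKer hq 1)]

/-- The coefficient at `v` of `m ⊗ ζ`, if all terms of `ζ` have the same generator as image under
a fixed morphism. -/
theorem coeff_lmk_of_forall {x z : C} (h : z ⟶ x) {w : A.obj.obj x} (hw : IsGen A w)
    {v : A.obj.obj z} (hv : A.obj.map h v = w) (m : repOf M) {ζ : A.obj.obj z →₀ k}
    (hζ : ∀ s ∈ ζ.support, A.obj.map h s = w) : coeff M v (lmk A M z m ζ) = ζ v • m := by
  have hgen : IsGen A v := isGen_of_map h (hv ▸ hw)
  rw [coeff_lmk, Finsupp.linearCombination_apply, Finsupp.sum, LinearMap.sum_apply,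
    Finset.sum_eq_single v]
  · have : transporter M v v = LinearMap.id := by
      have := transporter_app (M := M) hgen 1
      rw [inv_one, map_one] at this
      exact this
    rw [this]
    rfl
  · intro s hs hsv
    rw [transporter_eq_zero]
    · simp
    -- By naturality along `h`, `σ` fixes the generator `w`, hence is the identity.
    · rintro ⟨-, σ, rfl⟩
      apply hsv
      have h1 := hζ _ hs
      rw [← rep_naturality, hv] at h1
      have : σ = 1 := aut_eq_of_gen hw h1
      rw [this]
      rfl
  · intro hs
    rw [Finsupp.notMem_support_iff.1 hs, zero_smul, LinearMap.zero_apply]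

section Fintype

variable [∀ a b : C, Fintype (a ⟶ b)]

/-- Dichotomy: if no automorphism sends `v` to `w`, then `exists_iso_of_card_le` with `A' = A`
yields a morphism killing `w` but not `v`, and the twisted sum vanishes. Otherwise `twist_app`
computes it, and the automorphism is moved to the other side of the tensor product. -/
theorem exists_twist [∀ c, Finite (A.obj.obj c)] {a b : C} {v : A.obj.obj a} (hv : IsGen A v)
    (η : upperKer k A b) (w : A.obj.obj a) : ∃ T : upperKer k A b, T.1 = twist v η.1 w ∧
      ∀ m : repOf M, umk A M b m T =
        (Nat.card (orbit A v b).ker : k) • umk A M b (transporter M v w m) η := by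
  by_cases h : ∃ σ : Aut A, σ.hom.hom.app a v = w
  · obtain ⟨σ, rfl⟩ := h
    refine ⟨(Nat.card (orbit A v b).ker : k) • upperRho k A b σ η, ?_, fun m => ?_⟩
    · rw [twist_app hv]
      rfl
    · rw [map_smul, transporter_app hv, ← umk_rho σ _ η, Representation.self_inv_apply]
  · refine ⟨0, ?_, fun m => ?_⟩
    · rw [twist_eq_zero η.2]
      · rfl
      · by_contra! hc
        exact h (exists_iso_of_card_le (fun c => le_rfl) hv hc)
    · rw [transporter_eq_zero fun hh => h hh.2]
      simp

/-- The central identity: a combination of morphisms depending only on `v` and `η` turns an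
arbitrary `t` into a pure tensor `m ⊗ η`, with `m` the coefficient of `t` at `v`. For `t = m ⊗ ξ`,
exchanging the sums over `f` and over the support of `ξ` leaves one twisted sum for each `w`. -/
theorem sum_map_upperTensor [∀ c, Finite (A.obj.obj c)] {a b : C} {v : A.obj.obj a}
    (hv : IsGen A v) (η : upperKer k A b) (t : (upperTensor A M).obj a) :
    ∑ f : a ⟶ b, η.1 (A.obj.map f v) • (upperTensor A M).map f t =
      (Nat.card (orbit A v b).ker : k) • umk A M b (coeff M v ((tensorMap A M).app a t)) η := by
  induction t using umk_induction with
  | h0 => simp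
  | hadd s t hs ht =>
    simp only [map_add, smul_add, Finset.sum_add_distrib, LinearMap.add_apply]
    rw [hs, ht]
  | h m ξ =>
    choose T hT hT' using exists_twist (M := M) hv η
    have h1 : ∑ f : a ⟶ b, η.1 (A.obj.map f v) •
        (Finsupp.lmapDomain k k (A.obj.map f)).restrict (upperKer_map k A f) ξ =
        ∑ w ∈ ξ.1.support, ξ.1 w • T w := by
      refine Subtype.ext ?_
      have e1 : ((∑ f : a ⟶ b, η.1 (A.obj.map f v) •
          (Finsupp.lmapDomain k k (A.obj.map f)).restrict (upperKer_map k A f) ξ :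
          upperKer k A b) : A.obj.obj b →₀ k) =
          ∑ f : a ⟶ b, η.1 (A.obj.map f v) • ξ.1.mapDomain (A.obj.map f) := by
        rw [AddSubmonoidClass.coe_finsetSum]
        rfl
      have e2 : ((∑ w ∈ ξ.1.support, ξ.1 w • T w : upperKer k A b) : A.obj.obj b →₀ k) =
          ∑ w ∈ ξ.1.support, ξ.1 w • twist v η.1 w := by
        rw [AddSubmonoidClass.coe_finsetSum]
        exact Finset.sum_congr rfl fun w _ => by rw [← hT w]; rfl
      rw [e1, e2]
      simp only [twist, Finset.smul_sum]
      rw [Finset.sum_comm]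
      refine Finset.sum_congr rfl fun f _ => ?_
      rw [Finsupp.mapDomain, Finsupp.sum, Finset.smul_sum]
      refine Finset.sum_congr rfl fun w _ => ?_
      rw [smul_smul, mul_comm, ← smul_smul, Finsupp.smul_single _ _ (1 : k), smul_eq_mul, mul_one]
    have h2 : ∑ f : a ⟶ b, η.1 (A.obj.map f v) • (upperTensor A M).map f (umk A M a m ξ) =
        umk A M b m (∑ f : a ⟶ b, η.1 (A.obj.map f v) •
          (Finsupp.lmapDomain k k (A.obj.map f)).restrict (upperKer_map k A f) ξ) := by
      rw [map_sum]
      refine Finset.sum_congr rfl fun f _ => ?_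
      rw [umk_map, map_smul]
    rw [h2, h1, tensorMap_umk, coeff_lmk, Finsupp.linearCombination_apply, Finsupp.sum, map_sum,
      LinearMap.sum_apply, map_sum, LinearMap.sum_apply, Finset.smul_sum]
    refine Finset.sum_congr rfl fun w _ => ?_
    rw [map_smul, hT', LinearMap.smul_apply, map_smul, LinearMap.smul_apply, smul_comm]

end Fintype

/-! ### Elements of `Q^A` -/

theorem upperKer_translate {b c : C} (i : b ⟶ c) (p : A.obj.obj c) {ξ : A.obj.obj b →₀ k}
    (hξ : ξ ∈ upperKer k A b) :
    ξ.mapDomain (fun u => A.obj.map i u + p) ∈ upperKer k A c := by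
  rw [mem_upperKer] at hξ ⊢
  intro B hB
  refine cosetKer_map _ (fun x y hxy => ?_) (hξ B hB)
  have h : -(A.obj.map i x + p) + (A.obj.map i y + p) = A.obj.map i (-x + y) := by
    rw [map_add, map_neg]
    abel
  rw [h]
  exact B.map_mem i _ hxy

variable [HasBinaryBiproducts C]

theorem inl_add_inr_injective {b c : C} {x x' : A.obj.obj b} {y y' : A.obj.obj c}
    (h : A.obj.map (biprod.inl : b ⟶ b ⊞ c) x + A.obj.map (biprod.inr : c ⟶ b ⊞ c) y =
      A.obj.map (biprod.inl : b ⟶ b ⊞ c) x' + A.obj.map (biprod.inr : c ⟶ b ⊞ c) y') :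
    x = x' ∧ y = y' := by
  constructor
  · have := congrArg (A.obj.map biprod.fst) h
    simpa only [map_add, ← rep_map_comp, biprod.inl_fst, biprod.inr_fst, rep_map_id, rep_map_zero,
      add_zero] using this
  · have := congrArg (A.obj.map biprod.snd) h
    simpa only [map_add, ← rep_map_comp, biprod.inl_snd, biprod.inr_snd, rep_map_id, rep_map_zero,
      zero_add] using this

variable (k) in
-- The element is the product of the `[n] - [0]` over the nonzero `n ∈ A(b)`, each placed on its own
-- summand `b`. A factor dies in `k[A/B]` once `n ∈ B`, every nonzero `B` contains such an `n`
-- because `b` cogenerates, and the separate summands keep the product nonzero.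
theorem IsCogen.exists_upperKer_ne_zero {b : C} (hb : IsCogen A b) [Finite (A.obj.obj b)] :
    ∃ (c : C) (η : A.obj.obj c →₀ k), η ∈ upperKer k A c ∧ η ≠ 0 := by
  classical
  have : Fintype (A.obj.obj b) := Fintype.ofFinite _
  have key : ∀ s : Finset (A.obj.obj b), ∃ (c : C) (η : A.obj.obj c →₀ k), η ≠ 0 ∧
      ∀ n ∈ s, n ≠ 0 → ∀ B : SubRep A, n ∈ B.obj b → η ∈ cosetKer k (B.obj c) := by
    intro s
    induction s using Finset.induction_on with
    | empty => exact ⟨b, Finsupp.single 0 1, by simp, by simp⟩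
    | insert n s _ ih =>
      obtain ⟨c, η, hη, h⟩ := ih
      by_cases hn : n = 0
      · refine ⟨c, η, hη, fun n' hn' h0 => ?_⟩
        rcases Finset.mem_insert.1 hn' with rfl | hn'
        · exact absurd hn h0
        · exact h n' hn' h0
      have hinj : Function.Injective (A.obj.map (biprod.inl : c ⟶ c ⊞ b)) := by
        intro x y hxy
        exact (inl_add_inr_injective (y := (0 : A.obj.obj b)) (y' := 0) (by rw [hxy])).1
      set ζ : A.obj.obj (c ⊞ b) →₀ k := η.mapDomain (A.obj.map biprod.inl) with hζ
      refine ⟨c ⊞ b, shift (A.obj.map biprod.inr n) ζ - ζ, ?_, fun n' hn' h0 B hB => ?_⟩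
      · obtain ⟨u, hu⟩ := Finsupp.ne_iff.1 hη
        rw [Finsupp.zero_apply] at hu
        -- Since `n ≠ 0`, the translated copy of `ζ` is supported away from the first summand.
        refine Finsupp.ne_iff.2 ⟨A.obj.map biprod.inl u, ?_⟩
        rw [Finsupp.sub_apply, hζ, Finsupp.mapDomain_apply hinj, shift, Finsupp.lmapDomain_apply,
          ← Finsupp.mapDomain_comp, Finsupp.mapDomain_of_notMem_range, zero_sub, Finsupp.zero_apply]
        · simpa using hu
        · rintro ⟨u', hu'⟩
          have hu'' : A.obj.map (biprod.inl : c ⟶ c ⊞ b) u' +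
              A.obj.map (biprod.inr : b ⟶ c ⊞ b) n = A.obj.map (biprod.inl : c ⟶ c ⊞ b) u +
              A.obj.map (biprod.inr : b ⟶ c ⊞ b) 0 := by
            rw [map_zero, add_zero]
            exact hu'
          exact hn (inl_add_inr_injective hu'').2
      · rcases Finset.mem_insert.1 hn' with rfl | hn'
        · exact shift_sub_mem (B.map_mem _ _ hB) ζ
        · have h1 : ζ ∈ cosetKer k (B.obj (c ⊞ b)) :=
            cosetKer_map _ (fun x y hxy => by
              rw [← map_neg, ← map_add]
              exact B.map_mem _ _ hxy) (h n' hn' h0 B hB)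
          refine Submodule.sub_mem _ ?_ h1
          exact cosetKer_map _ (fun x y hxy => by
            have : -(x + A.obj.map biprod.inr n) + (y + A.obj.map biprod.inr n) = -x + y := by abel
            rwa [this]) h1
  obtain ⟨c, η, hη, h⟩ := key Finset.univ
  refine ⟨c, η, mem_upperKer.2 fun B hB => ?_, hη⟩
  have : ∃ n ∈ B.obj b, n ≠ 0 := by
    by_contra! hn
    exact hB (SubRep.eq_bot_iff_forall.2 fun c x hx => hb c x fun f => hn _ (B.map_mem f x hx))
  obtain ⟨n, hn, hn0⟩ := this
  exact h n (Finset.mem_univ _) hn0 B hn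

/-- Adding the generator `w` on a new summand makes every term of `η` a generator with projection
`w`. Distinct terms then lie in distinct orbits of `Aut A`, and the coefficient at a term is `m`
times a value of `η`. -/
theorem exists_coeff_umk_ne_zero {x : C} {w : A.obj.obj x} (hw : IsGen A w) {b : C}
    (hb : IsCogen A b) [Finite (A.obj.obj b)] :
    ∃ (c : C) (η : upperKer k A c) (v : A.obj.obj c), ∀ m : repOf M, m ≠ 0 →
      coeff M v ((tensorMap A M).app c (umk A M c m η)) ≠ 0 := by
  obtain ⟨c, η, hη, hne⟩ := hb.exists_upperKer_ne_zero k
  obtain ⟨u, hu⟩ := Finsupp.ne_iff.1 hne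
  let j : A.obj.obj c → A.obj.obj (x ⊞ c) :=
    fun u => A.obj.map biprod.inr u + A.obj.map biprod.inl w
  have hj : ∀ u, A.obj.map biprod.fst (j u) = w := fun u => by
    simp only [j, map_add, ← rep_map_comp, biprod.inl_fst, biprod.inr_fst, rep_map_id,
      rep_map_zero, zero_add]
  have hinj : Function.Injective j := fun u u' h => by
    simp only [j, add_left_inj] at h
    exact (inl_add_inr_injective (x := (0 : A.obj.obj x)) (x' := 0) (by rw [h])).2
  refine ⟨x ⊞ c, ⟨η.mapDomain j, upperKer_translate _ _ hη⟩, j u, fun m hm => ?_⟩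
  rw [tensorMap_umk, coeff_lmk_of_forall biprod.fst hw (hj u), Finsupp.mapDomain_apply hinj]
  · exact smul_ne_zero hu hm
  · classical
    intro s hs
    obtain ⟨u', -, rfl⟩ := Finset.mem_image.1 (Finsupp.mapDomain_support hs)
    exact hj u'

end QTensor

/-! ### Pointwise description of monomorphisms and epimorphisms -/

section Pointwise

variable {k : Type v} [Field k] {C : Type u} [Category.{v} C]

theorem mono_iff_injective {F F' : C ⥤ ModuleCat.{v} k} (α : F ⟶ F') :
    Mono α ↔ ∀ a, Function.Injective (α.app a) := by
  rw [NatTrans.mono_iff_mono_app]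
  exact forall_congr' fun a => ModuleCat.mono_iff_injective _

theorem epi_iff_surjective {F F' : C ⥤ ModuleCat.{v} k} (α : F ⟶ F') :
    Epi α ↔ ∀ a, Function.Surjective (α.app a) := by
  rw [NatTrans.epi_iff_epi_app]
  exact forall_congr' fun a => ModuleCat.epi_iff_surjective _

theorem exists_app_ne_zero {F F' : C ⥤ ModuleCat.{v} k} {α : F ⟶ F'} (h : α ≠ 0) :
    ∃ (a : C) (x : F.obj a), α.app a x ≠ 0 := by
  by_contra! h'
  apply h
  ext a x
  exact h' a x

theorem naturality_apply {F F' : C ⥤ ModuleCat.{v} k} (α : F ⟶ F') {a b : C} (f : a ⟶ b)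
    (x : F.obj a) : α.app b (F.map f x) = F'.map f (α.app a x) := by
  have := ConcreteCategory.congr_hom (α.naturality f) x
  simpa only [ConcreteCategory.comp_apply] using this

theorem isZero_of_forall {F : C ⥤ ModuleCat.{v} k} (h : ∀ (a : C) (y : F.obj a), y = 0) :
    IsZero F := by
  rw [Functor.isZero_iff]
  intro a
  have : Subsingleton (F.obj a) := ⟨fun y z => (h a y).trans (h a z).symm⟩
  exact ModuleCat.isZero_of_subsingleton _

end Pointwise

/-! ### Modules over a group algebra -/

section GroupAlgebra

variable {k : Type v} [Field k] {G : Type w} [Group G]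

/-- A subgroup stable under scalars and group elements is a submodule. -/
def stableSubmodule {N : Type*} [AddCommGroup N] [Module (MonoidAlgebra k G) N] (p : AddSubgroup N)
    (hg : ∀ (g : G), ∀ x ∈ p, MonoidAlgebra.of k G g • x ∈ p)
    (hc : ∀ (c : k), ∀ x ∈ p, algebraMap k (MonoidAlgebra k G) c • x ∈ p) :
    Submodule (MonoidAlgebra k G) N where
  carrier := p
  add_mem' := p.add_mem
  zero_mem' := p.zero_mem
  smul_mem' r x hx := by
    induction r using MonoidAlgebra.induction_on with
    | of g => exact hg g x hx
    | add r s hr hs => rw [add_smul]; exact p.add_mem hr hs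
    | smul c r hr => rw [Algebra.smul_def, mul_smul]; exact hc c _ hr

theorem stable_eq_top {M : ModuleCat.{v} (MonoidAlgebra k G)} (hM : Simple M)
    (p : Submodule k (repOf M)) (hp : ∀ (g : G), ∀ m ∈ p, (repOf M).ρ g m ∈ p)
    (hne : ∃ m ∈ p, m ≠ 0) (m : repOf M) : m ∈ p := by
  have := (simple_iff_isSimpleModule' M).1 hM
  let P : Submodule (MonoidAlgebra k G) M := stableSubmodule (N := M) p.toAddSubgroup
    (fun g x hx => hp g x hx) (fun c x hx => p.smul_mem c hx)
  have hP : P ≠ ⊥ := by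
    obtain ⟨m, hm, hm0⟩ := hne
    intro h
    have hm' : (show M from m) ∈ P := hm
    exact hm0 ((Submodule.eq_bot_iff P).1 h _ hm')
  have hP' : P = ⊤ := (eq_bot_or_eq_top P).resolve_left hP
  have hm : (show M from m) ∈ P := by
    rw [hP']
    exact Submodule.mem_top
  exact hm

end GroupAlgebra

/-! ### Simplicity of `Q(A, M)`, and recovery of `A` and `M` from it -/

section Classify

variable {k : Type v} [Field k] {C : Type u} [Category.{v} C] [Preadditive C]

/-- `A` has a generator and a cogenerating object. -/
def IsGenCogen (A : AddRep C) : Prop :=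
  (∃ (a : C) (v : A.obj.obj a), IsGen A v) ∧ ∃ b : C, IsCogen A b

theorem IsGenCogen.finite (hC : IsKTrivial k C) {A : AddRep C} (hA : IsGenCogen A) (c : C) :
    Finite (A.obj.obj c) := by
  obtain ⟨⟨a, v, hv⟩, -⟩ := hA
  exact hv.finite hC c

theorem IsFiniteRep.isGenCogen [HasZeroObject C] [HasBinaryBiproducts C] {A : AddRep C}
    (hA : IsFiniteRep A) : IsGenCogen A :=
  ⟨hA.exists_isGen, hA.exists_isCogen⟩

theorem card_ker_ne_zero (hC : IsKTrivial k C) {A : AddRep C} {a : C} (v : A.obj.obj a) (b : C) :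
    (Nat.card (orbit A v b).ker : k) ≠ 0 :=
  card_ne_zero_of_subgroup k _ (hC a b).2

section

variable {A : AddRep C} {M : ModuleCat.{v} (MonoidAlgebra k (Aut A))}

/-- The projection `M ⊗ Q^A ⟶ Q(A, M)`. -/
def toQ (A : AddRep C) (M : ModuleCat.{v} (MonoidAlgebra k (Aut A))) : upperTensor A M ⟶ Q A M :=
  factorThruImage (tensorMap A M)

/-- The inclusion `Q(A, M) ⟶ M ⊗ Q_A`. -/
def fromQ (A : AddRep C) (M : ModuleCat.{v} (MonoidAlgebra k (Aut A))) : Q A M ⟶ lowerTensor A M :=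
  image.ι (tensorMap A M)

instance : Epi (toQ A M) := inferInstanceAs (Epi (factorThruImage (tensorMap A M)))

instance : Mono (fromQ A M) := inferInstanceAs (Mono (image.ι (tensorMap A M)))

theorem toQ_fromQ : toQ A M ≫ fromQ A M = tensorMap A M := image.fac _

theorem fromQ_toQ_apply {a : C} (t : (upperTensor A M).obj a) :
    (fromQ A M).app a ((toQ A M).app a t) = (tensorMap A M).app a t := by
  rw [← toQ_fromQ]
  rfl

theorem toQ_eq_zero_iff {a : C} {t : (upperTensor A M).obj a} :
    (toQ A M).app a t = 0 ↔ (tensorMap A M).app a t = 0 := by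
  rw [← fromQ_toQ_apply]
  constructor
  · intro h
    rw [h, map_zero]
  · intro h
    exact (mono_iff_injective (fromQ A M)).1 inferInstance a (by rw [h, map_zero])

theorem toQ_surjective (a : C) : Function.Surjective ((toQ A M).app a) :=
  (epi_iff_surjective (toQ A M)).1 inferInstance a

end

/-- A subfunctor of `M ⊗ Q^A` with nonzero image in `M ⊗ Q_A` is everything. -/
theorem mem_of_tensorMap_ne_zero (hC : IsKTrivial k C) {A : AddRep C} (hA : IsGenCogen A)
    {M : ModuleCat.{v} (MonoidAlgebra k (Aut A))} (hM : Simple M)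
    (T : ∀ a, Submodule k ((upperTensor A M).obj a))
    (hT : ∀ {a b : C} (f : a ⟶ b), ∀ t ∈ T a, (upperTensor A M).map f t ∈ T b)
    {a : C} {t : (upperTensor A M).obj a} (ht : t ∈ T a) (ht0 : (tensorMap A M).app a t ≠ 0)
    (b : C) (s : (upperTensor A M).obj b) : s ∈ T b := by
  have : ∀ a b : C, Fintype (a ⟶ b) := fun a b => by
    have := (hC a b).1
    exact Fintype.ofFinite _
  have := hA.finite hC
  obtain ⟨v, hv, hm⟩ := exists_coeff_ne_zero ht0
  -- The `m` with `m ⊗ Q^A ⊆ T` form a subrepresentation of `M`. By `sum_map_upperTensor` it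
  -- contains a nonzero coefficient of `t`, so it is all of `M`.
  let p : Submodule k (repOf M) :=
    { carrier := {m | ∀ (b : C) (η : upperKer k A b), umk A M b m η ∈ T b}
      zero_mem' := fun b η => by
        rw [map_zero]
        exact Submodule.zero_mem _
      add_mem' := fun {m m'} h h' b η => by
        rw [map_add]
        exact Submodule.add_mem _ (h b η) (h' b η)
      smul_mem' := fun c m h b η => by
        rw [map_smul]
        exact Submodule.smul_mem _ c (h b η) }
  have hp := stable_eq_top hM p (fun g m hm b η => by
    have := umk_rho g m (upperRho k A b g⁻¹ η)
    rw [Representation.self_inv_apply] at this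
    rw [this]
    exact hm b _) ⟨_, fun b η => by
    have h1 := sum_map_upperTensor hv η t
    have h2 : (Nat.card (orbit A v b).ker : k) •
        umk A M b (coeff M v ((tensorMap A M).app a t)) η ∈ T b := by
      rw [← h1]
      exact Submodule.sum_mem _ fun f _ => Submodule.smul_mem _ _ (hT f t ht)
    exact (Submodule.smul_mem_iff _ (card_ker_ne_zero hC v b)).1 h2, hm⟩
  induction s using umk_induction with
  | h0 => exact Submodule.zero_mem _
  | hadd s t hs ht => exact Submodule.add_mem _ hs ht
  | h m η => exact hp m b η

theorem exists_toQ_umk_ne_zero [HasBinaryBiproducts C] (hC : IsKTrivial k C) {A : AddRep C}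
    (hA : IsGenCogen A) (M : ModuleCat.{v} (MonoidAlgebra k (Aut A))) :
    ∃ (c : C) (η : upperKer k A c),
      ∀ m : repOf M, m ≠ 0 → (toQ A M).app c (umk A M c m η) ≠ 0 := by
  have hA' := hA.finite hC
  obtain ⟨⟨x, w, hw⟩, b, hb⟩ := hA
  obtain ⟨c, η, v, h⟩ := exists_coeff_umk_ne_zero (M := M) hw hb
  refine ⟨c, η, fun m hm h0 => h m hm ?_⟩
  rw [toQ_eq_zero_iff.1 h0, map_zero]

theorem toQ_ne_zero [HasBinaryBiproducts C] (hC : IsKTrivial k C) {A : AddRep C}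
    (hA : IsGenCogen A) {M : ModuleCat.{v} (MonoidAlgebra k (Aut A))} (hM : Simple M) :
    toQ A M ≠ 0 := by
  have := (simple_iff_isSimpleModule' M).1 hM
  have := IsSimpleModule.nontrivial (MonoidAlgebra k (Aut A)) M
  obtain ⟨m, hm⟩ := exists_ne (0 : M)
  obtain ⟨c, η, h⟩ := exists_toQ_umk_ne_zero hC hA M
  intro h0
  apply h m hm
  rw [h0]
  rfl

theorem simple_Q [HasBinaryBiproducts C] (hC : IsKTrivial k C) {A : AddRep C}
    (hA : IsGenCogen A) {M : ModuleCat.{v} (MonoidAlgebra k (Aut A))} (hM : Simple M) :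
    Simple (Q A M) := by
  refine ⟨fun {Y} i _ => ⟨fun hi h0 => ?_, fun hi => ?_⟩⟩
  · apply toQ_ne_zero hC hA hM
    have h1 : 𝟙 (Q A M) = 0 := by
      exact (IsIso.inv_hom_id i).symm.trans ((congrArg (inv i ≫ ·) h0).trans comp_zero)
    rw [← Category.comp_id (toQ A M), h1, comp_zero]
  · obtain ⟨a, y, hy⟩ := exists_app_ne_zero hi
    obtain ⟨t, ht⟩ := toQ_surjective a (i.app a y)
    have hall := mem_of_tensorMap_ne_zero hC hA hM
      (fun b => (LinearMap.range (i.app b).hom).comap ((toQ A M).app b).hom)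
      (fun {b c} f s hs => by
        obtain ⟨z, hz⟩ := hs
        refine ⟨Y.map f z, ?_⟩
        change i.app c (Y.map f z) = (toQ A M).app c ((upperTensor A M).map f s)
        rw [naturality_apply, naturality_apply]
        exact congrArg _ hz)
      (t := t) ⟨y, ht.symm⟩ (by rw [Ne, ← toQ_eq_zero_iff, ht]; exact hy)
    have : Epi i := by
      rw [epi_iff_surjective]
      intro b z
      obtain ⟨s, rfl⟩ := toQ_surjective b z
      exact hall b s
    exact isIso_of_mono_of_epi i

/-- The kernel of `ρ` is a proper subfunctor, so it has zero image in `M ⊗ Q_A`. Hence the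
projection to `Q(A, M)` factors through `S`, and a nonzero map between simple objects is invertible.
-/
theorem nonempty_iso_Q [HasBinaryBiproducts C] (hC : IsKTrivial k C) {A : AddRep C}
    (hA : IsGenCogen A) {M : ModuleCat.{v} (MonoidAlgebra k (Aut A))} (hM : Simple M)
    {S : C ⥤ ModuleCat.{v} k}
    (hS : Simple S) (ρ : upperTensor A M ⟶ S) (hρ : ρ ≠ 0) : Nonempty (S ≅ Q A M) := by
  have : Epi ρ := epi_of_nonzero_to_simple hρ
  have hker : kernel.ι ρ ≫ toQ A M = 0 := by
    ext a s
    change (toQ A M).app a ((kernel.ι ρ).app a s) = 0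
    rw [toQ_eq_zero_iff]
    by_contra hne
    apply hρ
    have hall := mem_of_tensorMap_ne_zero hC hA hM (fun b => LinearMap.ker (ρ.app b).hom)
      (fun {b c} f s hs => by
        have hs' : ρ.app b s = 0 := hs
        change ρ.app c ((upperTensor A M).map f s) = 0
        rw [naturality_apply, hs', map_zero])
      (t := (kernel.ι ρ).app a s) (by
        have := ConcreteCategory.congr_hom (congrArg (fun α => α.app a) (kernel.condition ρ)) s
        exact this) hne
    ext b x
    exact hall b x
  have hd : Abelian.epiDesc ρ (toQ A M) hker ≠ 0 := by
    intro h0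
    apply toQ_ne_zero hC hA hM
    rw [← Abelian.comp_epiDesc ρ (toQ A M) hker, h0, comp_zero]
  have := simple_Q hC hA hM
  have := isIso_of_hom_simple hd
  exact ⟨asIso (Abelian.epiDesc ρ (toQ A M) hker)⟩

theorem nonempty_iso_Q_of_iso [HasBinaryBiproducts C] (hC : IsKTrivial k C) {A : AddRep C}
    (hA : IsGenCogen A) {M M' : ModuleCat.{v} (MonoidAlgebra k (Aut A))} (hM : Simple M)
    (hM' : Simple M')
    (e : M ≅ M') : Nonempty (Q A M ≅ Q A M') := by
  let ε : upperTensor A M' ≅ upperTensor A M := Functor.isoWhiskerLeft (qUpper k A)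
    ((Rep.coinvariantsTensor k (Aut A)).mapIso (Rep.ofModuleMonoidAlgebra.mapIso e.symm))
  refine nonempty_iso_Q hC hA hM' (simple_Q hC hA hM) (ε.hom ≫ toQ A M) fun h => ?_
  apply toQ_ne_zero hC hA hM
  rw [← Iso.inv_hom_id_assoc ε (toQ A M), h, comp_zero]

/-- Apply `∑ η(A(f)(v)) f` to a nonzero element of the common functor. Read through `A`, the result
is a nonzero class `m ⊗ η`. Read through `A'`, it is a combination of the `twist v η w` with `w ∈
A'(a)`; one of these must be nonzero, and `twist_eq_zero` gives the required implication for that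
`w`. -/
theorem exists_dominating [HasBinaryBiproducts C] (hC : IsKTrivial k C) {A A' : AddRep C}
    (hA : IsGenCogen A) (hA' : IsGenCogen A')
    {M : ModuleCat.{v} (MonoidAlgebra k (Aut A))} {M' : ModuleCat.{v} (MonoidAlgebra k (Aut A'))}
    (hM' : Simple M') (e : Q A' M' ≅ Q A M) :
    ∃ (a : C) (v : A.obj.obj a) (w : A'.obj.obj a), IsGen A v ∧
      ∀ (c : C) (f : a ⟶ c), A'.obj.map f w = 0 → A.obj.map f v = 0 := by
  have : ∀ a b : C, Fintype (a ⟶ b) := fun a b => by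
    have := (hC a b).1
    exact Fintype.ofFinite _
  have := hA.finite hC
  have hψ : toQ A' M' ≫ e.hom ≠ 0 := by
    intro h
    apply toQ_ne_zero hC hA' hM'
    rw [← Category.comp_id (toQ A' M'), ← e.hom_inv_id, ← Category.assoc, h, zero_comp]
  set ψ := toQ A' M' ≫ e.hom with hψ_def
  obtain ⟨a, t', ht'⟩ := exists_app_ne_zero hψ
  have hpure : ∃ (m' : repOf M') (ξ : upperKer k A' a), ψ.app a (umk A' M' a m' ξ) ≠ 0 := by
    by_contra! h
    apply ht'
    induction t' using umk_induction with
    | h0 => exact map_zero _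
    | hadd s t hs ht =>
      rw [map_add]
      by_cases h1 : ψ.app a s = 0
      · by_cases h2 : ψ.app a t = 0
        · rw [h1, h2, add_zero]
        · exact absurd (ht h2) h2
      · exact absurd (hs h1) h1
    | h m ξ => exact h m ξ
  obtain ⟨m', ξ, hξ⟩ := hpure
  obtain ⟨t, ht⟩ := toQ_surjective a (ψ.app a (umk A' M' a m' ξ))
  have ht0 : (tensorMap A M).app a t ≠ 0 := by
    rw [Ne, ← toQ_eq_zero_iff, ht]
    exact hξ
  obtain ⟨v, hv, hm⟩ := exists_coeff_ne_zero ht0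
  obtain ⟨b, η, hη⟩ := exists_toQ_umk_ne_zero hC hA M
  by_contra! hno
  have hno' : ∀ w : A'.obj.obj a, twist v η.1 w = 0 := fun w => by
    obtain ⟨c, f, h1, h2⟩ := hno a v w hv
    exact twist_eq_zero η.2 ⟨c, f, h1, h2⟩
  apply smul_ne_zero (card_ker_ne_zero hC v b) (hη _ hm)
  rw [← map_smul, ← sum_map_upperTensor hv η t, map_sum]
  have h1 : ∀ f : a ⟶ b, (toQ A M).app b (η.1 (A.obj.map f v) • (upperTensor A M).map f t) =
      ψ.app b (umk A' M' b m' (η.1 (A.obj.map f v) •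
        (Finsupp.lmapDomain k k (A'.obj.map f)).restrict (q := upperKer k A' b)
          (upperKer_map k A' f) ξ)) := by
    intro f
    rw [map_smul, naturality_apply, ht, ← naturality_apply, umk_map, map_smul, map_smul]
  rw [Finset.sum_congr rfl fun f _ => h1 f, ← map_sum, ← map_sum]
  have h2 : ∑ f : a ⟶ b, η.1 (A.obj.map f v) •
      (Finsupp.lmapDomain k k (A'.obj.map f)).restrict (q := upperKer k A' b)
        (upperKer_map k A' f) ξ = 0 := by
    refine Subtype.ext ?_
    rw [AddSubmonoidClass.coe_finsetSum]
    change ∑ f : a ⟶ b, η.1 (A.obj.map f v) • ξ.1.mapDomain (A'.obj.map f) = 0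
    have e2 : ∑ w ∈ ξ.1.support, ξ.1 w • twist v η.1 w = 0 :=
      Finset.sum_eq_zero fun w _ => by rw [hno' w, smul_zero]
    rw [← e2]
    simp only [twist, Finset.smul_sum]
    rw [Finset.sum_comm]
    refine Finset.sum_congr rfl fun f _ => ?_
    rw [Finsupp.mapDomain, Finsupp.sum, Finset.smul_sum]
    refine Finset.sum_congr rfl fun w _ => ?_
    rw [smul_smul, mul_comm, ← smul_smul, Finsupp.smul_single _ _ (1 : k), smul_eq_mul, mul_one]
  rw [h2, map_zero, map_zero]

/-- The hypothesis exhibits `A` as a quotient of the subfunctor `⟨w⟩` of `A'`. -/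
theorem card_le_of_dominating {A A' : AddRep C} [∀ c, Finite (A'.obj.obj c)] {a : C}
    {v : A.obj.obj a} {w : A'.obj.obj a} (hv : IsGen A v)
    (h : ∀ (c : C) (f : a ⟶ c), A'.obj.map f w = 0 → A.obj.map f v = 0) (c : C) :
    Nat.card (A.obj.obj c) ≤ Nat.card (A'.obj.obj c) := by
  refine Nat.card_le_card_of_injective
    (fun u => orbit A' w c (Function.surjInv (hv c) u)) fun u u' huu => ?_
  have h1 : orbit A' w c (Function.surjInv (hv c) u - Function.surjInv (hv c) u') = 0 := by
    rw [map_sub, sub_eq_zero]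
    exact huu
  have h2 : orbit A v c (Function.surjInv (hv c) u - Function.surjInv (hv c) u') = 0 := h c _ h1
  rwa [map_sub, sub_eq_zero, Function.surjInv_eq (hv c), Function.surjInv_eq (hv c)] at h2

theorem nonempty_iso_of_Q_iso [HasBinaryBiproducts C] (hC : IsKTrivial k C) {A A' : AddRep C}
    (hA : IsGenCogen A) (hA' : IsGenCogen A')
    {M : ModuleCat.{v} (MonoidAlgebra k (Aut A))} {M' : ModuleCat.{v} (MonoidAlgebra k (Aut A'))}
    (hM : Simple M) (hM' : Simple M') (e : Q A' M' ≅ Q A M) : Nonempty (A ≅ A') := by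
  have := hA.finite hC
  have := hA'.finite hC
  obtain ⟨a, v, w, hv, h⟩ := exists_dominating hC hA hA' hM' e
  obtain ⟨a', v', w', hv', h'⟩ := exists_dominating hC hA' hA hM e.symm
  exact ⟨(exists_iso_of_card_le (card_le_of_dominating hv' h') hv h).choose⟩

/-- The pairs `(m', m)` for which `m' ⊗ η` and `m ⊗ η` agree in `Q(A, M)` for all `η` form a
submodule of `M' × M`. It meets `0 × M` trivially, and applying `sum_map_upperTensor` on both sides
with the same `v` produces a pair with `m ≠ 0`. By simplicity it is the graph of an isomorphism. -/
theorem nonempty_module_iso_of_Q_iso [HasBinaryBiproducts C] (hC : IsKTrivial k C) {A : AddRep C}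
    (hA : IsGenCogen A) {M M' : ModuleCat.{v} (MonoidAlgebra k (Aut A))} (hM : Simple M)
    (hM' : Simple M')
    (e : Q A M' ≅ Q A M) : Nonempty (M' ≅ M) := by
  have : ∀ a b : C, Fintype (a ⟶ b) := fun a b => by
    have := (hC a b).1
    exact Fintype.ofFinite _
  have := hA.finite hC
  have hψ : toQ A M' ≫ e.hom ≠ 0 := by
    intro h
    apply toQ_ne_zero hC hA hM'
    rw [← Category.comp_id (toQ A M'), ← e.hom_inv_id, ← Category.assoc, h, zero_comp]
  set ψ := toQ A M' ≫ e.hom with hψ_def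
  obtain ⟨c₀, η₀, hη₀⟩ := exists_toQ_umk_ne_zero hC hA M
  let K : Submodule k (repOf M' × repOf M) :=
    { carrier := {p | ∀ (b : C) (η : upperKer k A b),
        ψ.app b (umk A M' b p.1 η) = (toQ A M).app b (umk A M b p.2 η)}
      zero_mem' := fun b η => by
        simp only [Prod.fst_zero, Prod.snd_zero, map_zero, LinearMap.zero_apply]
      add_mem' := fun {p q} hp hq b η => by
        rw [Prod.fst_add, Prod.snd_add, map_add, map_add, LinearMap.add_apply,
          LinearMap.add_apply, map_add, map_add, hp b η, hq b η]
      smul_mem' := fun c p hp b η => by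
        rw [Prod.smul_fst, Prod.smul_snd, map_smul, map_smul, LinearMap.smul_apply,
          LinearMap.smul_apply, map_smul, map_smul, hp b η] }
  have hK : ∀ (g : Aut A), ∀ p ∈ K, ((repOf M').ρ g p.1, (repOf M).ρ g p.2) ∈ K := by
    intro g p hp b η
    have h1 := umk_rho (M := M') g p.1 (upperRho k A b g⁻¹ η)
    have h2 := umk_rho (M := M) g p.2 (upperRho k A b g⁻¹ η)
    rw [Representation.self_inv_apply] at h1 h2
    rw [h1, h2]
    exact hp b _
  let R : Submodule (MonoidAlgebra k (Aut A)) (M' × M) := stableSubmodule K.toAddSubgroup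
    (fun g p hp => hK g p hp) (fun c p hp => K.smul_mem c hp)
  have hR : ∀ p ∈ R, p.1 = 0 → p.2 = 0 := by
    intro p hp h0
    by_contra hne
    apply hη₀ p.2 hne
    have h1 : ψ.app c₀ (umk A M' c₀ p.1 η₀) = (toQ A M).app c₀ (umk A M c₀ p.2 η₀) := hp c₀ η₀
    have h2 : ∀ m : repOf M', m = 0 → ψ.app c₀ (umk A M' c₀ m η₀) = 0 := by
      rintro _ rfl
      rw [map_zero, LinearMap.zero_apply, map_zero]
    exact h1.symm.trans (h2 p.1 h0)
  have hex : ∃ p ∈ R, p.2 ≠ 0 := by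
    obtain ⟨a, t', ht'⟩ := exists_app_ne_zero hψ
    obtain ⟨t, ht⟩ := toQ_surjective a (ψ.app a t')
    have ht0 : (tensorMap A M).app a t ≠ 0 := by
      rw [Ne, ← toQ_eq_zero_iff, ht]
      exact ht'
    obtain ⟨v, hv, hm⟩ := exists_coeff_ne_zero ht0
    refine ⟨(coeff M' v ((tensorMap A M').app a t'), coeff M v ((tensorMap A M).app a t)),
      fun b η => ?_, hm⟩
    have h1 := sum_map_upperTensor hv η t
    have h2 := sum_map_upperTensor hv η t'
    have h3 := congrArg ((toQ A M).app b) h1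
    have h4 := congrArg (ψ.app b) h2
    rw [map_sum, map_smul] at h3 h4
    refine smul_right_injective _ (card_ker_ne_zero hC v b) ?_
    change (Nat.card (orbit A v b).ker : k) • _ = (Nat.card (orbit A v b).ker : k) • _
    refine h4.symm.trans (Eq.trans ?_ h3)
    refine Finset.sum_congr rfl fun f _ => ?_
    rw [map_smul, map_smul, naturality_apply, naturality_apply, ht]
  have := (simple_iff_isSimpleModule' M).1 hM
  have := (simple_iff_isSimpleModule' M').1 hM'
  let p1 : R →ₗ[MonoidAlgebra k (Aut A)] M' := (LinearMap.fst _ M' M).comp R.subtype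
  let p2 : R →ₗ[MonoidAlgebra k (Aut A)] M := (LinearMap.snd _ M' M).comp R.subtype
  have hinj : Function.Injective p1 := by
    rw [← LinearMap.ker_eq_bot, LinearMap.ker_eq_bot']
    intro p hp
    exact Subtype.ext (Prod.ext hp (hR p.1 p.2 hp))
  obtain ⟨p, hp, hp2⟩ := hex
  have hsurj : Function.Surjective p1 := by
    refine LinearMap.surjective_of_ne_zero (f := p1) fun h0 => hp2 (hR p hp ?_)
    exact LinearMap.congr_fun h0 ⟨p, hp⟩
  let E := LinearEquiv.ofBijective p1 ⟨hinj, hsurj⟩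
  have hne : p2.comp E.symm.toLinearMap ≠ 0 := by
    intro h0
    apply hp2
    have := LinearMap.congr_fun h0 (E ⟨p, hp⟩)
    simp only [LinearMap.comp_apply, LinearEquiv.coe_coe, LinearEquiv.symm_apply_apply] at this
    exact this
  exact ⟨(LinearEquiv.ofBijective _ (LinearMap.bijective_of_ne_zero hne)).toModuleIso⟩

end Classify

/-! ### Functors generated by linearizations of bounded length -/

section NatFam

variable {k : Type v} [Field k] {C : Type u} [Category.{v} C] [Preadditive C]

/-- A natural family of maps `A(a) → F(a)`, i.e. a morphism `k[A] ⟶ F`. -/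
structure NatFam (A : AddRep C) (F : C ⥤ ModuleCat.{v} k) where
  /-- the map at each object -/
  app : ∀ a : C, A.obj.obj a → F.obj a
  naturality : ∀ {a b : C} (f : a ⟶ b) (x : A.obj.obj a), F.map f (app a x) = app b (A.obj.map f x)

/-- `F` is generated by morphisms `k[A] ⟶ F` with `A` of length at most `n`. -/
def GenByLen (F : C ⥤ ModuleCat.{v} k) (n : ℕ) : Prop :=
  ∀ (a : C) (y : F.obj a), y ∈ Submodule.span k
    {z : F.obj a | ∃ A : AddRep C, LenLE A n ∧ ∃ (φ : NatFam A F) (w : A.obj.obj a), φ.app a w = z}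

theorem genByLen_lowerTensor {A : AddRep C} {n : ℕ} (hA : LenLE A n)
    (M : ModuleCat.{v} (MonoidAlgebra k (Aut A))) : GenByLen (lowerTensor A M) n := by
  intro a y
  induction y using lmk_induction with
  | h0 => exact Submodule.zero_mem _
  | hadd s t hs ht => exact Submodule.add_mem _ hs ht
  | h m x r =>
    have h1 : lmk A M a m (Finsupp.single x r) = r • lmk A M a m (Finsupp.single x 1) := by
      rw [← map_smul, Finsupp.smul_single, smul_eq_mul, mul_one]
    rw [h1]
    refine Submodule.smul_mem _ _ (Submodule.subset_span ⟨A, hA,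
      ⟨fun a x => lmk A M a m (Finsupp.single x 1), fun f x => ?_⟩, x, rfl⟩)
    rw [lmk_map, Finsupp.mapDomain_single]

end NatFam

/-! ### Parabolic differences -/

section Delta

variable {k : Type v} [Field k] {C : Type u} [Category.{v} C] [Preadditive C]
  [HasBinaryBiproducts C]

/-- The projection `F(x ⊕ a) → δ̄_x F(a)`. -/
def deltaProj (x : C) (F : C ⥤ ModuleCat.{v} k) (a : C) :
    F.obj (x ⊞ a) →ₗ[k] (barDelta x F).obj a :=
  ((cokernel.π (toBarTau x F)).app a).hom ∘ₗ (coinvKer x F a).mkQ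

theorem deltaProj_surjective (x : C) (F : C ⥤ ModuleCat.{v} k) (a : C) :
    Function.Surjective (deltaProj x F a) := by
  have h := (epi_iff_surjective (cokernel.π (toBarTau x F))).1 inferInstance a
  exact h.comp (Submodule.mkQ_surjective _)

theorem deltaProj_map (x : C) (F : C ⥤ ModuleCat.{v} k) {a b : C} (f : a ⟶ b)
    (y : F.obj (x ⊞ a)) : (barDelta x F).map f (deltaProj x F a y) =
      deltaProj x F b (F.map (biprod.map (𝟙 x) f) y) :=
  (naturality_apply (cokernel.π (toBarTau x F)) f ((coinvKer x F a).mkQ y)).symm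

theorem deltaProj_eq_zero_iff_mem {x : C} {F : C ⥤ ModuleCat.{v} k} {a : C} {y : F.obj (x ⊞ a)} :
    deltaProj x F a y = 0 ↔ ∃ z : F.obj a, y - F.map biprod.inr z ∈ coinvKer x F a := by
  have hex := (ShortComplex.exact_cokernel (toBarTau x F)).map
    ((evaluation C (ModuleCat.{v} k)).obj a)
  rw [ShortComplex.moduleCat_exact_iff] at hex
  constructor
  · intro h
    obtain ⟨z, hz⟩ := hex ((coinvKer x F a).mkQ y) h
    refine ⟨z, ?_⟩
    have hz' : (coinvKer x F a).mkQ (F.map biprod.inr z) = (coinvKer x F a).mkQ y := hz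
    exact (Submodule.Quotient.eq _).1 hz'.symm
  · rintro ⟨z, hz⟩
    have hz' : (coinvKer x F a).mkQ y = (toBarTau x F).app a z :=
      (Submodule.Quotient.eq (coinvKer x F a)).2 hz
    change (cokernel.π (toBarTau x F)).app a ((coinvKer x F a).mkQ y) = 0
    rw [hz']
    have := ConcreteCategory.congr_hom
      (congrArg (fun α => α.app a) (cokernel.condition (toBarTau x F))) z
    exact this

theorem deltaProj_transvection {x a : C} {F : C ⥤ ModuleCat.{v} k} (u : x ⟶ a)
    (y : F.obj (x ⊞ a)) : deltaProj x F a (F.map (transvection u) y) = deltaProj x F a y := by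
  rw [← sub_eq_zero, ← map_sub, deltaProj_eq_zero_iff_mem]
  refine ⟨0, ?_⟩
  rw [map_zero, sub_zero]
  exact Submodule.subset_span ⟨(u, y), rfl⟩

theorem deltaProj_inr {x a : C} {F : C ⥤ ModuleCat.{v} k} (z : F.obj a) :
    deltaProj x F a (F.map biprod.inr z) = 0 :=
  deltaProj_eq_zero_iff_mem.2 ⟨z, by rw [sub_self]; exact Submodule.zero_mem _⟩

theorem transvection_comp {x a : C} (u u' : x ⟶ a) :
    transvection u ≫ transvection u' = transvection (u + u') := by
  ext <;> simp [transvection, add_comm]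

theorem inr_transvection {x a : C} (u : x ⟶ a) :
    (biprod.inr : a ⟶ x ⊞ a) ≫ transvection u = biprod.inr := by
  ext <;> simp [transvection]

/-- The morphism `τ̄_x F ⟶ τ̄_x F'` induced by a morphism `F ⟶ F'`. -/
def barTauMap (x : C) {F F' : C ⥤ ModuleCat.{v} k} (α : F ⟶ F') : barTau x F ⟶ barTau x F' where
  app a := ModuleCat.ofHom (Submodule.mapQ (coinvKer x F a) (coinvKer x F' a)
    (α.app (x ⊞ a)).hom (by
      refine Submodule.span_le.2 ?_
      rintro _ ⟨⟨u, y⟩, rfl⟩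
      refine Submodule.subset_span ⟨(u, α.app _ y), ?_⟩
      change F'.map (transvection u) (α.app _ y) - α.app _ y =
        α.app _ (F.map (transvection u) y - y)
      rw [map_sub, naturality_apply]))
  naturality a b f := by
    ext y
    obtain ⟨y, rfl⟩ := (coinvKer x F a).mkQ_surjective y
    exact congrArg (coinvKer x F' b).mkQ (naturality_apply α (biprod.map (𝟙 x) f) y)

theorem toBarTau_naturality (x : C) {F F' : C ⥤ ModuleCat.{v} k} (α : F ⟶ F') :
    toBarTau x F ≫ barTauMap x α = α ≫ toBarTau x F' := by
  ext a y
  exact congrArg (coinvKer x F' a).mkQ (naturality_apply α biprod.inr y)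

/-- The morphism `δ̄_x F ⟶ δ̄_x F'` induced by a morphism `F ⟶ F'`. -/
def barDeltaMap (x : C) {F F' : C ⥤ ModuleCat.{v} k} (α : F ⟶ F') :
    barDelta x F ⟶ barDelta x F' :=
  cokernel.map (toBarTau x F) (toBarTau x F') α (barTauMap x α) (toBarTau_naturality x α)

theorem barDeltaMap_deltaProj (x : C) {F F' : C ⥤ ModuleCat.{v} k} (α : F ⟶ F') (a : C)
    (y : F.obj (x ⊞ a)) : (barDeltaMap x α).app a (deltaProj x F a y) =
      deltaProj x F' a (α.app (x ⊞ a) y) := by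
  have h : cokernel.π (toBarTau x F) ≫ barDeltaMap x α =
      barTauMap x α ≫ cokernel.π (toBarTau x F') := cokernel.π_desc _ _ _
  exact ConcreteCategory.congr_hom (congrArg (fun β => β.app a) h) ((coinvKer x F a).mkQ y)

section Average

variable [∀ a b : C, Fintype (a ⟶ b)]

/-- The average of the transvections. -/
def transAvg (x : C) (F : C ⥤ ModuleCat.{v} k) (a : C) : F.obj (x ⊞ a) →ₗ[k] F.obj (x ⊞ a) :=
  (Fintype.card (x ⟶ a) : k)⁻¹ • ∑ u : x ⟶ a, (F.map (transvection u)).hom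

theorem transAvg_apply (x : C) (F : C ⥤ ModuleCat.{v} k) (a : C) (y : F.obj (x ⊞ a)) :
    transAvg x F a y = (Fintype.card (x ⟶ a) : k)⁻¹ • ∑ u : x ⟶ a, F.map (transvection u) y := by
  simp [transAvg]

theorem transAvg_naturality (x : C) {F F' : C ⥤ ModuleCat.{v} k} (α : F ⟶ F') (a : C)
    (y : F.obj (x ⊞ a)) : α.app (x ⊞ a) (transAvg x F a y) = transAvg x F' a (α.app (x ⊞ a) y) := by
  rw [transAvg_apply, transAvg_apply, map_smul, map_sum]
  simp only [naturality_apply]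

/-- As the order of `C(x, a)` is invertible, averaging identifies coinvariants with invariants, and
it fixes the image of `F(a)`. Vanishing in the cokernel thus means that the average comes from
`F(a)`, that is, is fixed by an idempotent of `x ⊕ a`. Such an equation in `F(x ⊕ a)` is reflected
by monomorphisms, so `δ̄_x` preserves them. -/
theorem deltaProj_eq_zero_iff (hC : IsKTrivial k C) {x : C} {F : C ⥤ ModuleCat.{v} k} {a : C}
    {y : F.obj (x ⊞ a)} : deltaProj x F a y = 0 ↔
      F.map (biprod.snd ≫ biprod.inr) (transAvg x F a y) = transAvg x F a y := by
  have hcard : (Fintype.card (x ⟶ a) : k) ≠ 0 := by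
    rw [← Nat.card_eq_fintype_card]
    exact (hC x a).2
  have h1 : ∀ z : F.obj a, transAvg x F a (F.map biprod.inr z) = F.map biprod.inr z := by
    intro z
    rw [transAvg_apply]
    have : ∀ u : x ⟶ a, F.map (transvection u) (F.map biprod.inr z) = F.map biprod.inr z := by
      intro u
      rw [← ConcreteCategory.comp_apply, ← F.map_comp, inr_transvection]
    simp only [this, Finset.sum_const, Finset.card_univ]
    rw [← Nat.cast_smul_eq_nsmul k, smul_smul, inv_mul_cancel₀ hcard, one_smul]
  have h2 : ∀ z ∈ coinvKer x F a, transAvg x F a z = 0 := by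
    have : coinvKer x F a ≤ LinearMap.ker (transAvg x F a) := by
      refine Submodule.span_le.2 ?_
      rintro _ ⟨⟨u, z⟩, rfl⟩
      change transAvg x F a (F.map (transvection u) z - z) = 0
      rw [map_sub, sub_eq_zero, transAvg_apply, transAvg_apply]
      congr 1
      refine Fintype.sum_equiv (Equiv.addLeft u) _ _ fun u' => ?_
      rw [← ConcreteCategory.comp_apply, ← F.map_comp, transvection_comp]
      rfl
    exact fun z hz => this hz
  have h3 : y - transAvg x F a y ∈ coinvKer x F a := by
    have : y - transAvg x F a y = -((Fintype.card (x ⟶ a) : k)⁻¹ •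
        ∑ u : x ⟶ a, (F.map (transvection u) y - y)) := by
      rw [transAvg_apply, Finset.sum_sub_distrib, smul_sub, Finset.sum_const, Finset.card_univ,
        ← Nat.cast_smul_eq_nsmul k, smul_smul, inv_mul_cancel₀ hcard, one_smul, neg_sub]
    rw [this]
    exact Submodule.neg_mem _ (Submodule.smul_mem _ _ (Submodule.sum_mem _ fun u _ =>
      Submodule.subset_span ⟨(u, y), rfl⟩))
  rw [deltaProj_eq_zero_iff_mem]
  constructor
  · rintro ⟨z, hz⟩
    have h4 := h2 _ hz
    rw [map_sub, h1, sub_eq_zero] at h4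
    rw [h4, ← ConcreteCategory.comp_apply, ← F.map_comp, biprod.inr_snd_assoc]
  · intro h
    refine ⟨F.map biprod.snd (transAvg x F a y), ?_⟩
    rw [← ConcreteCategory.comp_apply, ← F.map_comp, h]
    exact h3

theorem barDeltaMap_mono (hC : IsKTrivial k C) (x : C) {F F' : C ⥤ ModuleCat.{v} k} (α : F ⟶ F')
    (hα : Mono α) : Mono (barDeltaMap x α) := by
  rw [mono_iff_injective]
  intro a
  refine (injective_iff_map_eq_zero ((barDeltaMap x α).app a).hom).2 fun z hz => ?_
  obtain ⟨y, rfl⟩ := deltaProj_surjective x F a z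
  have hz' : (barDeltaMap x α).app a (deltaProj x F a y) = 0 := hz
  rw [barDeltaMap_deltaProj, deltaProj_eq_zero_iff hC, ← transAvg_naturality,
    ← naturality_apply] at hz'
  exact (deltaProj_eq_zero_iff hC).2 ((mono_iff_injective α).1 hα _ hz')

end Average

theorem exists_mono_foldr (hC : IsKTrivial k C) {F F' : C ⥤ ModuleCat.{v} k} (α : F ⟶ F')
    (hα : Mono α) (l : List C) : ∃ β : l.foldr barDelta F ⟶ l.foldr barDelta F', Mono β := by
  have : ∀ a b : C, Fintype (a ⟶ b) := fun a b => by
    have := (hC a b).1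
    exact Fintype.ofFinite _
  induction l with
  | nil => exact ⟨α, hα⟩
  | cons x l ih =>
    obtain ⟨β, hβ⟩ := ih
    exact ⟨barDeltaMap x β, barDeltaMap_mono hC x β hβ⟩

theorem Fd_of_mono (hC : IsKTrivial k C) {d : ℕ} {F F' : C ⥤ ModuleCat.{v} k} (α : F ⟶ F')
    [Mono α] (h : Fd k C d F') : Fd k C d F := by
  intro l x hl
  have : Mono (Functor.whiskerLeft (biprodLeft x) α) := by
    rw [mono_iff_injective]
    exact fun a => (mono_iff_injective α).1 inferInstance _
  obtain ⟨β, hβ⟩ := exists_mono_foldr hC (F := tau x F) (F' := tau x F')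
    (Functor.whiskerLeft (biprodLeft x) α) this l
  exact IsZero.of_mono β (h l x hl)

/-! ### Natural families -/

theorem rep_biprod_total (A : AddRep C) {x a : C} (ω : A.obj.obj (x ⊞ a)) :
    A.obj.map biprod.inl (A.obj.map biprod.fst ω) + A.obj.map biprod.inr (A.obj.map biprod.snd ω) =
      ω := by
  rw [← rep_map_comp, ← rep_map_comp, ← rep_map_add, biprod.total, rep_map_id]

theorem rep_map_biprod (A : AddRep C) {x a b : C} (f : a ⟶ b) (v : A.obj.obj x)
    (w : A.obj.obj a) : A.obj.map (biprod.map (𝟙 x) f)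
      (A.obj.map biprod.inl v + A.obj.map biprod.inr w) =
      A.obj.map biprod.inl v + A.obj.map biprod.inr (A.obj.map f w) := by
  rw [map_add, ← rep_map_comp, ← rep_map_comp, ← rep_map_comp, biprod.inl_map, biprod.inr_map,
    Category.id_comp]

theorem rep_map_transvection (A : AddRep C) {x a : C} (u : x ⟶ a) (v : A.obj.obj x)
    (w : A.obj.obj a) : A.obj.map (transvection u)
      (A.obj.map biprod.inl v + A.obj.map biprod.inr w) =
      A.obj.map biprod.inl v + A.obj.map biprod.inr (A.obj.map u v + w) := by
  have h1 : (biprod.inl : x ⟶ x ⊞ a) ≫ transvection u = biprod.inl + u ≫ biprod.inr := by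
    ext <;> simp [transvection]
  rw [map_add, ← rep_map_comp, ← rep_map_comp, h1, inr_transvection, rep_map_add, rep_map_comp,
    map_add, add_assoc]

namespace NatFam

variable {A : AddRep C} {F : C ⥤ ModuleCat.{v} k}

/-- The family `w ↦ φ(v, w)` with values in the shift of `F`. -/
def shiftBy (φ : NatFam A F) {x : C} (v : A.obj.obj x) : NatFam A (tau x F) where
  app a w := φ.app (x ⊞ a) (A.obj.map biprod.inl v + A.obj.map biprod.inr w)
  naturality {a b} f w := by
    refine (φ.naturality (biprod.map (𝟙 x) f) _).trans ?_
    rw [rep_map_biprod]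

/-- If `w - w' = A(u)(v)`, the transvection of `u` carries `(v, w')` to `(v, w)`. -/
theorem deltaProj_app_eq (φ : NatFam A F) {x a : C} {v : A.obj.obj x} {w w' : A.obj.obj a}
    (h : (SubRep.span v).cls a w = (SubRep.span v).cls a w') :
    deltaProj x F a (φ.app (x ⊞ a) (A.obj.map biprod.inl v + A.obj.map biprod.inr w)) =
      deltaProj x F a (φ.app (x ⊞ a) (A.obj.map biprod.inl v + A.obj.map biprod.inr w')) := by
  obtain ⟨u, hu⟩ := SubRep.cls_eq_cls.1 h
  rw [orbit_apply] at hu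
  rw [← deltaProj_transvection u (φ.app (x ⊞ a) (A.obj.map biprod.inl v +
    A.obj.map biprod.inr w')), φ.naturality, rep_map_transvection, hu, sub_add_cancel]

/-- The family `w ↦ φ(v, w)` with values in the parabolic difference of `F`. -/
def delta (φ : NatFam A F) {x : C} (v : A.obj.obj x) :
    NatFam (SubRep.span v).quot (barDelta x F) where
  app a q := deltaProj x F a (φ.app (x ⊞ a) (A.obj.map biprod.inl v +
    A.obj.map biprod.inr (Function.surjInv ((SubRep.span v).cls_surjective a) q)))
  naturality {a b} f q := by
    rw [deltaProj_map, φ.naturality, rep_map_biprod]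
    refine φ.deltaProj_app_eq ?_
    rw [Function.surjInv_eq ((SubRep.span v).cls_surjective b), ← SubRep.quot_map,
      Function.surjInv_eq ((SubRep.span v).cls_surjective a)]

theorem delta_app_cls (φ : NatFam A F) {x a : C} (v : A.obj.obj x) (w : A.obj.obj a) :
    (φ.delta v).app a ((SubRep.span v).cls a w) =
      deltaProj x F a (φ.app (x ⊞ a) (A.obj.map biprod.inl v + A.obj.map biprod.inr w)) :=
  φ.deltaProj_app_eq (Function.surjInv_eq _ _)

end NatFam

theorem GenByLen.tau {F : C ⥤ ModuleCat.{v} k} {n : ℕ} (h : GenByLen F n) (x : C) :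
    GenByLen (tau x F) n := by
  intro a y
  refine Submodule.span_mono ?_ (h (x ⊞ a) y)
  rintro _ ⟨A, hA, φ, ω, rfl⟩
  refine ⟨A, hA, φ.shiftBy (A.obj.map biprod.fst ω), A.obj.map biprod.snd ω, ?_⟩
  exact congrArg (φ.app (x ⊞ a)) (rep_biprod_total A ω)

/-- A generator indexed by `(v, w) ∈ A(x) ⊕ A(a)` comes from `F(a)` when `v = 0`, and so dies in the
cokernel; for `v ≠ 0` it is a value of `φ.delta v`, a family on `A/⟨v⟩`. -/
theorem GenByLen.barDelta_mem {F : C ⥤ ModuleCat.{v} k} {n : ℕ} (h : GenByLen F n) (x a : C)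
    (p : Submodule k ((barDelta x F).obj a))
    (hp : ∀ A : AddRep C, LenLE A n → ∀ (φ : NatFam A F) (v : A.obj.obj x), v ≠ 0 →
      ∀ w : A.obj.obj a, (φ.delta v).app a ((SubRep.span v).cls a w) ∈ p)
    (y : (barDelta x F).obj a) : y ∈ p := by
  obtain ⟨y, rfl⟩ := deltaProj_surjective x F a y
  refine (Submodule.span_le (p := p.comap (deltaProj x F a))).2 ?_ (h (x ⊞ a) y)
  rintro _ ⟨A, hA, φ, ω, rfl⟩
  change deltaProj x F a (φ.app (x ⊞ a) ω) ∈ p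
  have hω := rep_biprod_total A ω
  by_cases hv : A.obj.map biprod.fst ω = 0
  · rw [hv, map_zero, zero_add] at hω
    rw [← hω, ← φ.naturality, deltaProj_inr]
    exact Submodule.zero_mem _
  · have := hp A hA φ _ hv (A.obj.map biprod.snd ω)
    rwa [NatFam.delta_app_cls, hω] at this

theorem GenByLen.barDelta {F : C ⥤ ModuleCat.{v} k} {n : ℕ} (h : GenByLen F (n + 1)) (x : C) :
    GenByLen (AntiPoly.barDelta x F) n := by
  intro a y
  refine h.barDelta_mem x a _ (fun A hA φ v hv w => Submodule.subset_span ?_) y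
  exact ⟨_, hA.quot_span hv, φ.delta v, (SubRep.span v).cls a w, rfl⟩

theorem GenByLen.isZero_barDelta {F : C ⥤ ModuleCat.{v} k} (h : GenByLen F 0) (x : C) :
    IsZero (AntiPoly.barDelta x F) :=
  isZero_of_forall fun a y => (Submodule.mem_bot k).1
    (h.barDelta_mem x a ⊥ (fun _ hA _ v hv => absurd (hA.eq_zero v) hv) y)

theorem GenByLen.foldr {F : C ⥤ ModuleCat.{v} k} {n : ℕ} (h : GenByLen F n) (l : List C) {m : ℕ}
    (hl : l.length + m = n) : GenByLen (l.foldr AntiPoly.barDelta F) m := by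
  induction l generalizing m with
  | nil =>
    obtain rfl : m = n := by simpa using hl
    exact h
  | cons x l ih =>
    refine GenByLen.barDelta (ih ?_) x
    rw [List.length_cons] at hl
    omega

theorem GenByLen.Fd {F : C ⥤ ModuleCat.{v} k} {d : ℕ} (h : GenByLen F d) : Fd k C d F := by
  intro l x hl
  match l with
  | [] => simp at hl
  | y :: l =>
    -- The `d` entries of the tail are applied first and bring the length bound down to `0`; the
    -- head then gives zero.
    exact GenByLen.isZero_barDelta ((h.tau x).foldr l (m := 0) (by simpa using hl)) y

theorem Fd_Q (hC : IsKTrivial k C) {A : AddRep C} {d : ℕ} (hA : LenLE A d)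
    (M : ModuleCat.{v} (MonoidAlgebra k (Aut A))) : Fd k C d (Q A M) :=
  Fd_of_mono hC (fromQ A M) (genByLen_lowerTensor hA M).Fd

/-! ### Linearly independent natural families -/

/-- If a combination dies in `δ̄_x F`, then by `deltaProj_eq_zero_iff` and the independence of `φ`,
the average `E` of a lift is fixed by the projection of `x ⊕ a` onto `a`, so it involves only
elements with first coordinate `0`. But the lift and its transvections have first coordinate `v ≠
0`. -/
theorem NatFam.delta_linearIndependent (hC : IsKTrivial k C) {A : AddRep C}
    {F : C ⥤ ModuleCat.{v} k} (φ : NatFam A F) (hφ : ∀ a, LinearIndependent k (φ.app a)) {x : C}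
    {v : A.obj.obj x} (hv : v ≠ 0) (a : C) : LinearIndependent k ((φ.delta v).app a) := by
  classical
  have : ∀ a b : C, Fintype (a ⟶ b) := fun a b => by
    have := (hC a b).1
    exact Fintype.ofFinite _
  have hcard : (Fintype.card (x ⟶ a) : k) ≠ 0 := by
    rw [← Nat.card_eq_fintype_card]
    exact (hC x a).2
  rw [linearIndependent_iff]
  intro ζ hζ
  let j : (SubRep.span v).quot.obj.obj a → A.obj.obj (x ⊞ a) := fun q =>
    A.obj.map biprod.inl v +
      A.obj.map biprod.inr (Function.surjInv ((SubRep.span v).cls_surjective a) q)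
  let Φ := Finsupp.linearCombination k (φ.app (x ⊞ a))
  have hmap : ∀ (f : x ⊞ a ⟶ x ⊞ a) (ξ : A.obj.obj (x ⊞ a) →₀ k),
      F.map f (Φ ξ) = Φ (ξ.mapDomain (A.obj.map f)) := by
    intro f ξ
    simp only [Φ]
    rw [Finsupp.linearCombination_mapDomain, Finsupp.linearCombination_apply,
      Finsupp.linearCombination_apply, map_finsuppSum]
    refine Finsupp.sum_congr fun w _ => ?_
    rw [map_smul, φ.naturality]
    rfl
  have h1 : deltaProj x F a (Φ (ζ.mapDomain j)) = 0 := by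
    rw [← hζ]
    simp only [Φ]
    rw [Finsupp.linearCombination_mapDomain, Finsupp.linearCombination_apply,
      Finsupp.linearCombination_apply, map_finsuppSum]
    refine Finsupp.sum_congr fun w _ => ?_
    rw [map_smul]
    rfl
  let E : A.obj.obj (x ⊞ a) →₀ k := (Fintype.card (x ⟶ a) : k)⁻¹ •
    ∑ u : x ⟶ a, (ζ.mapDomain j).mapDomain (A.obj.map (transvection u))
  have hE : transAvg x F a (Φ (ζ.mapDomain j)) = Φ E := by
    rw [transAvg_apply, map_smul, map_sum]
    simp only [hmap]
  rw [deltaProj_eq_zero_iff hC, hE, hmap] at h1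
  have h2 : E.mapDomain (A.obj.map (biprod.snd ≫ biprod.inr)) = E := hφ (x ⊞ a) h1
  -- On terms with first coordinate `v`, a transvection only changes the second coordinate modulo
  -- `⟨v⟩`, so `θ` undoes the averaging and recovers `ζ` from `E`.
  let θ : A.obj.obj (x ⊞ a) → A.obj.obj x × (SubRep.span v).quot.obj.obj a := fun ω =>
    (A.obj.map biprod.fst ω, (SubRep.span v).cls a (A.obj.map biprod.snd ω))
  have hθ : ∀ (u : x ⟶ a) (q), θ (A.obj.map (transvection u) (j q)) = (v, q) := by
    intro u q
    simp only [θ, j]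
    rw [rep_map_transvection]
    simp only [map_add, ← rep_map_comp, biprod.inl_fst, biprod.inr_fst, biprod.inl_snd,
      biprod.inr_snd, rep_map_id, rep_map_zero, add_zero, zero_add, comp_zero, Category.comp_id,
      Category.assoc]
    rw [Function.surjInv_eq ((SubRep.span v).cls_surjective a),
      SubRep.cls_eq_zero.2 (SubRep.mem_span.2 ⟨u, rfl⟩), zero_add]
  have h3 : E.mapDomain θ = ζ.mapDomain (fun q => (v, q)) := by
    have e1 : ∀ u : x ⟶ a, ((ζ.mapDomain j).mapDomain (A.obj.map (transvection u))).mapDomain θ =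
        ζ.mapDomain (fun q => (v, q)) := by
      intro u
      rw [← Finsupp.mapDomain_comp, ← Finsupp.mapDomain_comp]
      congr 1
      funext q
      exact hθ u q
    have e2 : E.mapDomain θ = Finsupp.lmapDomain k k θ E := rfl
    rw [e2, map_smul, map_sum]
    simp only [Finsupp.lmapDomain_apply, e1, Finset.sum_const, Finset.card_univ]
    rw [← Nat.cast_smul_eq_nsmul k, smul_smul, inv_mul_cancel₀ hcard, one_smul]
  ext q
  have h4 : (E.mapDomain θ) (v, q) = ζ q := by
    rw [h3]
    exact Finsupp.mapDomain_apply (f := fun q => (v, q)) (Prod.mk_right_injective v) ζ q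
  rw [← h4, ← h2, ← Finsupp.mapDomain_comp, Finsupp.mapDomain_of_notMem_range]
  · rfl
  · rintro ⟨ω, hω⟩
    apply hv
    have := congrArg Prod.fst hω
    simp only [θ, Function.comp_apply, ← rep_map_comp, Category.assoc, biprod.inr_fst, comp_zero,
      rep_map_zero] at this
    exact this.symm

/-- Each step of a chain pays for one nonvanishing difference: choosing `v` in the first step of the
chain, the independent family on `A` yields one on `A/⟨v⟩`, which still has a chain with one step
fewer. -/
theorem exists_foldr_not_isZero [HasZeroObject C] (hC : IsKTrivial k C) (n : ℕ) :
    ∀ (A : AddRep C) (F : C ⥤ ModuleCat.{v} k) (φ : NatFam A F),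
      (∀ a, LinearIndependent k (φ.app a)) → (∃ s : LTSeries (SubRep A), s.length = n) →
      ∃ l : List C, l.length = n ∧ ¬ IsZero (l.foldr barDelta F) := by
  induction n with
  | zero =>
    intro A F φ hφ _
    refine ⟨[], rfl, fun h => ?_⟩
    -- Some object is needed; `A(z)` contains `0`, and an independent family takes a nonzero value
    -- there.
    let z : C := (HasZeroObject.zero' C).zero
    refine (hφ z).ne_zero (0 : A.obj.obj z) ?_
    have := ModuleCat.subsingleton_of_isZero ((Functor.isZero_iff F).1 h z)
    exact Subsingleton.elim _ _
  | succ n ih =>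
    rintro A F φ hφ ⟨s, hs⟩
    obtain ⟨x, v, hv, t, ht⟩ := exists_quot_series s hs
    obtain ⟨l, hl, hl'⟩ := ih _ _ (φ.delta v) (φ.delta_linearIndependent hC hφ hv) ⟨t, ht⟩
    -- `foldr` applies its last entry first, so `x` goes at the end.
    refine ⟨l ++ [x], by simp [hl], ?_⟩
    rwa [List.foldr_append]

/-- The embedding of `k[A]` sends `u` to `m ⊗ ∑ η(y) [(w, y, u)]` over `(x ⊕ c) ⊕ a`. The element
`η` puts this in `Q^A`, and the generator `w` makes coefficients readable: the one at `(w, y₀, u₀)`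
of a combination `ζ` is `ζ(u₀) η(y₀) m`. -/
theorem exists_natFam_tau_Q (hC : IsKTrivial k C) {A : AddRep C} (hA : IsGenCogen A)
    {M : ModuleCat.{v} (MonoidAlgebra k (Aut A))} (hM : Simple M) :
    ∃ (z : C) (φ : NatFam A (tau z (Q A M))), ∀ a, LinearIndependent k (φ.app a) := by
  classical
  have hfin := hA.finite hC
  obtain ⟨⟨x, w, hw⟩, b, hb⟩ := hA
  have := (simple_iff_isSimpleModule' M).1 hM
  have := IsSimpleModule.nontrivial (MonoidAlgebra k (Aut A)) M
  obtain ⟨m, hm⟩ := exists_ne (0 : M)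
  let m' : repOf M := m
  have hm' : m' ≠ 0 := hm
  obtain ⟨c, η, hη, hne⟩ := hb.exists_upperKer_ne_zero k
  obtain ⟨y₀, hy₀⟩ := Finsupp.ne_iff.1 hne
  let p : ∀ a : C, A.obj.obj a → A.obj.obj ((x ⊞ c) ⊞ a) := fun a u =>
    A.obj.map biprod.inl (A.obj.map biprod.inl w) + A.obj.map biprod.inr u
  let j : ∀ a : C, A.obj.obj a → A.obj.obj c → A.obj.obj ((x ⊞ c) ⊞ a) := fun a u y =>
    A.obj.map (biprod.inr ≫ biprod.inl) y + p a u
  have hj : ∀ (a : C) (u : A.obj.obj a) (y : A.obj.obj c), j a u y =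
      A.obj.map biprod.inl (A.obj.map biprod.inl w + A.obj.map biprod.inr y) +
        A.obj.map biprod.inr u := by
    intro a u y
    simp only [j, p]
    rw [map_add, rep_map_comp]
    abel
  have hfst : ∀ (a : C) (u : A.obj.obj a) (y : A.obj.obj c),
      A.obj.map (biprod.fst ≫ biprod.fst) (j a u y) = w := by
    intro a u y
    rw [hj]
    simp only [map_add, ← rep_map_comp, Category.assoc, biprod.inl_fst_assoc,
      biprod.inr_fst_assoc, biprod.inl_fst, biprod.inr_fst, rep_map_id, rep_map_zero, zero_comp,
      add_zero]
  have hjinj : ∀ (a : C) {u u' : A.obj.obj a} {y y' : A.obj.obj c}, j a u y = j a u' y' →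
      u = u' ∧ y = y' := by
    intro a u u' y y' h
    rw [hj, hj] at h
    obtain ⟨h1, h2⟩ := inl_add_inr_injective h
    exact ⟨h2, (inl_add_inr_injective h1).2⟩
  let φ : NatFam A (tau (x ⊞ c) (Q A M)) :=
    { app := fun a u => (toQ A M).app _ (umk A M ((x ⊞ c) ⊞ a) m'
        ⟨η.mapDomain (j a u), upperKer_translate _ _ hη⟩)
      naturality := fun {a b} f u => by
        refine (naturality_apply (toQ A M) (biprod.map (𝟙 _) f) _).symm.trans ?_
        rw [umk_map]
        congr 2
        refine Subtype.ext ?_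
        change (η.mapDomain (j a u)).mapDomain (A.obj.map (biprod.map (𝟙 (x ⊞ c)) f)) =
          η.mapDomain (j b (A.obj.map f u))
        rw [← Finsupp.mapDomain_comp]
        congr 1
        funext y
        rw [Function.comp_apply, hj, hj, rep_map_biprod] }
  refine ⟨x ⊞ c, φ, fun a => ?_⟩
  rw [linearIndependent_iff]
  intro ζ hζ
  ext u₀
  let Z : A.obj.obj ((x ⊞ c) ⊞ a) →₀ k := ∑ u ∈ ζ.support, ζ u • η.mapDomain (j a u)
  have h1 : (fromQ A M).app ((x ⊞ c) ⊞ a) (Finsupp.linearCombination k (φ.app a) ζ) =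
      lmk A M ((x ⊞ c) ⊞ a) m' Z := by
    rw [Finsupp.linearCombination_apply, Finsupp.sum]
    refine (map_sum ((fromQ A M).app ((x ⊞ c) ⊞ a)).hom _ _).trans ?_
    rw [map_sum]
    refine Finset.sum_congr rfl fun u _ => ?_
    refine (map_smul ((fromQ A M).app ((x ⊞ c) ⊞ a)).hom _ _).trans ?_
    rw [map_smul]
    congr 1
    exact fromQ_toQ_apply _
  have h2 : lmk A M ((x ⊞ c) ⊞ a) m' Z = 0 := by
    rw [← h1, hζ]
    exact map_zero _
  have h3 := coeff_lmk_of_forall (M := M) (biprod.fst ≫ biprod.fst) hw (hfst a u₀ y₀) m' (ζ := Z)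
    (by
      intro s hs
      obtain ⟨u, hu, hs'⟩ := Finset.mem_biUnion.1 (Finsupp.support_finsetSum hs)
      obtain ⟨y, -, rfl⟩ := Finset.mem_image.1
        (Finsupp.mapDomain_support (Finsupp.support_smul hs'))
      exact hfst a u y)
  rw [h2, map_zero] at h3
  have h4 : Z (j a u₀ y₀) = ζ u₀ * η y₀ := by
    simp only [Z]
    rw [Finsupp.finsetSum_apply, Finset.sum_eq_single u₀]
    · rw [Finsupp.smul_apply, smul_eq_mul, Finsupp.mapDomain_apply fun y y' h => (hjinj a h).2]
    · intro u _ hu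
      rw [Finsupp.smul_apply, Finsupp.mapDomain_of_notMem_range, smul_zero]
      rintro ⟨y, hy⟩
      exact hu (hjinj a hy).1
    · intro hu
      rw [Finsupp.notMem_support_iff.1 hu, zero_smul, Finsupp.zero_apply]
  rw [h4] at h3
  have h5 := (smul_eq_zero.1 h3.symm).resolve_right hm'
  exact (mul_eq_zero.1 h5).resolve_right hy₀

theorem lenLE_of_Fd [HasZeroObject C] (hC : IsKTrivial k C) {A : AddRep C} (hA : IsGenCogen A)
    {M : ModuleCat.{v} (MonoidAlgebra k (Aut A))} (hM : Simple M) {d : ℕ}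
    (h : Fd k C d (Q A M)) : LenLE A d := by
  obtain ⟨z, φ, hφ⟩ := exists_natFam_tau_Q hC hA hM
  intro s
  by_contra! hs
  -- A chain longer than `d` is truncated to exactly `d + 1` steps, the number of differences in the
  -- definition of `F_d`.
  obtain ⟨l, hl, hl'⟩ := exists_foldr_not_isZero hC (d + 1) A _ φ hφ
    ⟨s.take ⟨d + 1, by omega⟩, rfl⟩
  exact hl' (h l z hl)

end Delta

section Simple

variable {k : Type v} [Field k] {C : Type u} [Category.{v} C]

/-! ### Simple functors -/

/-- The functor given by subspaces stable under the maps. -/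
def subFunctor {S : C ⥤ ModuleCat.{v} k} (T : ∀ a, Submodule k (S.obj a))
    (hT : ∀ {a b : C} (f : a ⟶ b), ∀ y ∈ T a, S.map f y ∈ T b) : C ⥤ ModuleCat.{v} k where
  obj a := ModuleCat.of k (T a)
  map f := ModuleCat.ofHom ((S.map f).hom.restrict fun y hy => hT f y hy)
  map_id a := by
    ext y
    change S.map (𝟙 a) y.1 = y.1
    rw [S.map_id]
    rfl
  map_comp f g := by
    ext y
    change S.map (f ≫ g) y.1 = S.map g (S.map f y.1)
    rw [S.map_comp]
    rfl

theorem eq_zero_of_simple {S : C ⥤ ModuleCat.{v} k} (hS : Simple S)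
    (T : ∀ a, Submodule k (S.obj a))
    (hT : ∀ {a b : C} (f : a ⟶ b), ∀ y ∈ T a, S.map f y ∈ T b)
    (hne : ∃ (a : C) (y : S.obj a), y ∉ T a) {a : C} {y : S.obj a} (hy : y ∈ T a) : y = 0 := by
  let i : subFunctor T hT ⟶ S :=
    { app := fun a => ModuleCat.ofHom (T a).subtype
      naturality := fun _ _ _ => rfl }
  have : Mono i := by
    rw [mono_iff_injective]
    exact fun a => Subtype.val_injective
  by_cases hi : i = 0
  · exact ConcreteCategory.congr_hom (congrArg (fun α => α.app a) hi) ⟨y, hy⟩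
  · exfalso
    have := isIso_of_mono_of_nonzero hi
    obtain ⟨b, z, hz⟩ := hne
    obtain ⟨z, rfl⟩ := (epi_iff_surjective i).1 inferInstance b z
    exact hz z.2

/-- The elements killed by all morphisms to `x` form a subfunctor that misses `ξ`, hence is zero. -/
theorem exists_map_ne_zero {S : C ⥤ ModuleCat.{v} k} (hS : Simple S) {x : C} {ξ : S.obj x}
    (hξ : ξ ≠ 0) {c : C} {s : S.obj c} (hs : s ≠ 0) : ∃ f : c ⟶ x, S.map f s ≠ 0 := by
  by_contra! h
  refine hs (eq_zero_of_simple hS (fun a => ⨅ f : a ⟶ x, LinearMap.ker (S.map f).hom) ?_ ?_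
    (y := s) ?_)
  · intro a b f y hy
    rw [Submodule.mem_iInf] at hy ⊢
    intro g
    have := hy (f ≫ g)
    rw [LinearMap.mem_ker] at this ⊢
    rw [S.map_comp] at this
    exact this
  · refine ⟨x, ξ, fun hx => hξ ?_⟩
    have := (Submodule.mem_iInf _).1 hx (𝟙 x)
    rw [LinearMap.mem_ker, S.map_id] at this
    exact this
  · rw [Submodule.mem_iInf]
    exact h

end Simple

/-! ### Families on subfunctors of `k[A]` -/

section SubFam

variable {k : Type v} [Field k] {C : Type u} [Category.{v} C] [Preadditive C]

/-- A natural family of linear maps on subspaces of the `k[A(a)]`. -/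
structure SubFam {A : AddRep C} (X : ∀ a, Submodule k (A.obj.obj a →₀ k))
    (S : C ⥤ ModuleCat.{v} k) where
  /-- the map at each object -/
  app : ∀ a, X a →ₗ[k] S.obj a
  naturality : ∀ {a b : C} (f : a ⟶ b) (ζ : X a) (h : ζ.1.mapDomain (A.obj.map f) ∈ X b),
    S.map f (app a ζ) = app b ⟨_, h⟩

/-- `φ` does not vanish. -/
def SubFam.Nonzero {A : AddRep C} {X : ∀ a, Submodule k (A.obj.obj a →₀ k)}
    {S : C ⥤ ModuleCat.{v} k} (φ : SubFam X S) : Prop :=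
  ∃ (a : C) (ζ : X a), φ.app a ζ ≠ 0

/-- The subspace of `k[A(a)]` of the elements whose image in `k[A/(B + ⟨n⟩)]` vanishes for all
`n ∈ N`. -/
def condKer (k : Type v) [Field k] {A : AddRep C} (B : SubRep A) {x : C} (N : Set (A.obj.obj x))
    (a : C) : Submodule k (A.obj.obj a →₀ k) :=
  ⨅ n ∈ N, cosetKer k ((B ⊔ SubRep.span n).obj a)

theorem mem_condKer {A : AddRep C} {B : SubRep A} {x : C} {N : Set (A.obj.obj x)} {a : C}
    {ζ : A.obj.obj a →₀ k} :
    ζ ∈ condKer k B N a ↔ ∀ n ∈ N, ζ ∈ cosetKer k ((B ⊔ SubRep.span n).obj a) := by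
  simp only [condKer, Submodule.mem_iInf]

theorem rep_cosetKer_map {A : AddRep C} (B : SubRep A) {a b : C} (f : a ⟶ b)
    {ζ : A.obj.obj a →₀ k} (hζ : ζ ∈ cosetKer k (B.obj a)) :
    ζ.mapDomain (A.obj.map f) ∈ cosetKer k (B.obj b) :=
  cosetKer_map _ (fun y z h => by
    rw [← map_neg, ← map_add]
    exact B.map_mem f _ h) hζ

theorem condKer_map {A : AddRep C} {B : SubRep A} {x : C} {N : Set (A.obj.obj x)} {a b : C}
    (f : a ⟶ b) {ζ : A.obj.obj a →₀ k} (hζ : ζ ∈ condKer k B N a) :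
    ζ.mapDomain (A.obj.map f) ∈ condKer k B N b :=
  mem_condKer.2 fun n hn => rep_cosetKer_map _ f (mem_condKer.1 hζ n hn)

theorem condKer_mono {A : AddRep C} {B B' : SubRep A} (h : B ≤ B') {x : C}
    {N N' : Set (A.obj.obj x)} (hN : N' ⊆ N) (a : C) : condKer k B N a ≤ condKer k B' N' a :=
  fun _ hζ => mem_condKer.2 fun n hn =>
    cosetKer_mono ((sup_le_sup_right h (SubRep.span n)) a) (mem_condKer.1 hζ n (hN hn))

/-- There is a nonzero family on `condKer k B N` which factors through `k[A/B]`. -/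
def Supports {A : AddRep C} (S : C ⥤ ModuleCat.{v} k) (B : SubRep A) {x : C}
    (N : Set (A.obj.obj x)) : Prop :=
  ∃ φ : SubFam (condKer k B N) S, φ.Nonzero ∧
    ∀ (a : C) (ζ : condKer k B N a), ζ.1 ∈ cosetKer k (B.obj a) → φ.app a ζ = 0

/-- If `n ∈ B(x)`, the condition attached to `n` already makes every element vanish in `k[A/B]`,
where the family factors. -/
theorem Supports.notMem {A : AddRep C} {S : C ⥤ ModuleCat.{v} k} {B : SubRep A} {x : C}
    {N : Set (A.obj.obj x)} (h : Supports S B N) {n : A.obj.obj x} (hn : n ∈ N) :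
    n ∉ B.obj x := by
  intro hB
  obtain ⟨φ, ⟨a, ζ, hζ⟩, hφ⟩ := h
  apply hζ
  refine hφ a ζ ?_
  have := mem_condKer.1 ζ.2 n hn
  rwa [sup_eq_left.2 (SubRep.span_le.2 hB)] at this

/-- Precompose `φ` with the average over `B'(a)`. By `avg_mem_cosetKer` it maps `condKer k B' N`
into the domain of `φ`; it kills `cosetKer k (B'.obj a)`, and it changes an element only by
something `φ` ignores. -/
theorem Supports.enlarge {A : AddRep C} [∀ a, Finite (A.obj.obj a)]
    (hcard : ∀ a, (Nat.card (A.obj.obj a) : k) ≠ 0) {S : C ⥤ ModuleCat.{v} k} {B B' : SubRep A}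
    (hB : B ≤ B') {x : C} {N : Set (A.obj.obj x)} {φ : SubFam (condKer k B N) S} (hφ : φ.Nonzero)
    (hφ' : ∀ (a : C) (ζ : condKer k B N a), ζ.1 ∈ cosetKer k (B'.obj a) → φ.app a ζ = 0) :
    Supports S B' N := by
  have : ∀ (a : C) (H : AddSubgroup (A.obj.obj a)), Fintype H := fun a H => Fintype.ofFinite _
  have hk : ∀ (a : C) (H : AddSubgroup (A.obj.obj a)), (Fintype.card H : k) ≠ 0 := by
    intro a H
    rw [← Nat.card_eq_fintype_card]
    exact card_ne_zero_of_subgroup k H (hcard a)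
  have hmem : ∀ {a : C} {ζ : A.obj.obj a →₀ k}, ζ ∈ condKer k B' N a →
      avg k (B'.obj a) ζ ∈ condKer k B N a := by
    intro a ζ hζ
    refine mem_condKer.2 fun n hn => avg_mem_cosetKer (hk _ _) ?_
    have h1 : (B ⊔ SubRep.span n) ⊔ B' = B' ⊔ SubRep.span n := by
      rw [sup_comm, ← sup_assoc, sup_eq_left.2 hB]
    rw [← SubRep.sup_obj, h1]
    exact mem_condKer.1 hζ n hn
  have heq : ∀ {a : C} (ζ ζ' : condKer k B N a), ζ.1 - ζ'.1 ∈ cosetKer k (B'.obj a) →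
      φ.app a ζ = φ.app a ζ' := by
    intro a ζ ζ' h
    rw [← sub_eq_zero, ← map_sub]
    exact hφ' a _ h
  refine ⟨⟨fun a => (φ.app a).comp ((avg k (B'.obj a)).restrict fun ζ hζ => hmem hζ), ?_⟩, ?_, ?_⟩
  -- The averages over `B'(a)` and `B'(b)` are compatible with `A(f)` only modulo `cosetKer k
  -- (B'.obj b)`, which suffices because `φ` vanishes on it.
  · intro a b f ζ h
    change S.map f (φ.app a ⟨avg k (B'.obj a) ζ.1, hmem ζ.2⟩) = φ.app b ⟨avg k (B'.obj b) _, hmem h⟩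
    rw [φ.naturality f _ (condKer_map f (hmem ζ.2))]
    refine heq _ _ ?_
    have h1 := rep_cosetKer_map B' f (avg_sub_mem (hk _ _) ζ.1 (N := B'.obj a))
    have h2 := avg_sub_mem (hk _ _) (ζ.1.mapDomain (A.obj.map f)) (N := B'.obj b)
    have h3 := Submodule.sub_mem _ h1 h2
    rwa [← Finsupp.lmapDomain_apply k k, map_sub, Finsupp.lmapDomain_apply,
      Finsupp.lmapDomain_apply, sub_sub_sub_cancel_right] at h3
  · obtain ⟨a, ζ, hζ⟩ := hφ
    refine ⟨a, ⟨ζ.1, condKer_mono hB subset_rfl a ζ.2⟩, fun h0 => hζ (Eq.trans ?_ h0)⟩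
    refine heq ζ ⟨avg k (B'.obj a) ζ.1, hmem (condKer_mono hB subset_rfl a ζ.2)⟩ ?_
    rw [← neg_sub]
    exact Submodule.neg_mem _ (avg_sub_mem (hk _ _) ζ.1)
  · intro a ζ hζ
    have h0 : (⟨avg k (B'.obj a) ζ.1, hmem ζ.2⟩ : condKer k B N a) = 0 :=
      Subtype.ext (avg_eq_zero hζ)
    exact (congrArg (φ.app a) h0).trans (map_zero _)

/-- The elements of `A(c)` sent to `B(x)` by every morphism to `x`. -/
def saturate {A : AddRep C} (B : SubRep A) (x : C) : SubRep A where
  obj c :=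
    { carrier := {y | ∀ f : c ⟶ x, A.obj.map f y ∈ B.obj x}
      zero_mem' := fun f => by
        rw [map_zero]
        exact zero_mem _
      add_mem' := fun {y z} hy hz f => by
        rw [map_add]
        exact add_mem (hy f) (hz f)
      neg_mem' := fun {y} hy f => by
        rw [map_neg]
        exact neg_mem (hy f) }
  map_mem {a b} f y hy g := by
    rw [← rep_map_comp]
    exact hy (f ≫ g)

theorem le_saturate {A : AddRep C} (B : SubRep A) (x : C) : B ≤ saturate B x :=
  fun _ y hy f => B.map_mem f y hy

theorem saturate_obj {A : AddRep C} (B : SubRep A) (x : C) : (saturate B x).obj x = B.obj x := by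
  refine le_antisymm (fun y hy => ?_) (le_saturate B x x)
  have := hy (𝟙 x)
  rwa [rep_map_id] at this

theorem saturate_saturate {A : AddRep C} (B : SubRep A) (x : C) :
    saturate (saturate B x) x = saturate B x := by
  refine le_antisymm (fun c y hy f => ?_) (le_saturate _ _)
  have := hy f
  rwa [saturate_obj] at this

/-- The additive functor represented by `x`. -/
def corep (x : C) : AddRep C :=
  ⟨preadditiveCoyoneda.obj (Opposite.op x), inferInstanceAs (Functor.Additive _)⟩

theorem corep_isGen (x : C) : IsGen (corep x) (show (corep x).obj.obj x from 𝟙 x) :=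
  fun _ f => ⟨f, Category.id_comp f⟩

/-- This is the Yoneda map of `ξ`; without conditions, `condKer` is the whole linearization. -/
theorem supports_bot {S : C ⥤ ModuleCat.{v} k} {x : C} {ξ : S.obj x} (hξ : ξ ≠ 0) :
    Supports S (⊥ : SubRep (corep x)) (x := x) ∅ := by
  let ψ : ∀ a, ((corep x).obj.obj a →₀ k) →ₗ[k] S.obj a := fun a =>
    Finsupp.linearCombination k (fun g : (corep x).obj.obj a => S.map (show x ⟶ a from g) ξ)
  have hψ : ∀ {a b : C} (f : a ⟶ b) (ζ : (corep x).obj.obj a →₀ k),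
      S.map f (ψ a ζ) = ψ b (ζ.mapDomain ((corep x).obj.map f)) := by
    intro a b f ζ
    simp only [ψ]
    rw [Finsupp.linearCombination_mapDomain, Finsupp.linearCombination_apply,
      Finsupp.linearCombination_apply, map_finsuppSum]
    refine Finsupp.sum_congr fun g _ => ?_
    rw [map_smul]
    congr 1
    change S.map f (S.map (show x ⟶ a from g) ξ) = S.map ((show x ⟶ a from g) ≫ f) ξ
    rw [S.map_comp]
    rfl
  refine ⟨⟨fun a => (ψ a).comp (Submodule.subtype _), fun f ζ h => hψ f ζ.1⟩, ?_, ?_⟩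
  · refine ⟨x, ⟨Finsupp.single (show (corep x).obj.obj x from 𝟙 x) 1,
      mem_condKer.2 fun n hn => absurd hn (Set.notMem_empty n)⟩, fun h0 => hξ ?_⟩
    change ψ x (Finsupp.single _ 1) = 0 at h0
    rw [Finsupp.linearCombination_single, one_smul] at h0
    change S.map (𝟙 x) ξ = 0 at h0
    rw [S.map_id] at h0
    exact h0
  · intro a ζ hζ
    have h0 : ζ.1 = 0 := by
      have : ζ.1 ∈ cosetKer k (⊥ : AddSubgroup ((corep x).obj.obj a)) := hζ
      rwa [cosetKer_bot, Submodule.mem_bot] at this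
    exact (congrArg (ψ a) h0).trans (map_zero _)

/-- Maximality of `B` is measured at `x` only, where `End(x)` is finite; saturating does not change
`B(x)`, and is allowed because nonzero elements of `S` are detected by morphisms to `x`. Then take
`N` maximal. If some `n ∉ B(x)` could not be added to `N`, the family would vanish on all elements
dying in `k[A/(B + ⟨n⟩)]`, and `Supports.enlarge` would contradict the choice of `B`. -/
theorem exists_supports (hC : IsKTrivial k C) {S : C ⥤ ModuleCat.{v} k} (hS : Simple S) {x : C}
    {ξ : S.obj x} (hξ : ξ ≠ 0) : ∃ (B : SubRep (corep x)) (N : Set ((corep x).obj.obj x)),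
      Supports S B N ∧ saturate B x = B ∧ ∀ n, n ∉ B.obj x → n ∈ N := by
  have hfin : ∀ a, Finite ((corep x).obj.obj a) := fun a => (hC x a).1
  have hcard : ∀ a, (Nat.card ((corep x).obj.obj a) : k) ≠ 0 := fun a => (hC x a).2
  obtain ⟨B, ⟨N, φ, hφ, hφB⟩, hmax⟩ := exists_maximalFor_of_wellFoundedGT
    (fun B : SubRep (corep x) => ∃ N : Set ((corep x).obj.obj x), Supports S B N)
    (fun B => B.obj x) ⟨⊥, ∅, supports_bot hξ⟩
  have hsat : Supports S (saturate B x) N := by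
    refine Supports.enlarge hcard (le_saturate B x) hφ fun a ζ hζ => ?_
    by_contra hne
    obtain ⟨f, hf⟩ := exists_map_ne_zero hS hξ hne
    rw [φ.naturality f ζ (condKer_map f ζ.2)] at hf
    refine hf (hφB _ _ ?_)
    have := rep_cosetKer_map _ f hζ
    rwa [saturate_obj] at this
  obtain ⟨N', hN', hmax'⟩ := exists_maximal_of_wellFoundedGT
    (fun N : Set ((corep x).obj.obj x) => Supports S (saturate B x) N) ⟨N, hsat⟩
  refine ⟨saturate B x, N', hN', saturate_saturate B x, fun n hn => ?_⟩
  obtain ⟨ψ, hψ, hψB⟩ := hN'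
  let X' := condKer k (saturate B x) (insert n N')
  have hle : ∀ a, X' a ≤ condKer k (saturate B x) N' a :=
    condKer_mono le_rfl (Set.subset_insert n N')
  let ψ' : SubFam X' S := ⟨fun a => (ψ.app a).comp (Submodule.inclusion (hle a)),
    fun f ζ h => ψ.naturality f ⟨ζ.1, hle _ ζ.2⟩ (hle _ h)⟩
  by_cases hψ' : ψ'.Nonzero
  · exact hmax' ⟨ψ', hψ', fun a ζ hζ => hψB a ⟨ζ.1, hle a ζ.2⟩ hζ⟩ (Set.subset_insert n N')
      (Set.mem_insert n N')
  · exfalso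
    have h1 : Supports S (saturate B x ⊔ SubRep.span n) N' := by
      refine Supports.enlarge hcard le_sup_left hψ fun a ζ hζ => ?_
      by_contra hne
      refine hψ' ⟨a, ⟨ζ.1, mem_condKer.2 fun m hm => ?_⟩, hne⟩
      rcases Set.mem_insert_iff.1 hm with rfl | hm
      · exact hζ
      · exact mem_condKer.1 ζ.2 m hm
    have h2 := hmax ⟨N', h1⟩ (((le_saturate B x).trans le_sup_left) x)
    refine hn (le_saturate B x x (h2 ?_))
    exact (le_sup_right : SubRep.span n ≤ saturate B x ⊔ SubRep.span n) x (SubRep.self_mem_span n)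

/-- A simple functor is hit by a nonzero family defined on some `Q^A`. -/
theorem exists_upperFam (hC : IsKTrivial k C) {S : C ⥤ ModuleCat.{v} k} (hS : Simple S) :
    ∃ (A : AddRep C) (φ : SubFam (upperKer k A) S), IsGenCogen A ∧ φ.Nonzero := by
  obtain ⟨x, ξ, hξ⟩ : ∃ (x : C) (ξ : S.obj x), ξ ≠ 0 := by
    obtain ⟨x, ξ, h⟩ := exists_app_ne_zero (id_nonzero S)
    exact ⟨x, ξ, h⟩
  obtain ⟨B, N, ⟨φ, hφ, hφB⟩, hsat, hN⟩ := exists_supports hC hS hξ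
  have hNB : ∀ n ∈ N, n ∉ B.obj x := fun n hn => Supports.notMem ⟨φ, hφ, hφB⟩ hn
  -- The section is neither additive nor natural, but `φ` only sees images in `k[A/B]`, so the
  -- choice does not matter.
  let s : ∀ a, B.quot.obj.obj a → (corep x).obj.obj a := fun a =>
    Function.surjInv (B.cls_surjective a)
  have hs : ∀ a q, B.cls a (s a q) = q := fun a => Function.surjInv_eq (B.cls_surjective a)
  have hmem : ∀ {a : C} {η : B.quot.obj.obj a →₀ k}, η ∈ upperKer k B.quot a →
      η.mapDomain (s a) ∈ condKer k B N a := by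
    intro a η hη
    refine mem_condKer.2 fun n hn => ?_
    have h1 : SubRep.map B.proj (B ⊔ SubRep.span n) ≠ ⊥ := by
      intro h0
      refine hNB n hn (SubRep.cls_eq_zero.1 (SubRep.eq_bot_iff_forall.1 h0 x _ ⟨n, ?_, rfl⟩))
      exact (le_sup_right : SubRep.span n ≤ B ⊔ SubRep.span n) x (SubRep.self_mem_span n)
    refine cosetKer_map _ ?_ (mem_upperKer.1 hη _ h1)
    rintro q q' ⟨y, hy, hyq⟩
    have hyq' : B.cls a y = -q + q' := hyq
    have h2 : -s a q + s a q' - y ∈ B.obj a := by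
      rw [← SubRep.cls_eq_cls, map_add, map_neg, hs, hs, hyq']
    have h3 := add_mem ((le_sup_left : B ≤ B ⊔ SubRep.span n) a h2) hy
    rwa [sub_add_cancel] at h3
  have hker : ∀ {a : C} {ζ ζ' : (corep x).obj.obj a →₀ k},
      ζ.mapDomain (B.cls a) = ζ'.mapDomain (B.cls a) → ζ - ζ' ∈ cosetKer k (B.obj a) := by
    intro a ζ ζ' h
    rw [cosetKer, LinearMap.mem_ker, map_sub, sub_eq_zero]
    exact h
  have heq : ∀ {a : C} (ζ ζ' : condKer k B N a),
      ζ.1.mapDomain (B.cls a) = ζ'.1.mapDomain (B.cls a) → φ.app a ζ = φ.app a ζ' := by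
    intro a ζ ζ' h
    rw [← sub_eq_zero, ← map_sub]
    exact hφB a _ (hker h)
  have hcs : ∀ {a : C} (η : B.quot.obj.obj a →₀ k),
      (η.mapDomain (s a)).mapDomain (B.cls a) = η := by
    intro a η
    rw [← Finsupp.mapDomain_comp, (funext (hs a) : B.cls a ∘ s a = id), Finsupp.mapDomain_id]
  refine ⟨B.quot, ⟨fun a => (φ.app a).comp ((Finsupp.lmapDomain k k (s a)).restrict
    fun η hη => hmem hη), ?_⟩, ⟨⟨x, _, (corep_isGen x).cls B⟩, x, ?_⟩, ?_⟩
  · intro a b f η h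
    refine (φ.naturality f ⟨_, hmem η.2⟩ (condKer_map f (hmem η.2))).trans (heq _ ⟨_, hmem h⟩ ?_)
    change ((η.1.mapDomain (s a)).mapDomain ((corep x).obj.map f)).mapDomain (B.cls b) =
      ((η.1.mapDomain (B.quot.obj.map f)).mapDomain (s b)).mapDomain (B.cls b)
    rw [hcs, ← Finsupp.mapDomain_comp, ← Finsupp.mapDomain_comp]
    congr 1
    funext q
    change B.cls b ((corep x).obj.map f (s a q)) = _
    rw [← SubRep.quot_map, hs]
  -- Saturation of `B` says exactly that `x` cogenerates the quotient.
  · intro c q hq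
    obtain ⟨y, rfl⟩ := B.cls_surjective c q
    rw [SubRep.cls_eq_zero, ← hsat]
    intro f
    rw [← SubRep.cls_eq_zero, ← SubRep.quot_map]
    exact hq f
  · obtain ⟨a, ζ, hζ⟩ := hφ
    -- A nonzero subfunctor `D` of the quotient contains, by cogeneration, the class of an element
    -- of `End(x)` outside `B(x)`. That element lies in `N`, and its condition on `ζ` gives the
    -- vanishing modulo `D`.
    have hη : ζ.1.mapDomain (B.cls a) ∈ upperKer k B.quot a := by
      refine mem_upperKer.2 fun D hD => ?_
      obtain ⟨c, q, hq, hq0⟩ : ∃ (c : C) (q : B.quot.obj.obj c), q ∈ D.obj c ∧ q ≠ 0 := by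
        by_contra! h
        exact hD (SubRep.eq_bot_iff_forall.2 h)
      obtain ⟨y, rfl⟩ := B.cls_surjective c q
      obtain ⟨f, hf⟩ : ∃ f : c ⟶ x, (corep x).obj.map f y ∉ B.obj x := by
        by_contra! h
        refine hq0 (SubRep.cls_eq_zero.2 ?_)
        rw [← hsat]
        exact h
      have hle : B ⊔ SubRep.span ((corep x).obj.map f y) ≤ SubRep.comap B.proj D := by
        refine sup_le (B.le_comap_proj D) (SubRep.span_le.2 ?_)
        exact D.map_mem f _ hq
      refine cosetKer_map _ (fun z z' h => ?_) (mem_condKer.1 ζ.2 _ (hN _ hf))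
      rw [← map_neg, ← map_add]
      exact hle a h
    refine ⟨a, ⟨_, hη⟩, fun h0 => hζ (Eq.trans (heq ζ ⟨_, hmem hη⟩ ?_) h0)⟩
    exact (hcs _).symm

end SubFam

/-! ### Every simple functor is some `Q(A, M)` -/

section Surjective

variable {k : Type v} [Field k] {C : Type u} [Category.{v} C] [Preadditive C]

theorem IsGenCogen.finite_aut (hC : IsKTrivial k C) {A : AddRep C} (hA : IsGenCogen A) :
    Finite (Aut A) := by
  obtain ⟨a, v, hv⟩ := hA.1
  have := hA.finite hC a
  exact Finite.of_injective (fun g : Aut A => g.hom.hom.app a v) fun g h => aut_eq_of_gen hv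

/-- Linear maps `Q^A(b) → S(b)`, as a representation of `Aut A`. -/
def famRho (A : AddRep C) (S : C ⥤ ModuleCat.{v} k) (b : C) :
    Representation k (Aut A) (upperKer k A b →ₗ[k] S.obj b) :=
  (upperRho k A b).linHom (Representation.trivial k (Aut A) (S.obj b))

theorem famRho_apply (A : AddRep C) (S : C ⥤ ModuleCat.{v} k) (b : C) (g : Aut A)
    (w : upperKer k A b →ₗ[k] S.obj b) (η : upperKer k A b) :
    famRho A S b g w η = w (upperRho k A b g⁻¹ η) := rfl

/-- The module of all families of linear maps `Q^A(b) → S(b)`. -/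
def FamModule (A : AddRep C) (S : C ⥤ ModuleCat.{v} k) :=
  ∀ b : C, upperKer k A b →ₗ[k] S.obj b

instance (A : AddRep C) (S : C ⥤ ModuleCat.{v} k) : AddCommGroup (FamModule A S) :=
  inferInstanceAs (AddCommGroup (∀ b : C, upperKer k A b →ₗ[k] S.obj b))

instance (A : AddRep C) (S : C ⥤ ModuleCat.{v} k) :
    Module (MonoidAlgebra k (Aut A)) (FamModule A S) :=
  letI (b : C) : Module (MonoidAlgebra k (Aut A)) (upperKer k A b →ₗ[k] S.obj b) :=
    Module.compHom _ (famRho A S b).asAlgebraHom.toRingHom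
  inferInstanceAs (Module (MonoidAlgebra k (Aut A)) (∀ b : C, upperKer k A b →ₗ[k] S.obj b))

/-- The component at `b` of an element of `FamModule A S`. -/
def FamModule.app {A : AddRep C} {S : C ⥤ ModuleCat.{v} k} (w : FamModule A S) (b : C) :
    upperKer k A b →ₗ[k] S.obj b := w b

theorem FamModule.of_smul_app {A : AddRep C} {S : C ⥤ ModuleCat.{v} k} (g : Aut A)
    (w : FamModule A S) (b : C) (η : upperKer k A b) :
    FamModule.app (MonoidAlgebra.of k (Aut A) g • w) b η = w.app b (upperRho k A b g⁻¹ η) := by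
  change (famRho A S b).asAlgebraHom (MonoidAlgebra.of k (Aut A) g) (w.app b) η = _
  rw [Representation.asAlgebraHom_of, famRho_apply]

theorem FamModule.algebraMap_smul_app {A : AddRep C} {S : C ⥤ ModuleCat.{v} k} (c : k)
    (w : FamModule A S) (b : C) :
    FamModule.app (algebraMap k (MonoidAlgebra k (Aut A)) c • w) b = c • w.app b := by
  change (famRho A S b).asAlgebraHom (algebraMap k _ c) (w.app b) = _
  rw [AlgHom.commutes]
  rfl

/-- The natural families. -/
def natFamModule (A : AddRep C) (S : C ⥤ ModuleCat.{v} k) :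
    Submodule (MonoidAlgebra k (Aut A)) (FamModule A S) :=
  stableSubmodule
    { carrier := {w | ∀ (a b : C) (f : a ⟶ b) (η : upperKer k A a),
        S.map f (w.app a η) = w.app b (upperMap k A f η)}
      zero_mem' := fun a b f η => map_zero (S.map f).hom
      add_mem' := fun {w w'} h h' a b f η => by
        change S.map f (w.app a η + w'.app a η) = w.app b _ + w'.app b _
        rw [map_add, h, h']
      neg_mem' := fun {w} h a b f η => by
        change S.map f (-w.app a η) = -w.app b _
        rw [map_neg, h] }
    (fun g w h a b f η => by
      rw [FamModule.of_smul_app, FamModule.of_smul_app, h a b f]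
      congr 1
      exact LinearMap.congr_fun ((upperMap k A f).isIntertwining' g⁻¹) η)
    (fun c w h a b f η => by
      rw [FamModule.algebraMap_smul_app, FamModule.algebraMap_smul_app, LinearMap.smul_apply,
        LinearMap.smul_apply, map_smul, h a b f])

/-- Under the finite-dimensional algebra `k[Aut A]`, `φ` generates an artinian module of natural
families, which contains a simple submodule `M`. Evaluation `m ⊗ η ↦ m(η)` is then a nonzero
morphism from `M ⊗ Q^A` to `S`, and `nonempty_iso_Q` applies. -/
theorem exists_iso_Q [HasBinaryBiproducts C] (hC : IsKTrivial k C) {A : AddRep C}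
    (hA : IsGenCogen A) {S : C ⥤ ModuleCat.{v} k} (hS : Simple S) (φ : SubFam (upperKer k A) S)
    (hφ : φ.Nonzero) :
    ∃ M : ModuleCat.{v} (MonoidAlgebra k (Aut A)), Simple M ∧ Nonempty (S ≅ Q A M) := by
  have := hA.finite_aut hC
  have : IsArtinianRing (MonoidAlgebra k (Aut A)) := IsArtinianRing.of_finite k _
  let w₀ : FamModule A S := fun b => φ.app b
  have hw₀ : w₀ ∈ natFamModule A S := fun a b f η => φ.naturality f η _
  let W : Submodule (MonoidAlgebra k (Aut A)) (FamModule A S) := Submodule.span _ {w₀}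
  have hW : W ≤ natFamModule A S := by
    rw [Submodule.span_le, Set.singleton_subset_iff]
    exact hw₀
  have hne : Nontrivial W := by
    rw [Submodule.nontrivial_iff_ne_bot, Ne, Submodule.span_singleton_eq_bot]
    obtain ⟨a, ζ, hζ⟩ := hφ
    intro h0
    apply hζ
    exact LinearMap.congr_fun (congrFun h0 a : w₀.app a = 0) ζ
  have : Module.Finite (MonoidAlgebra k (Aut A)) W :=
    Module.Finite.iff_fg.2 (Submodule.fg_span (Set.finite_singleton _))
  have : IsArtinian (MonoidAlgebra k (Aut A)) W := isArtinian_of_fg_of_artinian'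
  have : IsAtomic (Submodule (MonoidAlgebra k (Aut A)) W) :=
    isAtomic_of_orderBot_wellFounded_lt wellFounded_lt
  obtain ⟨P, hP⟩ := IsAtomic.exists_atom (Submodule (MonoidAlgebra k (Aut A)) W)
  -- Families are indexed by all objects of `C` and live in a larger universe; `P` is finitely
  -- generated over a finite-dimensional algebra, so it can be shrunk to the universe of `k`.
  have : Small.{v} (MonoidAlgebra k (Aut A)) := Module.Finite.small k _
  have : Small.{v} P := Module.Finite.small (MonoidAlgebra k (Aut A)) _
  have hPs : IsSimpleModule (MonoidAlgebra k (Aut A)) P := isSimpleModule_iff_isAtom.2 hP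
  let e := Shrink.linearEquiv.{v} (MonoidAlgebra k (Aut A)) P
  have hPs' : IsSimpleModule (MonoidAlgebra k (Aut A)) (Shrink.{v} P) :=
    IsSimpleModule.congr (N := P) e
  let M := ModuleCat.of (MonoidAlgebra k (Aut A)) (Shrink.{v} P)
  have hM : Simple M := simple_iff_isSimpleModule.2 hPs'
  let fam : M →ₗ[MonoidAlgebra k (Aut A)] FamModule A S :=
    W.subtype ∘ₗ P.subtype ∘ₗ e.toLinearMap
  have hfam : ∀ m, fam m ∈ natFamModule A S := fun m => hW (e m).1.2
  let ψ : ∀ b, repOf M →ₗ[k] upperKer k A b →ₗ[k] S.obj b := fun b =>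
    { toFun := fun m => (fam m).app b
      map_add' := fun m m' => congrArg (fun w => FamModule.app w b) (fam.map_add m m')
      map_smul' := fun c m =>
        (congrArg (fun w => FamModule.app w b) (fam.map_smul (algebraMap k _ c) m)).trans
          (FamModule.algebraMap_smul_app c (fam m) b) }
  have hψ : ∀ (b : C) (g : Aut A) (m : repOf M) (η : upperKer k A b),
      ψ b ((repOf M).ρ g m) (upperRho k A b g η) = ψ b m η := by
    intro b g m η
    have h1 := congrArg (fun w => FamModule.app w b (upperRho k A b g η))
      (fam.map_smul (MonoidAlgebra.of k (Aut A) g) m)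
    refine h1.trans ((FamModule.of_smul_app g (fam m) b _).trans ?_)
    rw [Representation.inv_self_apply]
    rfl
  let ρ : upperTensor A M ⟶ S :=
    { app := fun b => ModuleCat.ofHom (tlift M (upperObj k A b) (ψ b) (hψ b))
      naturality := fun a b f => by
        ext t
        induction t using umk_induction with
        | h0 => rw [map_zero, map_zero]
        | hadd s t hs ht => rw [map_add, map_add, hs, ht]
        | h m η => exact (hfam m a b f η).symm }
  refine ⟨M, hM, nonempty_iso_Q hC hA hM hS ρ fun h0 => ?_⟩
  have := IsSimpleModule.nontrivial (MonoidAlgebra k (Aut A)) P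
  obtain ⟨p, hp⟩ := exists_ne (0 : P)
  apply hp
  refine Subtype.ext (Subtype.ext (funext fun b => LinearMap.ext fun η => ?_))
  have h1 : ρ.app b (umk A M b (e.symm p) η) = (fam (e.symm p)).app b η := rfl
  have h2 : fam (e.symm p) = p.1.1 := congrArg (fun p : P => p.1.1) (e.apply_symm_apply p)
  rw [h2, h0] at h1
  exact h1.symm

theorem upperKer_iso {A A' : AddRep C} (e : A ≅ A') {a : C} {η : A.obj.obj a →₀ k}
    (hη : η ∈ upperKer k A a) : η.mapDomain (e.hom.hom.app a) ∈ upperKer k A' a := by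
  refine mem_upperKer.2 fun B hB => ?_
  refine cosetKer_map _ (N := (SubRep.comap e.hom B).obj a) (fun y z h => ?_)
    (mem_upperKer.1 hη _ fun h => hB ?_)
  · rw [← map_neg, ← map_add]
    exact h
  · exact (map_eq_bot_iff (subRepOrderIso e.symm)).1 h

/-- Transport of a family along an isomorphism. -/
def SubFam.ofIso {A A' : AddRep C} (e : A' ≅ A) {S : C ⥤ ModuleCat.{v} k}
    (φ : SubFam (upperKer k A) S) : SubFam (upperKer k A') S where
  app a := (φ.app a).comp ((Finsupp.lmapDomain k k (e.hom.hom.app a)).restrict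
    fun _ hη => upperKer_iso e hη)
  naturality {a b} f η h := by
    refine (φ.naturality f _ (upperKer_map k A f (upperKer_iso e η.2))).trans ?_
    change φ.app b ⟨(η.1.mapDomain _).mapDomain _, _⟩ = φ.app b ⟨(η.1.mapDomain _).mapDomain _, _⟩
    congr 2
    rw [← Finsupp.mapDomain_comp, ← Finsupp.mapDomain_comp]
    congr 1
    funext y
    exact (rep_naturality e.hom f y).symm

theorem SubFam.Nonzero.ofIso {A A' : AddRep C} (e : A' ≅ A) {S : C ⥤ ModuleCat.{v} k}
    {φ : SubFam (upperKer k A) S} (hφ : φ.Nonzero) : (φ.ofIso e).Nonzero := by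
  obtain ⟨a, ζ, hζ⟩ := hφ
  refine ⟨a, ⟨_, upperKer_iso e.symm ζ.2⟩, fun h0 => hζ (Eq.trans ?_ h0)⟩
  change φ.app a ζ = φ.app a ⟨(ζ.1.mapDomain _).mapDomain _, _⟩
  congr 1
  refine Subtype.ext ?_
  change ζ.1 = (ζ.1.mapDomain _).mapDomain _
  rw [← Finsupp.mapDomain_comp]
  have h1 : (e.hom.hom.app a ∘ e.symm.hom.hom.app a : A.obj.obj a → A.obj.obj a) = id := by
    funext y
    have h : (e.inv ≫ e.hom).hom.app a y = y := by rw [e.inv_hom_id]; rfl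
    exact h
  rw [h1, Finsupp.mapDomain_id]

end Surjective

/-! ### Locally finite categories of representations -/

section LocallyFinite

/-- The elements below `b` satisfy both chain conditions. -/
def FinBelow {α : Type*} [PartialOrder α] (b : α) : Prop :=
  WellFoundedGT (Set.Iic b) ∧ WellFoundedLT (Set.Iic b)

/-- The map `x ↦ (x ⊓ b, (x ⊔ b) ⊓ b')` is strictly monotone: by modularity its second component
determines `x ⊔ b`, and comparable elements with the same meet and join with `b` are equal. -/
theorem FinBelow.sup {α : Type*} [Lattice α] [IsModularLattice α] {b b' : α} (h : FinBelow b)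
    (h' : FinBelow b') : FinBelow (b ⊔ b') := by
  have := h.1
  have := h.2
  have := h'.1
  have := h'.2
  let f : Set.Iic (b ⊔ b') → Set.Iic b × Set.Iic b' := fun x =>
    (⟨x.1 ⊓ b, inf_le_right⟩, ⟨(x.1 ⊔ b) ⊓ b', inf_le_right⟩)
  have hmono : Monotone f := fun x y hxy =>
    ⟨inf_le_inf_right b hxy, inf_le_inf_right b' (sup_le_sup_right (Subtype.coe_le_coe.2 hxy) b)⟩
  have hrec : ∀ x : Set.Iic (b ⊔ b'), b ⊔ (f x).2.1 = x.1 ⊔ b := fun x => by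
    change b ⊔ (x.1 ⊔ b) ⊓ b' = x.1 ⊔ b
    rw [inf_comm, ← sup_inf_assoc_of_le b' (le_sup_right : b ≤ x.1 ⊔ b),
      inf_eq_right]
    exact sup_le x.2 le_sup_left
  have hf : StrictMono f := by
    intro x y hxy
    refine lt_of_le_of_ne (hmono hxy.le) fun heq => hxy.ne (Subtype.ext ?_)
    have h1 : x.1 ⊓ b = y.1 ⊓ b := congrArg (fun p => p.1.1) heq
    have h2 : x.1 ⊔ b = y.1 ⊔ b := by rw [← hrec x, ← hrec y, heq]
    exact eq_of_le_of_inf_le_of_sup_le hxy.le h1.ge h2.ge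
  exact ⟨hf.wellFoundedGT, hf.wellFoundedLT⟩

variable {C : Type u} [Category.{v} C] [Preadditive C]

theorem IsFiniteRep.finBelow_map {A G : AddRep C} (hG : IsFiniteRep G) (h : G ⟶ A) :
    FinBelow (SubRep.map h ⊤) := by
  have := hG.1
  have := hG.2
  have hf : StrictMono fun U : Set.Iic (SubRep.map h ⊤) => SubRep.comap h U.1 := by
    refine Monotone.strictMono_of_injective (fun U V hUV => SubRep.comap_mono h hUV)
      fun U V hUV => ?_
    have key : ∀ W : Set.Iic (SubRep.map h ⊤), SubRep.map h (SubRep.comap h W.1) = W.1 := by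
      intro W
      refine le_antisymm (SubRep.map_le_iff.2 le_rfl) fun a y hy => ?_
      obtain ⟨z, -, rfl⟩ := W.2 a hy
      exact ⟨z, hy, rfl⟩
    have hUV' : SubRep.comap h U.1 = SubRep.comap h V.1 := hUV
    exact Subtype.ext (by rw [← key U, ← key V, hUV'])
  exact ⟨hf.wellFoundedGT, hf.wellFoundedLT⟩

/-- The subfunctors with both chain conditions below them form a directed family. If `U` bounds it,
then `A ⟶ A/U` vanishes on every morphism from a finite object, hence is zero, and `U = A`. Finite
generation puts `A` itself in the family. -/
theorem IsFinGen.isFiniteRep (hsep : (IsFiniteRep : ObjectProperty (AddRep C)).IsSeparating)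
    {A : AddRep C} (hA : IsFinGen A) : IsFiniteRep A := by
  have htop : FinBelow (⊤ : SubRep A) := by
    refine hA {B | FinBelow B} ⟨⊥, ?_⟩ (fun B hB B' hB' =>
      ⟨B ⊔ B', hB.sup hB', le_sup_left, le_sup_right⟩) ⟨fun B _ => le_top, fun U hU => ?_⟩
    · have : Subsingleton (Set.Iic (⊥ : SubRep A)) :=
        ⟨fun U V => Subtype.ext ((le_bot_iff.1 U.2).trans (le_bot_iff.1 V.2).symm)⟩
      exact ⟨inferInstance, inferInstance⟩
    · let z : A ⟶ U.quot := ⟨0⟩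
      have h0 : U.proj = z := by
        refine hsep _ _ fun G hG h => ?_
        refine ObjectProperty.hom_ext _ ?_
        ext a y
        change U.cls a (h.hom.app a y) = 0
        rw [SubRep.cls_eq_zero]
        exact hU (hG.finBelow_map h) a ⟨y, SubRep.mem_top y, rfl⟩
      intro a y _
      rw [← SubRep.cls_eq_zero, ← SubRep.proj_app, h0]
      rfl
  have := htop.1
  have := htop.2
  have hf : StrictMono fun U : SubRep A => (⟨U, (le_top : U ≤ ⊤)⟩ : Set.Iic (⊤ : SubRep A)) :=
    fun _ _ h => h
  exact ⟨hf.wellFoundedGT, hf.wellFoundedLT⟩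

end LocallyFinite

/-! ### The classification -/

section Main

theorem Irr.exists_mk {E : Type u} [Category.{w} E] [HasZeroMorphisms E] (q : Irr E) :
    ∃ (X : E) (hX : Simple X), Irr.mk X hX = q := by
  obtain ⟨⟨X, hX⟩, rfl⟩ := Quotient.exists_rep q
  exact ⟨X, hX, rfl⟩

theorem Irr.mk_eq_mk {E : Type u} [Category.{w} E] [HasZeroMorphisms E] {X Y : E} {hX : Simple X}
    {hY : Simple Y} : Irr.mk X hX = Irr.mk Y hY ↔ Nonempty (X ≅ Y) :=
  Quotient.eq (r := simpleSetoid E)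

variable {k : Type v} [Field k] {C : Type u} [Category.{v} C] [Preadditive C]

theorem IsSystemOfReps.unique {L : ℕ → Set (AddRep C)} (hL : IsSystemOfReps L) {n n' : ℕ}
    {A A' : AddRep C} (hA : A ∈ L n) (hA' : A' ∈ L n') (e : A ≅ A') : n = n' ∧ A = A' := by
  obtain ⟨hf, hl⟩ := (hL n).1 A hA
  obtain ⟨hf', hl'⟩ := (hL n').1 A' hA'
  obtain rfl : n = n' := le_antisymm ((hl.of_iso e).le (hl'.lenLE hf'))
    ((hl'.of_iso e.symm).le (hl.lenLE hf))
  exact ⟨rfl, ((hL n).2 A hf hl).unique ⟨hA, ⟨Iso.refl A⟩⟩ ⟨hA', ⟨e⟩⟩⟩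

variable [HasBinaryBiproducts C]

/-- `F_d` is closed under subobjects, so it contains the kernel computed in the ambient category.
For this reason simplicity means the same in both categories. -/
theorem Fd_mono_hom (hC : IsKTrivial k C) {d : ℕ} {X Y : (Fd k C d).FullSubcategory} (i : X ⟶ Y)
    [Mono i] : Mono i.hom := by
  refine Preadditive.mono_of_kernel_zero ?_
  let K : (Fd k C d).FullSubcategory := ⟨kernel i.hom, Fd_of_mono hC (kernel.ι i.hom) X.property⟩
  let j : K ⟶ X := ⟨kernel.ι i.hom⟩
  have h : j ≫ i = (⟨0⟩ : K ⟶ X) ≫ i := by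
    refine ObjectProperty.hom_ext _ ?_
    change kernel.ι i.hom ≫ i.hom = 0 ≫ i.hom
    rw [kernel.condition, zero_comp]
  exact congrArg (fun f => f.hom) ((cancel_mono i).1 h)

theorem simple_Fd_iff (hC : IsKTrivial k C) {d : ℕ} (X : (Fd k C d).FullSubcategory) :
    Simple X ↔ Simple X.obj := by
  constructor
  · intro hX
    refine ⟨fun {Y} i _ => ?_⟩
    let Y' : (Fd k C d).FullSubcategory := ⟨Y, Fd_of_mono hC i X.property⟩
    let i' : Y' ⟶ X := ⟨i⟩
    have : Mono i' := (Fd k C d).ι.mono_of_mono_map (inferInstanceAs (Mono i))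
    have h := hX.mono_isIso_iff_nonzero i'
    have h1 : IsIso i' ↔ IsIso i := (isIso_iff_of_reflects_iso i' (Fd k C d).ι).symm
    have h2 : i' = 0 ↔ i = 0 :=
      ⟨fun h => congrArg (fun f => f.hom) h, fun h => ObjectProperty.hom_ext _ h⟩
    rw [← h1, h, Ne, h2]
  · intro hX
    refine ⟨fun {Y} i _ => ?_⟩
    have := Fd_mono_hom hC i
    have h := hX.mono_isIso_iff_nonzero i.hom
    have h1 : IsIso i.hom ↔ IsIso i := isIso_iff_of_reflects_iso i (Fd k C d).ι
    have h2 : i = 0 ↔ i.hom = 0 :=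
      ⟨fun h => congrArg (fun f => f.hom) h, fun h => ObjectProperty.hom_ext _ h⟩
    rw [← h1, h, Ne, Ne, h2]

theorem IsSystemOfReps.Fd_Q (hC : IsKTrivial k C) {L : ℕ → Set (AddRep C)} (hL : IsSystemOfReps L)
    {d n : ℕ} (hn : n ≤ d) (A : L n) (M : ModuleCat.{v} (MonoidAlgebra k (Aut A.1))) :
    Fd k C d (Q A.1 M) :=
  AntiPoly.Fd_Q hC ((HasLength.lenLE ((hL n).1 A A.2).1 ((hL n).1 A A.2).2).mono hn) M

variable [HasZeroObject C]

theorem exists_rep_iso_Q (hC : IsKTrivial k C) {L : ℕ → Set (AddRep C)} (hL : IsSystemOfReps L)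
    {S : C ⥤ ModuleCat.{v} k} (hS : Simple S)
    (hfin : ∀ (A : AddRep C) (M : ModuleCat.{v} (MonoidAlgebra k (Aut A))), IsGenCogen A →
      Simple M → Nonempty (S ≅ Q A M) → IsFiniteRep A) :
    ∃ (n : ℕ) (A : AddRep C) (M : ModuleCat.{v} (MonoidAlgebra k (Aut A))), A ∈ L n ∧ Simple M ∧
      Nonempty (S ≅ Q A M) := by
  obtain ⟨A, φ, hA, hφ⟩ := exists_upperFam hC hS
  obtain ⟨M, hM, e⟩ := exists_iso_Q hC hA hS φ hφ
  have hAf := hfin A M hA hM e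
  obtain ⟨n, hn⟩ := hAf.exists_hasLength
  obtain ⟨B, ⟨hB, ⟨ε⟩⟩, -⟩ := (hL n).2 A hAf hn
  -- The family is transported to the representative `B` and a module over `Aut B` is extracted
  -- afresh, which avoids transporting `M` itself.
  obtain ⟨M', hM', e'⟩ := exists_iso_Q hC ((hL n).1 B hB).1.isGenCogen hS _ (hφ.ofIso ε.symm)
  exact ⟨n, B, M', hB, hM', e'⟩

theorem Irr.mk_eq_of_Q_iso (hC : IsKTrivial k C) {L : ℕ → Set (AddRep C)} (hL : IsSystemOfReps L)
    {n n' : ℕ} {A A' : AddRep C} (hA : A ∈ L n) (hA' : A' ∈ L n')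
    {M : ModuleCat.{v} (MonoidAlgebra k (Aut A))} {M' : ModuleCat.{v} (MonoidAlgebra k (Aut A'))}
    (hM : Simple M) (hM' : Simple M') (e : Q A M ≅ Q A' M') :
    n = n' ∧ A = A' ∧ Irr.mk M hM ≍ Irr.mk M' hM' := by
  have hAf := ((hL n).1 A hA).1.isGenCogen
  have hAf' := ((hL n').1 A' hA').1.isGenCogen
  obtain ⟨ε⟩ := nonempty_iso_of_Q_iso hC hAf' hAf hM' hM e
  obtain ⟨rfl, rfl⟩ := hL.unique hA hA' ε.symm
  exact ⟨rfl, rfl, heq_of_eq (Irr.mk_eq_mk.2 (nonempty_module_iso_of_Q_iso hC hAf hM' hM e))⟩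

theorem IsSystemOfReps.isGenCogen {L : ℕ → Set (AddRep C)} (hL : IsSystemOfReps L) {n : ℕ}
    (A : L n) : IsGenCogen A.1 :=
  ((hL n).1 A A.2).1.isGenCogen

theorem IsSystemOfReps.simple_Fd_Q (hC : IsKTrivial k C) {L : ℕ → Set (AddRep C)}
    (hL : IsSystemOfReps L) {d n : ℕ} (hn : n ≤ d) (A : L n)
    {M : ModuleCat.{v} (MonoidAlgebra k (Aut A.1))} (hM : Simple M) :
    Simple (⟨Q A.1 M, hL.Fd_Q hC hn A M⟩ : (Fd k C d).FullSubcategory) :=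
  (simple_Fd_iff hC _).2 (simple_Q hC (hL.isGenCogen A) hM)

/-- The map `(n, A, [M]) ↦ [Q(A, M)]` with values in the simple objects of `F_d`. -/
def classifyFd (hC : IsKTrivial k C) {L : ℕ → Set (AddRep C)} (hL : IsSystemOfReps L) (d : ℕ)
    (p : Σ (n : Set.Iic d) (A : L n), Irr (ModuleCat.{v} (MonoidAlgebra k (Aut A.1)))) :
    Irr (Fd k C d).FullSubcategory :=
  Quotient.lift (fun M : {M // Simple M} => Irr.mk _ (hL.simple_Fd_Q hC p.1.2 p.2.1 M.2))
    (fun M M' h => by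
      obtain ⟨e⟩ := h
      obtain ⟨ε⟩ := nonempty_iso_Q_of_iso hC (hL.isGenCogen p.2.1) M.2 M'.2 e
      exact Irr.mk_eq_mk.2 ⟨(Fd k C d).fullyFaithfulι.preimageIso ε⟩) p.2.2

theorem classifyFd_mk (hC : IsKTrivial k C) {L : ℕ → Set (AddRep C)} (hL : IsSystemOfReps L)
    {d : ℕ} (n : Set.Iic d) (A : L n) {M : ModuleCat.{v} (MonoidAlgebra k (Aut A.1))}
    (hM : Simple M) :
    classifyFd hC hL d ⟨n, A, Irr.mk M hM⟩ = Irr.mk _ (hL.simple_Fd_Q hC n.2 A hM) := rfl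

theorem classifyFd_injective (hC : IsKTrivial k C) {L : ℕ → Set (AddRep C)}
    (hL : IsSystemOfReps L) (d : ℕ) : Function.Injective (classifyFd hC hL d) := by
  rintro ⟨⟨n, hn⟩, ⟨A, hA⟩, q⟩ ⟨⟨n', hn'⟩, ⟨A', hA'⟩, q'⟩ h
  obtain ⟨M, hM, rfl⟩ := q.exists_mk
  obtain ⟨M', hM', rfl⟩ := q'.exists_mk
  rw [classifyFd_mk, classifyFd_mk] at h
  obtain ⟨e⟩ := Irr.mk_eq_mk.1 h
  obtain ⟨rfl, rfl, h⟩ := Irr.mk_eq_of_Q_iso hC hL hA hA' hM hM' ((Fd k C d).ι.mapIso e)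
  rw [eq_of_heq h]

/-- Membership in `F_d` bounds the length of any `A` with `S ≅ Q(A, M)`; this gives both the
finiteness of `A` and `n ≤ d`. -/
theorem classifyFd_surjective (hC : IsKTrivial k C) {L : ℕ → Set (AddRep C)}
    (hL : IsSystemOfReps L) (d : ℕ) : Function.Surjective (classifyFd hC hL d) := by
  intro q
  obtain ⟨S, hS, rfl⟩ := Irr.exists_mk q
  have hlen : ∀ (A : AddRep C) (M : ModuleCat.{v} (MonoidAlgebra k (Aut A))), IsGenCogen A →
      Simple M → Nonempty (S.obj ≅ Q A M) → LenLE A d := fun A M hA hM ⟨e⟩ =>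
    lenLE_of_Fd hC hA hM (Fd_of_mono hC e.inv S.property)
  obtain ⟨n, A, M, hA, hM, e⟩ := exists_rep_iso_Q hC hL ((simple_Fd_iff hC S).1 hS)
    fun A M hA hM e => (hlen A M hA hM e).isFiniteRep
  have hn : n ≤ d := ((hL n).1 A hA).2.le (hlen A M (hL.isGenCogen ⟨A, hA⟩) hM e)
  obtain ⟨e⟩ := e
  refine ⟨⟨⟨n, hn⟩, ⟨A, hA⟩, Irr.mk M hM⟩, ?_⟩
  rw [classifyFd_mk]
  exact Irr.mk_eq_mk.2 ⟨(Fd k C d).fullyFaithfulι.preimageIso e.symm⟩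

/-- The map `(n, A, [M]) ↦ [Q(A, M)]`. -/
def classify (hC : IsKTrivial k C) {L : ℕ → Set (AddRep C)} (hL : IsSystemOfReps L)
    (p : Σ (n : ℕ) (A : L n), Irr (ModuleCat.{v} (MonoidAlgebra k (Aut A.1)))) :
    Irr (C ⥤ ModuleCat.{v} k) :=
  Quotient.lift (fun M : {M // Simple M} => Irr.mk _ (simple_Q hC (hL.isGenCogen p.2.1) M.2))
    (fun M M' h => by
      obtain ⟨e⟩ := h
      exact Irr.mk_eq_mk.2 (nonempty_iso_Q_of_iso hC (hL.isGenCogen p.2.1) M.2 M'.2 e)) p.2.2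

theorem classify_mk (hC : IsKTrivial k C) {L : ℕ → Set (AddRep C)} (hL : IsSystemOfReps L)
    {n : ℕ} (A : L n) {M : ModuleCat.{v} (MonoidAlgebra k (Aut A.1))} (hM : Simple M) :
    classify hC hL ⟨n, A, Irr.mk M hM⟩ = Irr.mk _ (simple_Q hC (hL.isGenCogen A) hM) := rfl

theorem classify_injective (hC : IsKTrivial k C) {L : ℕ → Set (AddRep C)}
    (hL : IsSystemOfReps L) : Function.Injective (classify hC hL) := by
  rintro ⟨n, ⟨A, hA⟩, q⟩ ⟨n', ⟨A', hA'⟩, q'⟩ h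
  obtain ⟨M, hM, rfl⟩ := q.exists_mk
  obtain ⟨M', hM', rfl⟩ := q'.exists_mk
  rw [classify_mk, classify_mk] at h
  obtain ⟨e⟩ := Irr.mk_eq_mk.1 h
  obtain ⟨rfl, rfl, h⟩ := Irr.mk_eq_of_Q_iso hC hL hA hA' hM hM' e
  rw [eq_of_heq h]

theorem classify_surjective (hC : IsKTrivial k C) {L : ℕ → Set (AddRep C)}
    (hL : IsSystemOfReps L)
    (hfin : ∀ A : AddRep C, IsFinGen A → IsFinCogen A → IsFiniteRep A) :
    Function.Surjective (classify hC hL) := by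
  intro q
  obtain ⟨S, hS, rfl⟩ := Irr.exists_mk q
  obtain ⟨n, A, M, hA, hM, ⟨e⟩⟩ := exists_rep_iso_Q hC hL hS fun A M hA hM e => by
    have := hA.finite hC
    obtain ⟨⟨a, v, hv⟩, b, hb⟩ := hA
    exact hfin A hv.isFinGen hb.isFinCogen
  refine ⟨⟨n, ⟨A, hA⟩, Irr.mk M hM⟩, ?_⟩
  rw [classify_mk]
  exact Irr.mk_eq_mk.2 ⟨e.symm⟩

end Main

end

end AntiPoly

theorem mainTheorem2 (k : Type v) [Field k] (C : Type u) [Category.{v} C] [Preadditive C]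
    [HasZeroObject C] [HasBinaryBiproducts C] [EssentiallySmall.{v} C] (hC : AntiPoly.IsKTrivial k C)
    (L : ℕ → Set (AntiPoly.AddRep C)) (hL : AntiPoly.IsSystemOfReps L) :
    (∀ (A : AntiPoly.AddRep C) (M : ModuleCat.{v} (MonoidAlgebra k (Aut A))),
      AntiPoly.IsFiniteRep A → Simple M → Simple (AntiPoly.Q A M)) ∧
    (∀ d : ℕ,
      ∃ φ : (Σ (n : Set.Iic d) (A : L n),
            AntiPoly.Irr (ModuleCat.{v} (MonoidAlgebra k (Aut A.1)))) →
          AntiPoly.Irr (AntiPoly.Fd k C d).FullSubcategory,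
        Function.Bijective φ ∧
        ∀ (n : Set.Iic d) (A : L n) (M : ModuleCat.{v} (MonoidAlgebra k (Aut A.1)))
          (hM : Simple M),
          ∃ (hd : AntiPoly.Fd k C d (AntiPoly.Q A.1 M))
            (hs : Simple (⟨AntiPoly.Q A.1 M, hd⟩ : (AntiPoly.Fd k C d).FullSubcategory)),
            φ ⟨n, A, AntiPoly.Irr.mk M hM⟩ = AntiPoly.Irr.mk ⟨AntiPoly.Q A.1 M, hd⟩ hs) ∧
    ((∀ A : AntiPoly.AddRep C,
        AntiPoly.IsFinGen A → AntiPoly.IsFinCogen A → AntiPoly.IsFiniteRep A) →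
      ∃ φ : (Σ (n : ℕ) (A : L n),
            AntiPoly.Irr (ModuleCat.{v} (MonoidAlgebra k (Aut A.1)))) →
          AntiPoly.Irr (C ⥤ ModuleCat.{v} k),
        Function.Bijective φ ∧
        ∀ (n : ℕ) (A : L n) (M : ModuleCat.{v} (MonoidAlgebra k (Aut A.1))) (hM : Simple M),
          ∃ hs : Simple (AntiPoly.Q A.1 M),
            φ ⟨n, A, AntiPoly.Irr.mk M hM⟩ = AntiPoly.Irr.mk (AntiPoly.Q A.1 M) hs) ∧
    ((AntiPoly.IsFiniteRep : ObjectProperty (AntiPoly.AddRep C)).IsSeparating →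
      ∀ A : AntiPoly.AddRep C,
        AntiPoly.IsFinGen A → AntiPoly.IsFinCogen A → AntiPoly.IsFiniteRep A) := by
  refine ⟨fun A M hA hM => AntiPoly.simple_Q hC hA.isGenCogen hM, fun d => ?_, fun hfin => ?_,
    fun hsep A hA _ => hA.isFiniteRep hsep⟩
  · exact ⟨AntiPoly.classifyFd hC hL d,
      ⟨AntiPoly.classifyFd_injective hC hL d, AntiPoly.classifyFd_surjective hC hL d⟩,
      fun n A M hM => ⟨hL.Fd_Q hC n.2 A M, hL.simple_Fd_Q hC n.2 A hM,
        AntiPoly.classifyFd_mk hC hL n A hM⟩⟩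
  · exact ⟨AntiPoly.classify hC hL,
      ⟨AntiPoly.classify_injective hC hL, AntiPoly.classify_surjective hC hL hfin⟩,
      fun n A M hM => ⟨AntiPoly.simple_Q hC (hL.isGenCogen A) hM,
        AntiPoly.classify_mk hC hL A hM⟩⟩
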